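/- **Theorem (Uniform separation).** Let $Q:\mathbb{C}\to\mathbb{R}\cup\{+\infty\}$ be lower semicontinuous, finite on some set of positive logarithmic capacity, with $\liminf_{\zeta\to\infty} Q(\zeta)/(2\log|\zeta|)>1$. Let $\sigma$ be the equilibrium measure of $Q$, i.e. the minimizer of $$I_Q[\mu]=\iint\log\frac1{|\zeta-\eta|}\,d\mu(\zeta)\,d\mu(\eta)+\int Q\,d\mu$$ over all compactly supported Borel probability measures $\mu$ on $\mathbb{C}$, and let $S=\operatorname{supp}\sigma$ (the droplet). Assume that $Q$ is finite and $C^2$-smooth in a neighbourhood of $S$, and, with $\Delta=\tfrac14(\partial_{xx}+\partial_{yy})$, that 1. $\Delta Q>0$ in a neighbourhood of $\partial S$; 2. $\partial S$ has finitely many connected components; 3. each component of $\partial S$ is an everywhere $C^1$-smooth Jordan curve; 4. for every $\zeta\in\mathbb{C}\setminus S$, $Q(\zeta)>\sup f(\zeta)$, the supremum being taken over all subharmonic functions $f$ on $\mathbb{C}$ with $f\le Q$ everywhere and $f(z)\le\log|z|^2+O(1)$ as $z\to\infty$. For $n\ge1$ and real $\beta$ let $$H_n=\sum_{j\ne k}\log\frac1{|\zeta_j-\zeta_k|}+n\sum_{j=1}^nQ(\zeta_j),$$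 let $dA=\tfrac1\pi\,dx\,dy$, and let $\mathbf{P}_n^{\beta}$ be the Boltzmann–Gibbs probability measure on $\mathbb{C}^n$ with density $\frac1{Z_n^\beta}e^{-\beta H_n}$ with respect to $dA^{\otimes n}$, defined whenever $0<Z_n^\beta=\int e^{-\beta H_n}\,dA^{\otimes n}<\infty$. For a configuration $\boldsymbol\zeta_n=\{\zeta_j\}_1^n$ let $s_n(\boldsymbol\zeta_n)=\sqrt n\,\min_{j\ne k}|\zeta_j-\zeta_k|$ (with $s_1=+\infty$). Then: (i) There is a constant $m>0$, depending only on $Q$, such that for every $c>0$ and every sequence $(\beta_n)_{n\ge1}$ with $\beta_n\ge c\log n$ for which all the measures $\mathbf{P}_n^{\beta_n}$ are defined, almost every family $(\boldsymbol\zeta_n)_{n\ge1}$ with respect to the product measure $\prod_{n\ge1}\mathbf{P}_n^{\beta_n}$ satisfies $$\liminf_{n\to\infty}s_n(\boldsymbol\zeta_n)\ \ge\ s_0(c):=m\,e^{-3/(2c)}>0.$$ (ii) There are constants $a,b>0$, depending only on $Q$, such that for all $\beta\ge\tfrac12$, all $n\ge1$ for which $\mathbf{P}_n^\beta$ is defined,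 and all $\lambda>0$, $$\mathbf{P}_n^{\beta}\bigl(s_n\ge a\lambda^{-1/(2\beta)}\bigr)\ \ge\ 1-b\,\frac n\lambda .$$ -/

import Mathlib

open MeasureTheory Filter Topology
open scoped ENNReal NNReal

namespace CoulombGas

noncomputable section

/-- The integral of an extended-real valued function, as positive part minus negative part. It is
used only where the positive part or the negative part has finite integral. -/
def eintegral {α : Type*} [MeasurableSpace α] (μ : Measure α) (f : α → EReal) : EReal :=
  ((∫⁻ x, (f x).toENNReal ∂μ : ℝ≥0∞) : EReal) - ((∫⁻ x, (-f x).toENNReal ∂μ : ℝ≥0∞) : EReal)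

/-- The logarithmic kernel `log (1 / |z - w|)`, equal to `+∞` on the diagonal. -/
def logKernel (z w : ℂ) : EReal := -ENNReal.log (edist z w)

/-! ### Potential theory -/

/-- A Borel probability measure on `ℂ` with compact support. -/
def IsCompactProb (μ : Measure ℂ) : Prop :=
  IsProbabilityMeasure μ ∧ ∃ K : Set ℂ, IsCompact K ∧ μ Kᶜ = 0

/-- The logarithmic energy `∫∫ log (1 / |z - w|) dμ(z) dμ(w)`. -/
def logEnergy (μ : Measure ℂ) : EReal :=
  eintegral (μ.prod μ) (fun p => logKernel p.1 p.2)

/-- The set `E` has positive (inner) logarithmic capacity: some compact subset of `E` carries a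
probability measure of finite logarithmic energy. -/
def HasPositiveCapacity (E : Set ℂ) : Prop :=
  ∃ K : Set ℂ, IsCompact K ∧ K ⊆ E ∧
    ∃ μ : Measure ℂ, IsProbabilityMeasure μ ∧ μ Kᶜ = 0 ∧ logEnergy μ < ⊤

/-- Standing assumptions on an external potential `Q : ℂ → ℝ ∪ {+∞}`. -/
structure IsExternalPotential (Q : ℂ → EReal) : Prop where
  ne_bot : ∀ z, Q z ≠ ⊥
  lsc : LowerSemicontinuous Q
  capacity : HasPositiveCapacity {z | Q z ≠ ⊤}
  growth : 1 < liminf (fun z : ℂ => Q z / ((2 * Real.log ‖z‖ : ℝ) : EReal))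
    (Bornology.cobounded ℂ)

/-- The weighted energy `I_Q[μ] = ∫∫ log (1 / |z - w|) dμ dμ + ∫ Q dμ`. -/
def weightedEnergy (Q : ℂ → EReal) (μ : Measure ℂ) : EReal :=
  logEnergy μ + eintegral μ Q

/-- `σ` is an equilibrium measure in the external potential `Q`: it minimizes `I_Q` over all
compactly supported Borel probability measures. The droplet is then `σ.support`. -/
def IsEquilibriumMeasure (Q : ℂ → EReal) (σ : Measure ℂ) : Prop :=
  IsCompactProb σ ∧ ∀ μ : Measure ℂ, IsCompactProb μ → weightedEnergy Q σ ≤ weightedEnergy Q μ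

/-- Subharmonic functions on the whole plane (the constant `-∞` is allowed). -/
structure IsSubharmonic (f : ℂ → EReal) : Prop where
  ne_top : ∀ z, f z ≠ ⊤
  usc : UpperSemicontinuous f
  submean : ∀ (z : ℂ) (r : ℝ), 0 < r →
    f z ≤ (((2 * Real.pi)⁻¹ : ℝ) : EReal) *
      eintegral (volume.restrict (Set.Ioc 0 (2 * Real.pi))) (fun θ : ℝ => f (circleMap z r θ))

/-- The competitors in the obstacle problem for `Q`: subharmonic functions `f ≤ Q` with
`f z ≤ log |z|² + O(1)` as `z → ∞`. -/
def obstacleClass (Q : ℂ → EReal) : Set (ℂ → EReal) :=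
  {f | IsSubharmonic f ∧ (∀ z, f z ≤ Q z) ∧
    ∃ C : ℝ, ∀ᶠ z in Bornology.cobounded ℂ, f z ≤ ((Real.log (‖z‖ ^ 2) + C : ℝ) : EReal)}

/-- One quarter of the standard Laplacian, `∂∂̄ = (∂ₓₓ + ∂ᵧᵧ) / 4`. -/
def quarterLaplacian (q : ℂ → ℝ) (z : ℂ) : ℝ := (1 / 4) * Laplacian.laplacian q z

/-- `Q` is finite and `C²`-smooth in a neighbourhood of `S`. -/
def IsC2Near (Q : ℂ → EReal) (S : Set ℂ) : Prop :=
  ∃ U : Set ℂ, IsOpen U ∧ S ⊆ U ∧ (∀ z ∈ U, Q z ≠ ⊤) ∧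
    ContDiffOn ℝ 2 (fun z => (Q z).toReal) U

/-- An everywhere `C¹`-smooth Jordan curve: the trace of a `C¹` closed curve that is regular
and simple. -/
def IsC1JordanCurve (J : Set ℂ) : Prop :=
  ∃ γ : ℝ → ℂ, ContDiff ℝ 1 γ ∧ Function.Periodic γ 1 ∧ (∀ t, deriv γ t ≠ 0) ∧
    Set.InjOn γ (Set.Ico 0 1) ∧ Set.range γ = J

/-- The regularity assumptions on the potential `Q` and its droplet `S`. -/
structure IsRegularDroplet (Q : ℂ → EReal) (S : Set ℂ) : Prop where
  laplacian_pos : ∃ V : Set ℂ, IsOpen V ∧ frontier S ⊆ V ∧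
    ∀ z ∈ V, 0 < quarterLaplacian (fun w => (Q w).toReal) z
  finite_components : Finite (ConnectedComponents (frontier S))
  smooth_boundary : ∀ z ∈ frontier S, IsC1JordanCurve (connectedComponentIn (frontier S) z)
  coincidence : ∀ z, z ∉ S → (⨆ f ∈ obstacleClass Q, f z) < Q z

/-! ### The Coulomb gas -/

/-- The Hamiltonian `H_n = ∑_{j ≠ k} log (1 / |ζ_j - ζ_k|) + n ∑_j Q(ζ_j)`. -/
def hamiltonian (Q : ℂ → EReal) (n : ℕ) (ζ : Fin n → ℂ) : EReal :=
  (∑ j, ∑ k ∈ Finset.univ.erase j, logKernel (ζ j) (ζ k)) + (n : EReal) * ∑ j, Q (ζ j)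

/-- Normalized area measure `dA = dx dy / π`. -/
def areaMeasure : Measure ℂ := (Real.toNNReal Real.pi⁻¹) • (volume : Measure ℂ)

/-- The Boltzmann factor `exp (-β H_n)`. -/
def boltzmannFactor (Q : ℂ → EReal) (n : ℕ) (β : ℝ) (ζ : Fin n → ℂ) : ℝ≥0∞ :=
  EReal.exp (-((β : EReal) * hamiltonian Q n ζ))

/-- The partition function `Z_n^β`. -/
def partitionFunction (Q : ℂ → EReal) (n : ℕ) (β : ℝ) : ℝ≥0∞ :=
  ∫⁻ ζ, boltzmannFactor Q n β ζ ∂(Measure.pi fun _ : Fin n => areaMeasure)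

/-- The Boltzmann-Gibbs measure on `ℂⁿ`, with density `exp (-β H_n) / Z_n^β` with respect to
`dA_n`. It is a probability measure exactly when `Z_n^β` is neither `0` nor `+∞`. -/
def boltzmannGibbs (Q : ℂ → EReal) (n : ℕ) (β : ℝ) : Measure (Fin n → ℂ) :=
  (partitionFunction Q n β)⁻¹ •
    (Measure.pi fun _ : Fin n => areaMeasure).withDensity (boltzmannFactor Q n β)

/-- The scaled spacing `s_n = √n · min_{j ≠ k} |ζ_j - ζ_k|` (equal to `+∞` for `n = 1`). -/
def spacing (n : ℕ) (ζ : Fin n → ℂ) : ℝ≥0∞ :=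
  ENNReal.ofReal (Real.sqrt n) * ⨅ (j : Fin n) (k : Fin n) (_ : j ≠ k), edist (ζ j) (ζ k)

end

end CoulombGas

namespace CoulombGas

noncomputable section

/-! ### Extended integrals -/

/-! Freeze all particles but one. The conditional density of the remaining one is a multiple of
$W=|q|^{2\beta}e^{-n\beta Q}$, where $q$ is the monic polynomial of degree $n-1$ vanishing at the
other particles. Everything rests on a deterministic estimate (`exists_separation_estimate`): the
points within $A\lambda^{-1/(2\beta)}/\sqrt n$ of a zero of $q$ carry at most a fraction $B/\lambda$
of the mass of $W$, with $A,B$ depending only on $Q$. Integrating over the frozen particles and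
summing over the $n$ choices of the free one gives (ii); taking $\lambda=n^3$ and applying
Borel–Cantelli gives (i).

Near the droplet, $Q$ differs from an affine function by $O(r^2)$ on a disc of radius
$r=\varepsilon/\sqrt n$, so $W$ has the sub-mean value property there up to a factor $e^{O(\beta)}$.
If $w$ lies within $d$ of a zero $a_k$, apply this property to $q/(z-a_k)$ over the annulus
$r/2<|z-w|<r$, where $|z-a_k|\ge r/4$. This gains $(4d/r)^{2\beta}$, and $A$ is chosen so that gain
and loss multiply to exactly $1/\lambda$. Integration in $w$ and Tonelli then compare with the total
mass (`wt_le_of_near_root`).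

Far from the droplet, $Q$ is not assumed smooth, and it is compared with
$V=c+2\int\log|z-w|\,d\sigma(w)$. This function equals $Q$ on $S$, is harmonic off $S$, grows like
$2\log|z|$, and satisfies $V+\delta\le Q$ at distance at least $\varepsilon$ from $S$. By the
maximum principle $|q|e^{-nV/2}$ peaks on $S$, where the local estimate applies; the root again
gains $4d/r$, and the gap gives a factor $e^{-n\beta\delta}$ which absorbs the remaining power of
$n$ (`wt_le_of_far_root`).

The existence of $V$ is the Euler–Lagrange condition for $\sigma$. Let $\Phi$ be, up to a constant,
$Q$ minus twice the logarithmic potential. Varying $\sigma$ towards uniform measures on small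
circles gives $\int\Phi\,d\sigma\le\Phi(p)$ for every $p\in S$. The minimum point of $\Phi$ must lie
in $S$: otherwise a translate of the potential would be an obstacle competitor touching $Q$ off $S$,
against assumption 4. Hence $\Phi$ equals its minimum $\sigma$-a.e., and on all of $S$ by lower
semicontinuity (`exists_potFun_le`). -/

lemma eintegral_coe_real {α : Type*} [MeasurableSpace α] {μ : Measure α} {f : α → EReal}
    {h : α → ℝ} (hf : ∀ᵐ x ∂μ, f x = h x) (hh : Integrable h μ) :
    eintegral μ f = ((∫ x, h x ∂μ : ℝ) : EReal) := by
  have h1 : ∫⁻ x, (f x).toENNReal ∂μ = ∫⁻ x, ENNReal.ofReal (h x) ∂μ :=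
    lintegral_congr_ae (by filter_upwards [hf] with x hx; rw [hx]; rfl)
  have h2 : ∫⁻ x, (-f x).toENNReal ∂μ = ∫⁻ x, ENNReal.ofReal (-h x) ∂μ :=
    lintegral_congr_ae (by filter_upwards [hf] with x hx; rw [hx]; rfl)
  have t1 : ∫⁻ x, ENNReal.ofReal (h x) ∂μ ≠ ⊤ := by
    refine ne_top_of_le_ne_top hh.hasFiniteIntegral.ne (lintegral_mono fun x => ?_)
    rw [← ofReal_norm]
    exact ENNReal.ofReal_le_ofReal (le_abs_self _)
  have t2 : ∫⁻ x, ENNReal.ofReal (-h x) ∂μ ≠ ⊤ := by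
    refine ne_top_of_le_ne_top hh.hasFiniteIntegral.ne (lintegral_mono fun x => ?_)
    rw [← ofReal_norm]
    exact ENNReal.ofReal_le_ofReal (neg_le_abs _)
  rw [eintegral, h1, h2, integral_eq_lintegral_pos_part_sub_lintegral_neg_part hh]
  lift ∫⁻ x, ENNReal.ofReal (h x) ∂μ to ℝ≥0 using t1 with A
  lift ∫⁻ x, ENNReal.ofReal (-h x) ∂μ to ℝ≥0 using t2 with B
  rfl

lemma coe_toReal_sub_of_eq {f : EReal} {B : ℝ} (hb : -(B : EReal) ≤ f)
    (hf : (f + B).toENNReal ≠ ⊤) : f = (((f + B).toENNReal.toReal - B : ℝ) : EReal) := by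
  induction f with
  | bot =>
    rw [le_bot_iff] at hb
    exact absurd hb (by rw [← EReal.coe_neg]; exact EReal.coe_ne_bot _)
  | top => simp at hf
  | coe x =>
    norm_cast at hb ⊢
    rw [EReal.real_coe_toENNReal, ENNReal.toReal_ofReal (by linarith)]
    ring

/-- Adding a lower bound removes the negative part, so energies become Lebesgue integrals of
nonnegative functions. The value $+\infty$ is allowed and needs its own case. -/
lemma eintegral_eq_lintegral_sub {α : Type*} [MeasurableSpace α] {μ : Measure α}
    [IsProbabilityMeasure μ] {f : α → EReal} (hf : Measurable f) {B : ℝ}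
    (hb : ∀ᵐ x ∂μ, -(B : EReal) ≤ f x) :
    eintegral μ f = ((∫⁻ x, (f x + B).toENNReal ∂μ : ℝ≥0∞) : EReal) - B := by
  have hm : Measurable fun x => (f x + B).toENNReal :=
    (hf.add measurable_const).ereal_toENNReal
  by_cases hfin : ∫⁻ x, (f x + B).toENNReal ∂μ = ⊤
  · have hneg : ∫⁻ x, (-f x).toENNReal ∂μ ≤ ENNReal.ofReal B := by
      calc ∫⁻ x, (-f x).toENNReal ∂μ ≤ ∫⁻ x, ENNReal.ofReal B ∂μ := by
            refine lintegral_mono_ae ?_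
            filter_upwards [hb] with x hx
            rw [← EReal.real_coe_toENNReal]
            exact EReal.toENNReal_le_toENNReal (EReal.neg_le_of_neg_le hx)
        _ = _ := by simp
    have hpos : ∫⁻ x, (f x).toENNReal ∂μ = ⊤ := by
      have : ∫⁻ x, (f x + B).toENNReal ∂μ ≤ ∫⁻ x, (f x).toENNReal ∂μ + ENNReal.ofReal B := by
        calc _ ≤ ∫⁻ x, ((f x).toENNReal + ENNReal.ofReal B) ∂μ :=
              lintegral_mono fun x => EReal.toENNReal_add_le
          _ = _ := by rw [lintegral_add_right _ measurable_const]; simp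
      rw [hfin, top_le_iff] at this
      simpa using this
    have hneg' : ∫⁻ x, (-f x).toENNReal ∂μ ≠ ⊤ := ne_top_of_le_ne_top ENNReal.ofReal_ne_top hneg
    rw [eintegral, hfin, hpos]
    lift ∫⁻ x, (-f x).toENNReal ∂μ to ℝ≥0 using hneg' with A
    rw [EReal.coe_ennreal_top, EReal.top_sub_coe]
    exact EReal.top_sub_coe (A : ℝ)
  · have hint : Integrable (fun x => (f x + B).toENNReal.toReal) μ :=
      integrable_toReal_of_lintegral_ne_top hm.aemeasurable hfin
    have hae : ∀ᵐ x ∂μ, f x = (((f x + B).toENNReal.toReal - B : ℝ) : EReal) := by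
      filter_upwards [hb, ae_lt_top hm hfin] with x hx hx'
      exact coe_toReal_sub_of_eq hx hx'.ne
    rw [eintegral_coe_real hae (hint.sub (integrable_const B)),
      integral_sub hint (integrable_const B),
      integral_toReal hm.aemeasurable (ae_lt_top hm hfin)]
    simp only [integral_const, probReal_univ, smul_eq_mul, one_mul, EReal.coe_sub]
    lift ∫⁻ x, (f x + B).toENNReal ∂μ to ℝ≥0 using hfin with A
    rfl

/-! ### The logarithmic kernel -/

/-- The kernel `log (D / |z - w|)`, truncated from below at `0`. -/
def kern (D : ℝ) (z w : ℂ) : ℝ≥0∞ := (logKernel z w + (Real.log D : ℝ)).toENNReal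

lemma logKernel_self (z : ℂ) : logKernel z z = ⊤ := by simp [logKernel]

lemma logKernel_of_ne {z w : ℂ} (h : z ≠ w) : logKernel z w = ((-Real.log ‖z - w‖ : ℝ) : EReal) := by
  rw [logKernel, edist_dist, dist_eq_norm,
    ENNReal.log_ofReal_of_pos (norm_pos_iff.2 (sub_ne_zero.2 h)), EReal.coe_neg]

lemma logKernel_comm (z w : ℂ) : logKernel z w = logKernel w z := by
  rw [logKernel, logKernel, edist_comm]

lemma kern_comm (D : ℝ) (z w : ℂ) : kern D z w = kern D w z := by
  rw [kern, kern, logKernel_comm]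

lemma kern_self (D : ℝ) (z : ℂ) : kern D z z = ⊤ := by simp [kern, logKernel_self]

lemma kern_of_ne {D : ℝ} {z w : ℂ} (h : z ≠ w) :
    kern D z w = ENNReal.ofReal (Real.log D - Real.log ‖z - w‖) := by
  rw [kern, logKernel_of_ne h, ← EReal.coe_add, EReal.real_coe_toENNReal]
  congr 1; ring

lemma continuous_logKernel : Continuous fun p : ℂ × ℂ => logKernel p.1 p.2 :=
  (ENNReal.continuous_log.comp (continuous_fst.edist continuous_snd)).neg

lemma continuous_kern (D : ℝ) : Continuous fun p : ℂ × ℂ => kern D p.1 p.2 := by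
  refine EReal.continuous_toENNReal.comp ?_
  refine continuous_iff_continuousAt.2 fun p => ?_
  have h : ContinuousAt (fun q : EReal × EReal => q.1 + q.2)
      (logKernel p.1 p.2, ((Real.log D : ℝ) : EReal)) :=
    EReal.continuousAt_add (Or.inr (EReal.coe_ne_bot _)) (Or.inr (EReal.coe_ne_top _))
  exact ContinuousAt.comp (f := fun p : ℂ × ℂ => (logKernel p.1 p.2, ((Real.log D : ℝ) : EReal)))
    h (continuous_logKernel.continuousAt.prodMk continuousAt_const)

lemma measurable_kern (D : ℝ) : Measurable fun p : ℂ × ℂ => kern D p.1 p.2 :=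
  (continuous_kern D).measurable

lemma continuous_kern_right (D : ℝ) (z : ℂ) : Continuous fun w => kern D z w :=
  Continuous.comp (g := fun p : ℂ × ℂ => kern D p.1 p.2) (f := fun w => (z, w))
    (continuous_kern D) (by fun_prop)

lemma continuous_kern_left (D : ℝ) (w : ℂ) : Continuous fun z => kern D z w :=
  Continuous.comp (g := fun p : ℂ × ℂ => kern D p.1 p.2) (f := fun z => (z, w))
    (continuous_kern D) (by fun_prop)

lemma measurable_kern_right (D : ℝ) (z : ℂ) : Measurable fun w => kern D z w :=
  (continuous_kern_right D z).measurable

lemma measurable_kern_left (D : ℝ) (w : ℂ) : Measurable fun z => kern D z w :=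
  (continuous_kern_left D w).measurable

lemma neg_log_le_logKernel {D : ℝ} {z w : ℂ} (h : ‖z - w‖ ≤ D) :
    -((Real.log D : ℝ) : EReal) ≤ logKernel z w := by
  rcases eq_or_ne z w with rfl | hne
  · simp [logKernel_self]
  · rw [logKernel_of_ne hne, ← EReal.coe_neg, EReal.coe_le_coe_iff]
    exact neg_le_neg (Real.log_le_log (norm_pos_iff.2 (sub_ne_zero.2 hne)) h)

/-- At distances at most $D$ the truncation at $0$ is inactive, so a change of normalization only
adds a constant. -/
lemma kern_add {D D' : ℝ} {z w : ℂ} (hD : 0 < D) (h : ‖z - w‖ ≤ D) (h' : D ≤ D') :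
    kern D' z w = kern D z w + ENNReal.ofReal (Real.log D' - Real.log D) := by
  rcases eq_or_ne z w with rfl | hne
  · simp [kern_self]
  · have := Real.log_le_log (norm_pos_iff.2 (sub_ne_zero.2 hne)) h
    have := Real.log_le_log hD h'
    rw [kern_of_ne hne, kern_of_ne hne, ← ENNReal.ofReal_add (by linarith) (by linarith)]
    congr 1; ring

/-! ### Uniform measure on a circle -/

/-- The uniform probability measure on the circle of centre `p` and radius `r`. -/
def circ (p : ℂ) (r : ℝ) : Measure ℂ :=
  (ENNReal.ofReal (2 * Real.pi))⁻¹ •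
    (volume.restrict (Set.Ioc 0 (2 * Real.pi))).map (circleMap p r)

lemma measurable_circleMap (p : ℂ) (r : ℝ) : Measurable (circleMap p r) :=
  (continuous_circleMap p r).measurable

lemma lintegral_circ (p : ℂ) (r : ℝ) {f : ℂ → ℝ≥0∞} (hf : Measurable f) :
    ∫⁻ z, f z ∂(circ p r) = (ENNReal.ofReal (2 * Real.pi))⁻¹ *
      ∫⁻ θ in Set.Ioc 0 (2 * Real.pi), f (circleMap p r θ) := by
  rw [circ, lintegral_smul_measure, lintegral_map hf (measurable_circleMap p r), smul_eq_mul]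

lemma two_pi_inv_mul_self :
    (ENNReal.ofReal (2 * Real.pi))⁻¹ * ENNReal.ofReal (2 * Real.pi) = 1 :=
  ENNReal.inv_mul_cancel (by simp [Real.pi_pos]) ENNReal.ofReal_ne_top

instance (p : ℂ) (r : ℝ) : IsProbabilityMeasure (circ p r) := ⟨by
  have := lintegral_circ p r (f := fun _ => 1) measurable_const
  rw [lintegral_one] at this
  rw [this]
  simp only [lintegral_const, MeasurableSet.univ, Measure.restrict_apply, Set.univ_inter,
    Real.volume_Ioc, sub_zero, one_mul]
  exact two_pi_inv_mul_self⟩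

lemma ae_circ {p : ℂ} {r : ℝ} (hr : 0 ≤ r) : ∀ᵐ z ∂(circ p r), ‖z - p‖ = r := by
  refine Measure.ae_smul_measure ?_ _
  rw [ae_map_iff (measurable_circleMap p r).aemeasurable
    (measurableSet_eq_fun (by fun_prop) measurable_const)]
  exact Eventually.of_forall fun θ => by simp [circleMap, abs_of_nonneg hr]

/-- The mean of the logarithmic kernel over a circle. -/
lemma lintegral_kern_circ {D r : ℝ} {p w : ℂ} (hr : 0 < r) (hD : ‖p - w‖ + r ≤ D) :
    ∫⁻ z, kern D z w ∂(circ p r) =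
      ENNReal.ofReal (Real.log D - (Real.log r + Real.posLog (r⁻¹ * ‖p - w‖))) := by
  have hci := circleIntegrable_log_norm_sub_const (a := w) (c := p) r
  have hint : IntegrableOn (fun θ => Real.log ‖circleMap p r θ - w‖) (Set.Ioc 0 (2 * Real.pi)) :=
    (intervalIntegrable_iff_integrableOn_Ioc_of_le (by positivity)).1 hci
  have hne : ∀ᵐ θ ∂(volume.restrict (Set.Ioc 0 (2 * Real.pi))), circleMap p r θ ≠ w := by
    have : ((circleMap p r) ⁻¹' {w}).Countable :=
      (Set.countable_singleton w).preimage_circleMap p hr.ne'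
    exact ae_restrict_of_ae (by
      rw [ae_iff]; simpa [Set.preimage] using this.measure_zero volume)
  have hbound : ∀ θ, ‖circleMap p r θ - w‖ ≤ D := fun θ => by
    refine le_trans ?_ hD
    calc ‖circleMap p r θ - w‖ = ‖(p - w) + (circleMap p r θ - p)‖ := by congr 1; ring
      _ ≤ _ := by
        refine (norm_add_le _ _).trans ?_
        simp [circleMap, abs_of_pos hr]
  rw [lintegral_circ _ _ (measurable_kern_left D w)]
  have e1 : ∫⁻ θ in Set.Ioc 0 (2 * Real.pi), kern D (circleMap p r θ) w =
      ENNReal.ofReal (∫ θ in Set.Ioc 0 (2 * Real.pi),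
        (Real.log D - Real.log ‖circleMap p r θ - w‖)) := by
    rw [ofReal_integral_eq_lintegral_ofReal (f := fun θ => Real.log D -
      Real.log ‖circleMap p r θ - w‖) ((integrable_const _).sub hint)]
    · refine lintegral_congr_ae ?_
      filter_upwards [hne] with θ hθ
      rw [kern_of_ne hθ]
    · filter_upwards [hne] with θ hθ
      simpa using Real.log_le_log (norm_pos_iff.2 (sub_ne_zero.2 hθ)) (hbound θ)
  have e2 := circleAverage_log_norm_sub_const_eq_log_radius_add_posLog (a := w) (c := p) hr.ne'
  rw [Real.circleAverage, intervalIntegral.integral_of_le (by positivity), smul_eq_mul] at e2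
  rw [e1, integral_sub (integrable_const _) hint, ← e2,
    ← ENNReal.ofReal_inv_of_pos (by positivity), ← ENNReal.ofReal_mul (by positivity)]
  congr 1
  have : (0 : ℝ) < 2 * Real.pi := by positivity
  simp only [integral_const, MeasurableSet.univ, measureReal_restrict_apply, Set.univ_inter,
    Real.volume_real_Ioc_of_le this.le, sub_zero, smul_eq_mul]
  field_simp

lemma lintegral_kern_circ_le {D r : ℝ} {p w : ℂ} (hr : 0 < r) (hD : ‖p - w‖ + r ≤ D) :
    ∫⁻ z, kern D z w ∂(circ p r) ≤ kern D p w := by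
  rcases eq_or_ne p w with rfl | hne
  · simp [kern_self]
  rw [lintegral_kern_circ hr hD, kern_of_ne hne]
  refine ENNReal.ofReal_le_ofReal ?_
  have hpos : 0 < ‖p - w‖ := norm_pos_iff.2 (sub_ne_zero.2 hne)
  have : Real.log (r⁻¹ * ‖p - w‖) ≤ Real.posLog (r⁻¹ * ‖p - w‖) := le_max_right _ _
  rw [Real.log_mul (by positivity) hpos.ne', Real.log_inv] at this
  linarith

lemma lintegral_kern_circ_le_radius {D r : ℝ} {p w : ℂ} (hr : 0 < r) (hD : ‖p - w‖ + r ≤ D) :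
    ∫⁻ z, kern D z w ∂(circ p r) ≤ ENNReal.ofReal (Real.log D - Real.log r) := by
  rw [lintegral_kern_circ hr hD]
  refine ENNReal.ofReal_le_ofReal ?_
  have : 0 ≤ Real.posLog (r⁻¹ * ‖p - w‖) := Real.posLog_nonneg
  linarith

/-! ### Logarithmic potentials -/

/-- The potential `∫ log (D / |z - w|) dμ(w)`. -/
def pot (D : ℝ) (μ : Measure ℂ) (z : ℂ) : ℝ≥0∞ := ∫⁻ w, kern D z w ∂μ

/-- Fatou's lemma, the kernel being nonnegative and continuous with value $\infty$ on the diagonal.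
-/
lemma lowerSemicontinuous_pot (D : ℝ) (μ : Measure ℂ) : LowerSemicontinuous (pot D μ) := by
  refine lowerSemicontinuous_iff_le_liminf.2 fun z => ?_
  calc pot D μ z ≤ ∫⁻ w, liminf (fun z' => kern D z' w) (𝓝 z) ∂μ := by
        refine lintegral_mono fun w => ?_
        exact lowerSemicontinuousAt_iff_le_liminf.1
          (continuous_kern_left D w).continuousAt.lowerSemicontinuousAt
    _ ≤ _ := lintegral_liminf_le fun z' => measurable_kern_right D z'

lemma measurable_pot (D : ℝ) (μ : Measure ℂ) : Measurable (pot D μ) :=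
  (lowerSemicontinuous_pot D μ).measurable

lemma pot_add {D D' : ℝ} {μ : Measure ℂ} [IsProbabilityMeasure μ] {z : ℂ} (hD : 0 < D)
    (h : ∀ᵐ w ∂μ, ‖z - w‖ ≤ D) (h' : D ≤ D') :
    pot D' μ z = pot D μ z + ENNReal.ofReal (Real.log D' - Real.log D) := by
  rw [pot, pot, lintegral_congr_ae (g := fun w => kern D z w +
    ENNReal.ofReal (Real.log D' - Real.log D))
    (by filter_upwards [h] with w hw; exact kern_add hD hw h'),
    lintegral_add_right _ measurable_const]
  simp

lemma lintegral_pot_comm (D : ℝ) (μ ν : Measure ℂ) [SFinite μ] [SFinite ν] :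
    ∫⁻ z, pot D μ z ∂ν = ∫⁻ z, pot D ν z ∂μ := by
  simp only [pot]
  rw [lintegral_lintegral_swap (measurable_kern D).aemeasurable]
  simp only [kern_comm D]

/-- The super-mean value property, inherited from the kernel by Tonelli. The condition on $D$ keeps
the truncation inactive on the whole circle. -/
lemma lintegral_pot_circ_le {D r : ℝ} {p : ℂ} {μ : Measure ℂ} [SFinite μ] (hr : 0 < r)
    (hD : ∀ᵐ w ∂μ, ‖p - w‖ + r ≤ D) : ∫⁻ z, pot D μ z ∂(circ p r) ≤ pot D μ p := by
  rw [lintegral_pot_comm]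
  refine lintegral_mono_ae ?_
  filter_upwards [hD] with w hw
  rw [pot]
  simp only [kern_comm D w]
  exact lintegral_kern_circ_le hr hw

/-- A circle has potential at most $\log(D/r)$. Circle measures can therefore replace point masses,
which have infinite energy, in the first variation. -/
lemma lintegral_pot_circ_lt_top {D r : ℝ} {p : ℂ} {μ : Measure ℂ} [IsProbabilityMeasure μ]
    (hr : 0 < r) (hD : ∀ᵐ w ∂μ, ‖p - w‖ + r ≤ D) : ∫⁻ z, pot D μ z ∂(circ p r) < ⊤ := by
  rw [lintegral_pot_comm]
  calc _ ≤ ∫⁻ w, ENNReal.ofReal (Real.log D - Real.log r) ∂μ := by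
        refine lintegral_mono_ae ?_
        filter_upwards [hD] with w hw
        rw [pot]
        simp only [kern_comm D w]
        exact lintegral_kern_circ_le_radius hr hw
    _ < ⊤ := by simp

/-! ### Growth of the external potential -/

lemma IsExternalPotential.exists_growth {Q : ℂ → EReal} (hQ : IsExternalPotential Q) :
    ∃ κ : ℝ, 1 < κ ∧ ∀ᶠ z in Bornology.cobounded ℂ,
      ((κ * (2 * Real.log ‖z‖) : ℝ) : EReal) ≤ Q z := by
  obtain ⟨κ', h1, h2⟩ := EReal.lt_iff_exists_real_btwn.1 hQ.growth
  refine ⟨κ', by exact_mod_cast h1, ?_⟩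
  have := eventually_lt_of_lt_liminf h2
  filter_upwards [this, (tendsto_norm_cobounded_atTop (E := ℂ)).eventually_gt_atTop 1] with z hz hz1
  have hpos : (0 : ℝ) < 2 * Real.log ‖z‖ := by have := Real.log_pos hz1; linarith
  rw [EReal.lt_div_iff (by exact_mod_cast hpos) (EReal.coe_ne_top _)] at hz
  rw [EReal.coe_mul]
  exact hz.le

/-- The surplus $2(\kappa-1)\log|z|$, with $\kappa>1$, absorbs both the shift inside the logarithm
and the additive constant. -/
lemma IsExternalPotential.eventually_log_le {Q : ℂ → EReal} (hQ : IsExternalPotential Q)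
    (A C : ℝ) : ∀ᶠ z in Bornology.cobounded ℂ,
      ((2 * Real.log (‖z‖ + A) + C : ℝ) : EReal) ≤ Q z := by
  obtain ⟨κ, hκ, h⟩ := hQ.exists_growth
  have hlog : Tendsto (fun z : ℂ => Real.log ‖z‖) (Bornology.cobounded ℂ) atTop :=
    Real.tendsto_log_atTop.comp tendsto_norm_cobounded_atTop
  filter_upwards [h, (tendsto_norm_cobounded_atTop (E := ℂ)).eventually_gt_atTop (max 1 |A|),
    hlog.eventually_ge_atTop ((2 * Real.log 2 + C) / (2 * (κ - 1)))] with z hz hz1 hz2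
  refine le_trans ?_ hz
  rw [EReal.coe_le_coe_iff]
  have h1 : 1 < ‖z‖ := lt_of_le_of_lt (le_max_left _ _) hz1
  have h2 : |A| < ‖z‖ := lt_of_le_of_lt (le_max_right _ _) hz1
  have h3 : Real.log (‖z‖ + A) ≤ Real.log 2 + Real.log ‖z‖ := by
    rw [← Real.log_mul (by norm_num) (by linarith)]
    have := abs_lt.1 h2
    exact Real.log_le_log (by linarith) (by linarith)
  rw [div_le_iff₀ (by linarith)] at hz2
  nlinarith

lemma IsExternalPotential.exists_lower_bound {Q : ℂ → EReal} (hQ : IsExternalPotential Q) :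
    ∃ B : ℝ, ∀ z, -(B : EReal) ≤ Q z := by
  obtain ⟨R, -, hR⟩ := (Filter.hasBasis_cobounded_norm (E := ℂ)).eventually_iff.1
    (hQ.eventually_log_le 1 0)
  have hne : (Metric.closedBall (0 : ℂ) (max R 0)).Nonempty :=
    ⟨0, Metric.mem_closedBall_self (le_max_right _ _)⟩
  obtain ⟨p, -, hp⟩ := (hQ.lsc.lowerSemicontinuousOn _).exists_isMinOn hne
    (isCompact_closedBall _ _)
  obtain ⟨b, hb⟩ : ∃ b : ℝ, (b : EReal) ≤ Q p := by
    rcases eq_or_ne (Q p) ⊤ with h | h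
    · exact ⟨0, h ▸ le_top⟩
    · exact ⟨(Q p).toReal, (EReal.coe_toReal h (hQ.ne_bot p)).le⟩
  refine ⟨max (-b) 0, fun z => ?_⟩
  by_cases hz : ‖z‖ ≤ max R 0
  · refine le_trans ?_ (hb.trans (hp (by simpa using hz)))
    rw [← EReal.coe_neg, EReal.coe_le_coe_iff]
    linarith [le_max_left (-b) 0]
  · have hz' : R ≤ ‖z‖ := (le_max_left _ _).trans (not_le.1 hz).le
    refine le_trans ?_ (hR hz')
    rw [← EReal.coe_neg, EReal.coe_le_coe_iff]
    have := Real.log_nonneg (x := ‖z‖ + 1) (by linarith [norm_nonneg z])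
    linarith [le_max_right (-b) 0]

/-- The external potential shifted by `B`, as a nonnegative function. -/
def shiftPot (Q : ℂ → EReal) (B : ℝ) (z : ℂ) : ℝ≥0∞ := (Q z + B).toENNReal

lemma IsExternalPotential.lowerSemicontinuous_shiftPot {Q : ℂ → EReal}
    (hQ : IsExternalPotential Q) (B : ℝ) : LowerSemicontinuous (shiftPot Q B) := by
  have hc : Continuous fun x : EReal => (x + B).toENNReal := by
    refine EReal.continuous_toENNReal.comp (continuous_iff_continuousAt.2 fun x => ?_)
    have h : ContinuousAt (fun q : EReal × EReal => q.1 + q.2) (x, (B : EReal)) :=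
      EReal.continuousAt_add (Or.inr (EReal.coe_ne_bot _)) (Or.inr (EReal.coe_ne_top _))
    exact ContinuousAt.comp (f := fun x : EReal => (x, (B : EReal))) h
      (continuousAt_id.prodMk continuousAt_const)
  exact hc.comp_lowerSemicontinuous hQ.lsc
    fun x y hxy => EReal.toENNReal_le_toENNReal (add_le_add_left hxy _)

/-! ### The weighted energy and its first variation -/

/-- The weighted energy functional in terms of nonnegative kernels. -/
def shiftEnergy (D : ℝ) (q : ℂ → ℝ≥0∞) (μ : Measure ℂ) : ℝ≥0∞ :=
  ∫⁻ z, pot D μ z ∂μ + ∫⁻ z, q z ∂μ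

/-- Points of the disc of radius $R$ are at distance at most $2R$, so the kernel normalized by $2R$
is nonnegative. The subtracted constant does not depend on the measure, hence minimality passes to
`shiftEnergy`. -/
lemma weightedEnergy_eq {Q : ℂ → EReal} (hQ : Measurable Q) {B : ℝ} (hB : ∀ z, -(B : EReal) ≤ Q z)
    {μ : Measure ℂ} [IsProbabilityMeasure μ] {R : ℝ} (hR : ∀ᵐ z ∂μ, ‖z‖ ≤ R) :
    weightedEnergy Q μ = (shiftEnergy (2 * R) (shiftPot Q B) μ : EReal)
      - ((Real.log (2 * R) + B : ℝ) : EReal) := by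
  have h1 : logEnergy μ = ((∫⁻ z, pot (2 * R) μ z ∂μ : ℝ≥0∞) : EReal)
      - (Real.log (2 * R) : ℝ) := by
    rw [logEnergy, eintegral_eq_lintegral_sub continuous_logKernel.measurable
      (B := Real.log (2 * R))]
    · change ((∫⁻ p : ℂ × ℂ, kern (2 * R) p.1 p.2 ∂(μ.prod μ) : ℝ≥0∞) : EReal) - _ = _
      rw [lintegral_prod _ (measurable_kern _).aemeasurable]
      rfl
    · have hp : ∀ᵐ p : ℂ × ℂ ∂(μ.prod μ), ‖p.1‖ ≤ R ∧ ‖p.2‖ ≤ R :=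
        ((Measure.quasiMeasurePreserving_fst (μ := μ) (ν := μ)).ae hR).and
          ((Measure.quasiMeasurePreserving_snd (μ := μ) (ν := μ)).ae hR)
      filter_upwards [hp] with p hp
      exact neg_log_le_logKernel ((norm_sub_le _ _).trans (by linarith [hp.1, hp.2]))
  have h2 : eintegral μ Q = ((∫⁻ z, shiftPot Q B z ∂μ : ℝ≥0∞) : EReal) - B :=
    eintegral_eq_lintegral_sub hQ (Eventually.of_forall hB)
  rw [weightedEnergy, h1, h2, shiftEnergy, EReal.coe_ennreal_add]
  generalize ∫⁻ z, pot (2 * R) μ z ∂μ = a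
  generalize ∫⁻ z, shiftPot Q B z ∂μ = b
  generalize Real.log (2 * R) = x
  induction a with
  | top =>
    induction b with
    | top => rfl
    | coe b => rfl
  | coe a =>
    induction b with
    | top => rfl
    | coe b =>
      change (((a : ℝ) : EReal) - x) + (((b : ℝ) : EReal) - B) =
        (((a : ℝ) : EReal) + ((b : ℝ) : EReal)) - _
      norm_cast
      push_cast
      ring

lemma coe_ennreal_sub_le_iff {a b : ℝ≥0∞} {x : ℝ} :
    (a : EReal) - x ≤ (b : EReal) - x ↔ a ≤ b := by
  constructor
  · intro h
    have h' : (a : EReal) - x + x ≤ (b : EReal) - x + x := add_le_add_left h _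
    rw [EReal.sub_add_cancel, EReal.sub_add_cancel] at h'
    exact_mod_cast h'
  · intro h
    exact EReal.sub_le_sub (by exact_mod_cast h) le_rfl

lemma IsEquilibriumMeasure.shiftEnergy_le {Q : ℂ → EReal} (hQ : Measurable Q) {B : ℝ}
    (hB : ∀ z, -(B : EReal) ≤ Q z) {σ : Measure ℂ} (hσ : IsEquilibriumMeasure Q σ)
    {μ : Measure ℂ} [IsProbabilityMeasure μ] {R : ℝ} (hσR : ∀ᵐ z ∂σ, ‖z‖ ≤ R)
    (hμR : ∀ᵐ z ∂μ, ‖z‖ ≤ R) :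
    shiftEnergy (2 * R) (shiftPot Q B) σ ≤ shiftEnergy (2 * R) (shiftPot Q B) μ := by
  have := hσ.1.1
  have h := hσ.2 μ ⟨inferInstance, Metric.closedBall 0 R, isCompact_closedBall 0 R, by
    simpa [ae_iff, Set.compl_def] using hμR⟩
  rwa [weightedEnergy_eq hQ hB hσR, weightedEnergy_eq hQ hB hμR, coe_ennreal_sub_le_iff] at h

lemma pot_add_smul (D : ℝ) (a b : ℝ≥0∞) (μ ν : Measure ℂ) (z : ℂ) :
    pot D (a • μ + b • ν) z = a * pot D μ z + b * pot D ν z := by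
  simp [pot, lintegral_add_measure, lintegral_smul_measure]

lemma shiftEnergy_mix (D : ℝ) (q : ℂ → ℝ≥0∞) (a b : ℝ≥0∞) (μ ν : Measure ℂ) [SFinite μ]
    [SFinite ν] :
    shiftEnergy D q (a • μ + b • ν) =
      a * (a * ∫⁻ z, pot D μ z ∂μ) + 2 * (a * (b * ∫⁻ z, pot D μ z ∂ν))
        + b * (b * ∫⁻ z, pot D ν z ∂ν) + a * ∫⁻ z, q z ∂μ + b * ∫⁻ z, q z ∂ν := by
  simp only [shiftEnergy, pot_add_smul, lintegral_add_measure, lintegral_smul_measure, smul_eq_mul]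
  have hm : ∀ (c : ℝ≥0∞) (ρ : Measure ℂ), Measurable fun z => c * pot D ρ z := fun c ρ =>
    (measurable_pot D ρ).const_mul c
  rw [lintegral_add_left (hm _ _), lintegral_add_left (hm _ _),
    lintegral_const_mul _ (measurable_pot D μ), lintegral_const_mul _ (measurable_pot D μ),
    lintegral_const_mul _ (measurable_pot D ν), lintegral_const_mul _ (measurable_pot D ν),
    lintegral_pot_comm D ν μ]
  ring

lemma le_of_forall_quadratic {x y : ℝ} (h : ∀ t : ℝ, 0 < t → t < 1 → x ≤ t * y) : x ≤ 0 := by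
  have h1 : Tendsto (fun t : ℝ => t * y) (𝓝[>] 0) (𝓝 0) := by
    have : Tendsto (fun t : ℝ => t * y) (𝓝 0) (𝓝 (0 * y)) :=
      (continuous_id.mul continuous_const).tendsto 0
    rw [zero_mul] at this
    exact this.mono_left nhdsWithin_le_nhds
  refine ge_of_tendsto h1 ?_
  filter_upwards [Ioo_mem_nhdsGT (zero_lt_one (α := ℝ))] with t ht
  exact h t ht.1 ht.2

/-- The first variation of the weighted energy at a minimizer, in the direction of `ν`. -/
lemma lintegral_effective_le {D : ℝ} {q : ℂ → ℝ≥0∞} (hq : Measurable q) {μ ν : Measure ℂ}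
    [IsProbabilityMeasure μ] [IsProbabilityMeasure ν] (hμ : shiftEnergy D q μ < ⊤)
    (hμν : ∫⁻ z, pot D μ z ∂ν < ⊤) (hν : ∫⁻ z, pot D ν z ∂ν < ⊤) (hqν : ∫⁻ z, q z ∂ν < ⊤)
    (hmin : ∀ t : ℝ, 0 < t → t < 1 → shiftEnergy D q μ ≤
      shiftEnergy D q (ENNReal.ofReal (1 - t) • μ + ENNReal.ofReal t • ν)) :
    ∫⁻ z, (2 * pot D μ z + q z) ∂μ ≤ ∫⁻ z, (2 * pot D μ z + q z) ∂ν := by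
  rw [lintegral_add_right _ hq, lintegral_add_right _ hq,
    lintegral_const_mul _ (measurable_pot D μ), lintegral_const_mul _ (measurable_pot D μ)]
  simp only [shiftEnergy_mix] at hmin
  rw [shiftEnergy] at hμ hmin
  have hμ1 := (ENNReal.add_lt_top.1 hμ).1
  have hμ2 := (ENNReal.add_lt_top.1 hμ).2
  clear hμ
  lift ∫⁻ z, pot D μ z ∂μ to ℝ≥0 using hμ1.ne with a
  lift ∫⁻ z, q z ∂μ to ℝ≥0 using hμ2.ne with b
  lift ∫⁻ z, pot D μ z ∂ν to ℝ≥0 using hμν.ne with c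
  lift ∫⁻ z, pot D ν z ∂ν to ℝ≥0 using hν.ne with d
  lift ∫⁻ z, q z ∂ν to ℝ≥0 using hqν.ne with e
  suffices h : (2 * a + b - 2 * c - e : ℝ) ≤ 0 by
    have : 2 * a + b ≤ 2 * c + e := by
      rw [← NNReal.coe_le_coe]; push_cast; linarith
    exact_mod_cast this
  -- Along the segment from $\mu$ to $\nu$ the energy changes by $t(2c+e-2a-b)+t^2(a-2c+d)$.
  -- Minimality makes this nonnegative; divide by $t$ and let $t\to0$.
  refine le_of_forall_quadratic (y := a - 2 * c + d) fun t ht0 ht1 => ?_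
  have h := hmin t ht0 ht1
  lift t to ℝ≥0 using ht0.le with s
  have h1 : ENNReal.ofReal (1 - (s : ℝ)) = ((Real.toNNReal (1 - (s : ℝ)) : ℝ≥0) : ℝ≥0∞) := rfl
  rw [ENNReal.ofReal_coe_nnreal, h1] at h
  have h2 : a + b ≤ Real.toNNReal (1 - (s : ℝ)) * (Real.toNNReal (1 - (s : ℝ)) * a)
      + 2 * (Real.toNNReal (1 - (s : ℝ)) * (s * c)) + s * (s * d)
      + Real.toNNReal (1 - (s : ℝ)) * b + s * e := by exact_mod_cast h
  rw [← NNReal.coe_le_coe] at h2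
  push_cast at h2
  rw [Real.coe_toNNReal _ (by linarith)] at h2
  have h3 : (s : ℝ) * (2 * a + b - 2 * c - e) ≤ s * (s * (a - 2 * c + d)) := by nlinarith
  exact le_of_mul_le_mul_left h3 ht0

/-! ### The logarithmic potential as a competitor in the obstacle problem -/

/-- The function `c + 2 ∫ log |z - w| dσ(w)`, for a probability measure `σ` carried by the disc of
radius `R₀`. -/
def potFun (R₀ : ℝ) (σ : Measure ℂ) (c : ℝ) (z : ℂ) : EReal :=
  ((c + 2 * Real.log (‖z‖ + R₀ + 1) : ℝ) : EReal)
    - ((2 * pot (‖z‖ + R₀ + 1) σ z : ℝ≥0∞) : EReal)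

lemma potFun_ne_top (R₀ : ℝ) (σ : Measure ℂ) (c : ℝ) (z : ℂ) : potFun R₀ σ c z ≠ ⊤ := by
  refine ((EReal.sub_le_sub le_rfl (EReal.coe_ennreal_nonneg _)).trans_lt
    (by rw [sub_zero]; exact EReal.coe_lt_top _)).ne

lemma potFun_le (R₀ : ℝ) (σ : Measure ℂ) (c : ℝ) (z : ℂ) :
    potFun R₀ σ c z ≤ ((c + 2 * Real.log (‖z‖ + R₀ + 1) : ℝ) : EReal) := by
  refine (EReal.sub_le_sub le_rfl (EReal.coe_ennreal_nonneg _)).trans (by rw [sub_zero])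

section Competitor

variable {R₀ : ℝ} {σ : Measure ℂ} [IsProbabilityMeasure σ]

lemma potFun_eq (h0 : 0 ≤ R₀) (hR : ∀ᵐ w ∂σ, ‖w‖ ≤ R₀) (c : ℝ) {z : ℂ} {D : ℝ}
    (hD : ‖z‖ + R₀ + 1 ≤ D) :
    potFun R₀ σ c z = ((c + 2 * Real.log D : ℝ) : EReal) - ((2 * pot D σ z : ℝ≥0∞) : EReal) := by
  have hpos : 0 < ‖z‖ + R₀ + 1 := by positivity
  have hlog := Real.log_le_log hpos hD
  rw [potFun, pot_add (D := ‖z‖ + R₀ + 1) hpos _ hD]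
  · set a := pot (‖z‖ + R₀ + 1) σ z
    rcases eq_or_ne a ⊤ with ha | ha
    · rw [ha]; simp
    · lift a to ℝ≥0 using ha with a
      rw [ENNReal.ofReal, ← ENNReal.coe_add]
      have h1 : (2 * (a : ℝ≥0∞)) = ((2 * a : ℝ≥0) : ℝ≥0∞) := by push_cast; rfl
      have h2 : (2 * ((a + (Real.log D - Real.log (‖z‖ + R₀ + 1)).toNNReal : ℝ≥0) : ℝ≥0∞)) =
        ((2 * (a + (Real.log D - Real.log (‖z‖ + R₀ + 1)).toNNReal) : ℝ≥0) : ℝ≥0∞) := by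
          push_cast; rfl
      rw [h1, h2]
      change _ - (((2 * a : ℝ≥0) : ℝ) : EReal) = _ - (((2 * (a + _) : ℝ≥0) : ℝ) : EReal)
      rw [← EReal.coe_sub, ← EReal.coe_sub]
      congr 1
      push_cast
      rw [Real.coe_toNNReal _ (by linarith)]
      ring
  · filter_upwards [hR] with w hw
    exact (norm_sub_le _ _).trans (by linarith)

lemma upperSemicontinuous_potFun (h0 : 0 ≤ R₀) (hR : ∀ᵐ w ∂σ, ‖w‖ ≤ R₀) (c : ℝ) :
    UpperSemicontinuous (potFun R₀ σ c) := by
  intro z y hy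
  -- One normalization valid for all points within distance $1$ of $z$, so that near $z$ the
  -- function is a continuous decreasing function of one lower semicontinuous potential.
  set D := ‖z‖ + R₀ + 2
  rw [potFun_eq h0 hR c (D := D) (by simp [D])] at hy
  have hc : Continuous fun x : ℝ≥0∞ =>
      ((c + 2 * Real.log D : ℝ) : EReal) - ((2 * x : ℝ≥0∞) : EReal) := by
    have h1 : Continuous fun x : ℝ≥0∞ => -((2 * x : ℝ≥0∞) : EReal) :=
      (continuous_coe_ennreal_ereal.comp (ENNReal.continuous_const_mul (by simp))).neg
    refine continuous_iff_continuousAt.2 fun x => ?_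
    have h : ContinuousAt (fun q : EReal × EReal => q.1 + q.2)
        (((c + 2 * Real.log D : ℝ) : EReal), -((2 * x : ℝ≥0∞) : EReal)) :=
      EReal.continuousAt_add (Or.inl (EReal.coe_ne_top _)) (Or.inl (EReal.coe_ne_bot _))
    exact ContinuousAt.comp
      (f := fun x : ℝ≥0∞ => (((c + 2 * Real.log D : ℝ) : EReal), -((2 * x : ℝ≥0∞) : EReal))) h
      (continuousAt_const.prodMk h1.continuousAt)
  have hanti : Antitone fun x : ℝ≥0∞ =>
      ((c + 2 * Real.log D : ℝ) : EReal) - ((2 * x : ℝ≥0∞) : EReal) := fun x x' hx =>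
    EReal.sub_le_sub le_rfl (by exact_mod_cast mul_le_mul_right hx 2)
  have husc := hc.comp_lowerSemicontinuous_antitone (lowerSemicontinuous_pot D σ) hanti
  have hnear : ∀ᶠ z' in 𝓝 z, ‖z'‖ < ‖z‖ + 1 :=
    continuous_norm.continuousAt.eventually_lt continuousAt_const (by linarith)
  filter_upwards [husc z y hy, hnear] with z' h1 h2
  rw [potFun_eq h0 hR c (D := D) (by simp only [D]; linarith)]
  exact h1

lemma lintegral_circle_eq (z : ℂ) (r : ℝ) {f : ℂ → ℝ≥0∞} (hf : Measurable f) :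
    ∫⁻ θ in Set.Ioc 0 (2 * Real.pi), f (circleMap z r θ) =
      ENNReal.ofReal (2 * Real.pi) * ∫⁻ w, f w ∂(circ z r) := by
  rw [lintegral_circ _ _ hf, ← mul_assoc, mul_comm (ENNReal.ofReal _), two_pi_inv_mul_self,
    one_mul]

/-- This is the super-mean value property of the potential with the sign reversed. If the potential
is infinite at the centre, the left side is $-\infty$; otherwise its circle mean is finite and the
extended integral is a genuine one. -/
lemma potFun_submean (h0 : 0 ≤ R₀) (hR : ∀ᵐ w ∂σ, ‖w‖ ≤ R₀) (c : ℝ) (z : ℂ) {r : ℝ} (hr : 0 < r) :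
    potFun R₀ σ c z ≤ (((2 * Real.pi)⁻¹ : ℝ) : EReal) *
      eintegral (volume.restrict (Set.Ioc 0 (2 * Real.pi)))
        (fun θ : ℝ => potFun R₀ σ c (circleMap z r θ)) := by
  set D := ‖z‖ + r + R₀ + 1
  have hDz : ‖z‖ + R₀ + 1 ≤ D := by simp only [D]; linarith
  have hpi : (0 : ℝ) < 2 * Real.pi := by positivity
  rw [potFun_eq h0 hR c hDz]
  rcases eq_or_ne (pot D σ z) ⊤ with htop | htop
  · rw [htop]; simp
  have hfun : ∀ θ, potFun R₀ σ c (circleMap z r θ) = ((c + 2 * Real.log D : ℝ) : EReal)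
      - ((2 * pot D σ (circleMap z r θ) : ℝ≥0∞) : EReal) := fun θ => by
    refine potFun_eq h0 hR c ?_
    have : ‖circleMap z r θ‖ ≤ ‖z‖ + r := by
      refine (norm_add_le _ _).trans ?_
      simp [abs_of_pos hr]
    simp only [D]; linarith
  have hmean : ∫⁻ w, pot D σ w ∂(circ z r) ≤ pot D σ z := by
    refine lintegral_pot_circ_le hr ?_
    filter_upwards [hR] with w hw
    have := norm_sub_le z w
    simp only [D]; linarith
  have hm : Measurable fun θ => 2 * pot D σ (circleMap z r θ) :=
    ((measurable_pot D σ).comp (measurable_circleMap z r)).const_mul 2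
  have hint : ∫⁻ θ in Set.Ioc 0 (2 * Real.pi), 2 * pot D σ (circleMap z r θ) =
      ENNReal.ofReal (2 * Real.pi) * (2 * ∫⁻ w, pot D σ w ∂(circ z r)) := by
    rw [lintegral_circle_eq z r (f := fun w => 2 * pot D σ w) ((measurable_pot D σ).const_mul 2),
      lintegral_const_mul _ (measurable_pot D σ)]
  have hne : ∫⁻ w, pot D σ w ∂(circ z r) ≠ ⊤ := ne_top_of_le_ne_top htop hmean
  have hfin : ∫⁻ θ in Set.Ioc 0 (2 * Real.pi), 2 * pot D σ (circleMap z r θ) ≠ ⊤ := by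
    rw [hint]
    exact ENNReal.mul_ne_top ENNReal.ofReal_ne_top (ENNReal.mul_ne_top (by simp) hne)
  have hI := integrable_toReal_of_lintegral_ne_top hm.aemeasurable hfin
  rw [eintegral_coe_real (h := fun θ => (c + 2 * Real.log D) -
    (2 * pot D σ (circleMap z r θ)).toReal) _ ((integrable_const _).sub hI)]
  · rw [integral_sub (integrable_const _) hI,
      integral_toReal hm.aemeasurable (ae_lt_top hm hfin), hint, ← EReal.coe_mul]
    have h1 := ENNReal.toReal_mono htop hmean
    lift pot D σ z to ℝ≥0 using htop with a
    have h2 : (2 * (a : ℝ≥0∞)) = ((2 * a : ℝ≥0) : ℝ≥0∞) := by push_cast; rfl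
    rw [h2]
    change _ - (((2 * a : ℝ≥0) : ℝ) : EReal) ≤ _
    rw [← EReal.coe_sub, EReal.coe_le_coe_iff]
    simp only [integral_const, MeasurableSet.univ, measureReal_restrict_apply, Set.univ_inter,
      Real.volume_real_Ioc_of_le hpi.le, sub_zero, smul_eq_mul, ENNReal.toReal_mul,
      ENNReal.toReal_ofReal hpi.le, ENNReal.toReal_ofNat]
    rw [ENNReal.coe_toReal] at h1
    rw [← mul_sub, inv_mul_cancel_left₀ hpi.ne']
    push_cast
    linarith
  · filter_upwards [ae_lt_top hm hfin] with θ hθ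
    rw [hfun θ, EReal.coe_sub]
    lift 2 * pot D σ (circleMap z r θ) to ℝ≥0 using hθ.ne with b
    rfl

lemma isSubharmonic_potFun (h0 : 0 ≤ R₀) (hR : ∀ᵐ w ∂σ, ‖w‖ ≤ R₀) (c : ℝ) :
    IsSubharmonic (potFun R₀ σ c) where
  ne_top := potFun_ne_top R₀ σ c
  usc := upperSemicontinuous_potFun h0 hR c
  submean z _ hr := potFun_submean h0 hR c z hr

lemma potFun_mem_obstacleClass {Q : ℂ → EReal} (h0 : 0 ≤ R₀) (hR : ∀ᵐ w ∂σ, ‖w‖ ≤ R₀) {c : ℝ}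
    (hQ : ∀ z, potFun R₀ σ c z ≤ Q z) : potFun R₀ σ c ∈ obstacleClass Q := by
  refine ⟨isSubharmonic_potFun h0 hR c, hQ, c + 2 * Real.log 2, ?_⟩
  filter_upwards [(tendsto_norm_cobounded_atTop (E := ℂ)).eventually_ge_atTop (R₀ + 1)] with z hz
  refine (potFun_le R₀ σ c z).trans ?_
  have hz0 : 0 < ‖z‖ := by linarith
  rw [EReal.coe_le_coe_iff, Real.log_pow]
  have : Real.log (‖z‖ + R₀ + 1) ≤ Real.log 2 + Real.log ‖z‖ := by
    rw [← Real.log_mul (by norm_num) hz0.ne']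
    exact Real.log_le_log (by linarith) (by linarith)
  push_cast
  linarith

/-! ### The Euler-Lagrange conditions -/

/-- The constant undoes the normalizations: $2\log D$ from the kernel and $B$ from the shift of $Q$.
With it, a lower bound $m$ for the effective potential reads as an inequality with $Q$. -/
lemma potFun_le_of_le (h0 : 0 ≤ R₀) (hR : ∀ᵐ w ∂σ, ‖w‖ ≤ R₀) {Q : ℂ → EReal} {B : ℝ}
    {z : ℂ} (hB : -(B : EReal) ≤ Q z) {D : ℝ} (hD : ‖z‖ + R₀ + 1 ≤ D) {m : ℝ}
    (hm : ENNReal.ofReal m ≤ 2 * pot D σ z + shiftPot Q B z) :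
    potFun R₀ σ (m - 2 * Real.log D - B) z ≤ Q z := by
  rw [potFun_eq h0 hR _ hD]
  rcases eq_or_ne (pot D σ z) ⊤ with ha | ha
  · rw [ha]; simp
  rcases eq_or_ne (Q z) ⊤ with hq | hq
  · rw [hq]; exact le_top
  have hq' : shiftPot Q B z ≠ ⊤ := by
    rw [shiftPot, EReal.toENNReal_ne_top_iff]
    exact EReal.add_ne_top hq (EReal.coe_ne_top _)
  rw [coe_toReal_sub_of_eq hB hq']
  change _ ≤ (((shiftPot Q B z).toReal - B : ℝ) : EReal)
  lift shiftPot Q B z to ℝ≥0 using hq' with b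
  lift pot D σ z to ℝ≥0 using ha with a
  have h2 : (2 * (a : ℝ≥0∞)) = ((2 * a : ℝ≥0) : ℝ≥0∞) := by push_cast; rfl
  rw [h2] at hm ⊢
  change _ - (((2 * a : ℝ≥0) : ℝ) : EReal) ≤ _
  rw [← EReal.coe_sub, EReal.coe_le_coe_iff]
  have h3 : m ≤ 2 * a + b := by
    rw [← ENNReal.coe_add, ENNReal.ofReal, ENNReal.coe_le_coe, Real.toNNReal_le_iff_le_coe] at hm
    exact_mod_cast hm
  rw [ENNReal.coe_toReal]
  push_cast
  linarith

lemma potFun_eq_of_eq (h0 : 0 ≤ R₀) (hR : ∀ᵐ w ∂σ, ‖w‖ ≤ R₀) {Q : ℂ → EReal} {B : ℝ}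
    {z : ℂ} (hB : -(B : EReal) ≤ Q z) {D : ℝ} (hD : ‖z‖ + R₀ + 1 ≤ D) {m : ℝ} (hm0 : 0 ≤ m)
    (hm : 2 * pot D σ z + shiftPot Q B z = ENNReal.ofReal m) :
    potFun R₀ σ (m - 2 * Real.log D - B) z = Q z := by
  have hfin : 2 * pot D σ z + shiftPot Q B z ≠ ⊤ := by rw [hm]; exact ENNReal.ofReal_ne_top
  rw [ENNReal.add_ne_top] at hfin
  obtain ⟨ha, hq'⟩ := hfin
  rw [potFun_eq h0 hR _ hD, coe_toReal_sub_of_eq hB hq']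
  change _ = (((shiftPot Q B z).toReal - B : ℝ) : EReal)
  lift shiftPot Q B z to ℝ≥0 using hq' with b
  lift 2 * pot D σ z to ℝ≥0 using ha with a
  change _ - ((a : ℝ) : EReal) = _
  rw [← EReal.coe_sub, EReal.coe_eq_coe_iff]
  have h3 : a + b = m := by
    rw [← ENNReal.coe_add, ENNReal.ofReal, ENNReal.coe_inj] at hm
    rw [← NNReal.coe_add, hm, Real.coe_toNNReal _ hm0]
  rw [ENNReal.coe_toReal]
  linarith

end Competitor

lemma IsC2Near.exists_shiftPot_le {Q : ℂ → EReal} {S : Set ℂ} (h : IsC2Near Q S)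
    (hbot : ∀ z, Q z ≠ ⊥) (B : ℝ) {p : ℂ} (hp : p ∈ S) {ε : ℝ} (hε : 0 < ε) :
    shiftPot Q B p ≠ ⊤ ∧ ∃ δ > 0, ∀ z, ‖z - p‖ ≤ δ →
      shiftPot Q B z ≤ shiftPot Q B p + ENNReal.ofReal ε := by
  obtain ⟨U, hU, hSU, hfin, hC⟩ := h
  have hpU := hSU hp
  have heq : ∀ z ∈ U, shiftPot Q B z = ENNReal.ofReal ((Q z).toReal + B) := fun z hz => by
    rw [shiftPot, ← EReal.real_coe_toENNReal, EReal.coe_add, EReal.coe_toReal (hfin z hz) (hbot z)]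
  refine ⟨by rw [heq p hpU]; exact ENNReal.ofReal_ne_top, ?_⟩
  have hcont := (hC.continuousOn.continuousAt (hU.mem_nhds hpU))
  have hev : ∀ᶠ z in 𝓝 p, (Q z).toReal < (Q p).toReal + ε :=
    hcont.eventually_lt continuousAt_const (by linarith)
  obtain ⟨δ, hδ, hball⟩ := Metric.eventually_nhds_iff.1 (hev.and (hU.eventually_mem hpU))
  refine ⟨δ / 2, by positivity, fun z hz => ?_⟩
  obtain ⟨h1, h2⟩ := hball (y := z) (by rw [dist_eq_norm]; linarith)
  rw [heq z h2, heq p hpU]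
  calc _ ≤ ENNReal.ofReal ((Q p).toReal + B + ε) := ENNReal.ofReal_le_ofReal (by linarith)
    _ ≤ _ := ENNReal.ofReal_add_le

/-! ### First variation at points of the droplet. -/

section Frostman

variable {Q : ℂ → EReal} {σ : Measure ℂ} {R₀ B R : ℝ}

lemma ae_circ_norm_le {p : ℂ} {r : ℝ} (hr : 0 ≤ r) (h : ‖p‖ + r ≤ R) :
    ∀ᵐ z ∂(circ p r), ‖z‖ ≤ R := by
  filter_upwards [ae_circ (p := p) hr] with z hz
  calc ‖z‖ = ‖p + (z - p)‖ := by congr 1; ring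
    _ ≤ R := (norm_add_le _ _).trans (by rw [hz]; exact h)

lemma lintegral_shiftPot_circ_le {p : ℂ} {δ ε r : ℝ} (hr : 0 ≤ r) (hrδ : r ≤ δ)
    (h : ∀ z, ‖z - p‖ ≤ δ → shiftPot Q B z ≤ shiftPot Q B p + ENNReal.ofReal ε) :
    ∫⁻ z, shiftPot Q B z ∂(circ p r) ≤ shiftPot Q B p + ENNReal.ofReal ε := by
  calc _ ≤ ∫⁻ _, (shiftPot Q B p + ENNReal.ofReal ε) ∂(circ p r) := by
        refine lintegral_mono_ae ?_
        filter_upwards [ae_circ (p := p) hr] with z hz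
        exact h z (hz.le.trans hrδ)
    _ = _ := by simp

lemma norm_le_of_mem_support (hR : ∀ᵐ w ∂σ, ‖w‖ ≤ R₀) {p : ℂ} (hp : p ∈ σ.support) :
    ‖p‖ ≤ R₀ := by
  have := Measure.support_subset_of_isClosed (μ := σ) (Metric.isClosed_closedBall (x := (0 : ℂ))
    (ε := R₀)) (by filter_upwards [hR] with w hw; simpa using hw) hp
  simpa using this

/-- The minimizer does at least as well as a small circle around a point of the droplet, where $Q$
is bounded above. -/
lemma shiftEnergy_lt_top (hQ : IsExternalPotential Q) (hσ : IsEquilibriumMeasure Q σ)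
    (hC2 : IsC2Near Q σ.support) (hB : ∀ z, -(B : EReal) ≤ Q z) (h0 : 0 ≤ R₀)
    (hR₀ : ∀ᵐ w ∂σ, ‖w‖ ≤ R₀) (hR : R₀ + 1 ≤ R) :
    shiftEnergy (2 * R) (shiftPot Q B) σ < ⊤ := by
  have := hσ.1.1
  obtain ⟨p, hp⟩ := Measure.nonempty_support (IsProbabilityMeasure.ne_zero σ)
  obtain ⟨hfin, δ, hδ, hnear⟩ := hC2.exists_shiftPot_le hQ.ne_bot B hp zero_lt_one
  have hpn := norm_le_of_mem_support hR₀ hp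
  set r := min δ 1
  have hr : 0 < r := lt_min hδ one_pos
  have hr1 : r ≤ 1 := min_le_right _ _
  refine (hσ.shiftEnergy_le hQ.lsc.measurable hB (μ := circ p r) (R := R)
    (hR₀.mono fun z hz => by linarith) (ae_circ_norm_le hr.le (by linarith))).trans_lt ?_
  refine ENNReal.add_lt_top.2 ⟨lintegral_pot_circ_lt_top hr ?_, ?_⟩
  · filter_upwards [ae_circ (p := p) hr.le] with w hw
    rw [norm_sub_rev, hw]; linarith
  · exact (lintegral_shiftPot_circ_le hr.le (min_le_left _ _) hnear).trans_lt
      (ENNReal.add_lt_top.2 ⟨hfin.lt_top, ENNReal.ofReal_lt_top⟩)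

lemma isProbabilityMeasure_mix {μ ν : Measure ℂ} [IsProbabilityMeasure μ]
    [IsProbabilityMeasure ν] {t : ℝ} (h0 : 0 ≤ t) (h1 : t ≤ 1) :
    IsProbabilityMeasure (ENNReal.ofReal (1 - t) • μ + ENNReal.ofReal t • ν) := ⟨by
  simp only [Measure.coe_add, Measure.coe_smul, Pi.add_apply, Pi.smul_apply, measure_univ,
    smul_eq_mul, mul_one]
  rw [← ENNReal.ofReal_add (by linarith) h0]
  simp⟩

/-- Vary $\sigma$ towards a small circle centred at $p$. The super-mean value property bounds the
potential term by its value at $p$, and continuity of $Q$ near the droplet handles the other term up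
to $\varepsilon$. -/
lemma lintegral_effective_le_apply (hQ : IsExternalPotential Q) (hσ : IsEquilibriumMeasure Q σ)
    (hC2 : IsC2Near Q σ.support) (hB : ∀ z, -(B : EReal) ≤ Q z) (h0 : 0 ≤ R₀)
    (hR₀ : ∀ᵐ w ∂σ, ‖w‖ ≤ R₀) (hR : R₀ + 1 ≤ R) {p : ℂ} (hp : p ∈ σ.support) :
    ∫⁻ z, (2 * pot (2 * R) σ z + shiftPot Q B z) ∂σ ≤ 2 * pot (2 * R) σ p + shiftPot Q B p := by
  have := hσ.1.1
  have hpn := norm_le_of_mem_support hR₀ hp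
  have hqm := (hQ.lowerSemicontinuous_shiftPot B).measurable
  refine ENNReal.le_of_forall_pos_le_add fun ε hε _ => ?_
  obtain ⟨hfin, δ, hδ, hnear⟩ := hC2.exists_shiftPot_le hQ.ne_bot B hp (ε := ε) (by exact_mod_cast hε)
  -- $\delta$ controls the oscillation of $Q$; the bound $1$ keeps the circle inside the disc of
  -- radius $R_0+1\le R$.
  set r := min δ 1
  have hr : 0 < r := lt_min hδ one_pos
  have hr1 : r ≤ 1 := min_le_right _ _
  have hqν := lintegral_shiftPot_circ_le hr.le (min_le_left _ _) hnear
  have hD : ∀ᵐ w ∂σ, ‖p - w‖ + r ≤ 2 * R := by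
    filter_upwards [hR₀] with w hw
    have := norm_sub_le p w
    linarith
  have hc := ae_circ_norm_le (R := R) (p := p) hr.le (by linarith)
  calc _ ≤ ∫⁻ z, (2 * pot (2 * R) σ z + shiftPot Q B z) ∂(circ p r) := by
        refine lintegral_effective_le hqm (shiftEnergy_lt_top hQ hσ hC2 hB h0 hR₀ hR)
          (lintegral_pot_circ_lt_top hr hD) (lintegral_pot_circ_lt_top hr ?_)
          (hqν.trans_lt (ENNReal.add_lt_top.2 ⟨hfin.lt_top, ENNReal.ofReal_lt_top⟩)) ?_
        · filter_upwards [ae_circ (p := p) hr.le] with w hw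
          rw [norm_sub_rev, hw]; linarith
        · intro t ht0 ht1
          have := isProbabilityMeasure_mix (μ := σ) (ν := circ p r) ht0.le ht1.le
          refine hσ.shiftEnergy_le hQ.lsc.measurable hB
            (hR₀.mono fun z hz => by linarith) ?_
          refine ae_add_measure_iff.2 ⟨Measure.ae_smul_measure (hR₀.mono fun z hz => by linarith) _,
            Measure.ae_smul_measure hc _⟩
    _ ≤ 2 * pot (2 * R) σ p + (shiftPot Q B p + ENNReal.ofReal ε) := by
        rw [lintegral_add_right _ hqm, lintegral_const_mul _ (measurable_pot _ σ)]
        gcongr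
        exact lintegral_pot_circ_le hr hD
    _ = _ := by rw [ENNReal.ofReal_coe_nnreal, add_assoc]

lemma potFun_coe {c : ℝ} {z : ℂ} (h : pot (‖z‖ + R₀ + 1) σ z ≠ ⊤) :
    potFun R₀ σ c z = ((c + 2 * (Real.log (‖z‖ + R₀ + 1)
      - (pot (‖z‖ + R₀ + 1) σ z).toReal) : ℝ) : EReal) := by
  rw [potFun]
  lift pot (‖z‖ + R₀ + 1) σ z to ℝ≥0 using h with a
  have h2 : (2 * (a : ℝ≥0∞)) = ((2 * a : ℝ≥0) : ℝ≥0∞) := by push_cast; rfl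
  rw [h2]
  change _ - (((2 * a : ℝ≥0) : ℝ) : EReal) = _
  rw [← EReal.coe_sub, ENNReal.coe_toReal]
  congr 1
  push_cast
  ring

lemma pot_ne_top_of_potFun_ne_bot {c : ℝ} {z : ℂ} (h : potFun R₀ σ c z ≠ ⊥) :
    pot (‖z‖ + R₀ + 1) σ z ≠ ⊤ := fun htop => h (by rw [potFun, htop]; simp)

lemma le_of_potFun_le {c u : ℝ} {z : ℂ} (h : potFun R₀ σ u z ≠ ⊥)
    (hcu : potFun R₀ σ c z ≤ potFun R₀ σ u z) : c ≤ u := by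
  have hfin := pot_ne_top_of_potFun_ne_bot h
  rw [potFun_coe hfin, potFun_coe hfin, EReal.coe_le_coe_iff] at hcu
  linarith

/-- The Euler-Lagrange conditions: a translate of the logarithmic potential of the equilibrium
measure lies below `Q`, with equality on the droplet. -/
lemma exists_potFun_le (hQ : IsExternalPotential Q) (hσ : IsEquilibriumMeasure Q σ)
    (hC2 : IsC2Near Q σ.support)
    (hcoin : ∀ z, z ∉ σ.support → (⨆ f ∈ obstacleClass Q, f z) < Q z) (h0 : 0 ≤ R₀)
    (hR₀ : ∀ᵐ w ∂σ, ‖w‖ ≤ R₀) :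
    ∃ c : ℝ, (∀ z, potFun R₀ σ c z ≤ Q z) ∧ ∀ z ∈ σ.support, potFun R₀ σ c z = Q z := by
  have := hσ.1.1
  obtain ⟨B, hB⟩ := hQ.exists_lower_bound
  have hqm : Measurable (shiftPot Q B) := (hQ.lowerSemicontinuous_shiftPot B).measurable
  -- a point where the effective potential is finite
  obtain ⟨z₁, hz₁, u, hu⟩ : ∃ z₁, ‖z₁‖ ≤ R₀ ∧ ∃ u : ℝ, Q z₁ ≤ potFun R₀ σ u z₁ := by
    have hE := shiftEnergy_lt_top hQ hσ hC2 hB h0 hR₀ (le_refl (R₀ + 1))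
    rw [shiftEnergy, ENNReal.add_lt_top] at hE
    obtain ⟨z, h1, h2, h3⟩ := ((ae_lt_top (measurable_pot _ σ) hE.1.ne).and
      ((ae_lt_top hqm hE.2.ne).and hR₀)).exists
    have hD : ‖z‖ + R₀ + 1 ≤ 2 * (R₀ + 1) := by linarith
    have hf : 2 * pot (2 * (R₀ + 1)) σ z + shiftPot Q B z ≠ ⊤ :=
      ENNReal.add_ne_top.2 ⟨ENNReal.mul_ne_top (by simp) h1.ne, h2.ne⟩
    exact ⟨z, h3, _, (potFun_eq_of_eq h0 hR₀ (hB z) hD ENNReal.toReal_nonneg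
      (ENNReal.ofReal_toReal hf).symm).ge⟩
  -- The final constant $c$ is a minimum over a disc whose radius should make growth dominate $c$.
  -- The circularity is broken by $u$, fixed beforehand, since $c\le u$ whatever the radius.
  obtain ⟨R₁, -, hR₁⟩ := (Filter.hasBasis_cobounded_norm (E := ℂ)).eventually_iff.1
    (hQ.eventually_log_le (R₀ + 1) u)
  set R := max R₁ (R₀ + 1)
  have hRR : R₀ + 1 ≤ R := le_max_right _ _
  set Φ : ℂ → ℝ≥0∞ := fun z => 2 * pot (2 * R) σ z + shiftPot Q B z
  have hΦ : LowerSemicontinuous Φ := by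
    refine LowerSemicontinuous.add ?_ (hQ.lowerSemicontinuous_shiftPot B)
    exact (ENNReal.continuous_const_mul (by simp)).comp_lowerSemicontinuous
      (lowerSemicontinuous_pot _ σ) fun x y hxy => mul_le_mul_right hxy 2
  have hΦfin : ∀ᵐ z ∂σ, Φ z < ⊤ := by
    have hE := shiftEnergy_lt_top hQ hσ hC2 hB h0 hR₀ hRR
    rw [shiftEnergy, ENNReal.add_lt_top] at hE
    filter_upwards [ae_lt_top (measurable_pot _ σ) hE.1.ne, ae_lt_top hqm hE.2.ne] with z h1 h2
    exact ENNReal.add_lt_top.2 ⟨ENNReal.mul_lt_top (by simp) h1, h2⟩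
  have hne : (Metric.closedBall (0 : ℂ) R).Nonempty :=
    ⟨0, Metric.mem_closedBall_self (by linarith)⟩
  obtain ⟨p, hpR, hp⟩ := (hΦ.lowerSemicontinuousOn _).exists_isMinOn hne (isCompact_closedBall _ _)
  have hpn : ‖p‖ ≤ R := by simpa using hpR
  have hmin : ∀ z, ‖z‖ ≤ R → Φ p ≤ Φ z := fun z hz => hp (by simpa using hz)
  have hpfin : Φ p ≠ ⊤ := by
    obtain ⟨z, h1, h2⟩ := (hΦfin.and hR₀).exists
    exact ne_top_of_le_ne_top h1.ne (hmin z (by linarith))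
  set m := (Φ p).toReal
  have hm : ENNReal.ofReal m = Φ p := ENNReal.ofReal_toReal hpfin
  have hm0 : 0 ≤ m := ENNReal.toReal_nonneg
  have hDz : ∀ z : ℂ, ‖z‖ ≤ R → ‖z‖ + R₀ + 1 ≤ 2 * R := fun z hz => by linarith
  set c := m - 2 * Real.log (2 * R) - B
  have hcu : c ≤ u := by
    have h1 := potFun_le_of_le h0 hR₀ (hB z₁) (hDz z₁ (by linarith)) (m := m)
      (by rw [hm]; exact hmin z₁ (by linarith))
    have h2 := h1.trans hu
    refine le_of_potFun_le (fun hbot => ?_) h2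
    rw [hbot, le_bot_iff] at hu
    exact hQ.ne_bot z₁ hu
  have hle : ∀ z, potFun R₀ σ c z ≤ Q z := by
    intro z
    rcases le_or_gt ‖z‖ R with hz | hz
    · exact potFun_le_of_le h0 hR₀ (hB z) (hDz z hz) (by rw [hm]; exact hmin z hz)
    · refine (potFun_le R₀ σ c z).trans (le_trans ?_ (hR₁ ((le_max_left _ _).trans hz.le)))
      rw [EReal.coe_le_coe_iff, add_assoc]
      linarith
  -- At $p$ the competitor touches $Q$, which is excluded off the support.
  have hpS : p ∈ σ.support := by
    by_contra hpS
    have h1 := hcoin p hpS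
    have h2 : potFun R₀ σ c p ≤ ⨆ f ∈ obstacleClass Q, f p :=
      le_iSup₂_of_le (f := fun (f : ℂ → EReal) (_ : f ∈ obstacleClass Q) => f p)
        (potFun R₀ σ c) (potFun_mem_obstacleClass h0 hR₀ hle) le_rfl
    rw [potFun_eq_of_eq h0 hR₀ (hB p) (hDz p hpn) hm0 hm.symm] at h2
    exact absurd h1 (not_lt.2 h2)
  -- The mean of $\Phi$ under $\sigma$ does not exceed its minimum, so $\Phi$ is $\sigma$-a.e. equal
  -- to it. The sublevel set is closed and has full measure, hence contains the support.
  have hint : ∫⁻ z, Φ z ∂σ ≤ ∫⁻ _, Φ p ∂σ := by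
    rw [lintegral_const, measure_univ, mul_one]
    exact lintegral_effective_le_apply hQ hσ hC2 hB h0 hR₀ hRR hpS
  have hae : (fun _ => Φ p) =ᵐ[σ] Φ := by
    refine ae_eq_of_ae_le_of_lintegral_le ?_ (by simpa using hpfin) hΦ.measurable.aemeasurable hint
    filter_upwards [hR₀] with z hz
    exact hmin z (by linarith)
  refine ⟨c, hle, fun z hz => ?_⟩
  have hzn := norm_le_of_mem_support hR₀ hz
  have hclosed : IsClosed (Φ ⁻¹' Set.Iic (Φ p)) := hΦ.isClosed_preimage _
  have hmem := Measure.support_subset_of_isClosed hclosed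
    (by filter_upwards [hae] with w hw; exact hw.ge) hz
  exact potFun_eq_of_eq h0 hR₀ (hB z) (hDz z (by linarith)) hm0
    ((le_antisymm hmem (hmin z (by linarith))).trans hm.symm)

end Frostman

/-! ### Regularity of the real-valued logarithmic potential. -/

section RealPotential

lemma ae_ne_of_pot_ne_top {σ : Measure ℂ} {D : ℝ} {z : ℂ} (h : pot D σ z ≠ ⊤) : ∀ᵐ w ∂σ, w ≠ z := by
  filter_upwards [ae_lt_top (measurable_kern_right D z) h] with w hw hwz
  rw [hwz, kern_self] at hw
  exact lt_irrefl _ hw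

variable {σ : Measure ℂ} [IsProbabilityMeasure σ] {R₀ : ℝ}

lemma integrable_log_of_pot_ne_top {D : ℝ} {z : ℂ} (h : pot D σ z ≠ ⊤)
    (hD : ∀ᵐ w ∂σ, ‖z - w‖ ≤ D) : Integrable (fun w => Real.log ‖z - w‖) σ ∧
      (pot D σ z).toReal = Real.log D - ∫ w, Real.log ‖z - w‖ ∂σ := by
  have hae : (fun w => (kern D z w).toReal) =ᵐ[σ] fun w => Real.log D - Real.log ‖z - w‖ := by
    filter_upwards [hD, ae_ne_of_pot_ne_top h] with w hw hne
    rw [kern_of_ne hne.symm, ENNReal.toReal_ofReal]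
    have := Real.log_le_log (norm_pos_iff.2 (sub_ne_zero.2 hne.symm)) hw
    linarith
  have hI := integrable_toReal_of_lintegral_ne_top (measurable_kern_right D z).aemeasurable h
  have hI' : Integrable (fun w => Real.log ‖z - w‖) σ := by
    have := (integrable_const (μ := σ) (Real.log D)).sub (hI.congr hae)
    refine this.congr (Eventually.of_forall fun w => ?_)
    simp
  refine ⟨hI', ?_⟩
  rw [pot, ← integral_toReal (measurable_kern_right D z).aemeasurable
    (ae_lt_top (measurable_kern_right D z) h), integral_congr_ae hae,
    integral_sub (integrable_const _) hI']
  simp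

lemma potFun_eq_integral (hR : ∀ᵐ w ∂σ, ‖w‖ ≤ R₀) {c : ℝ} {z : ℂ}
    (h : potFun R₀ σ c z ≠ ⊥) : Integrable (fun w => Real.log ‖z - w‖) σ ∧
      potFun R₀ σ c z = ((c + 2 * ∫ w, Real.log ‖z - w‖ ∂σ : ℝ) : EReal) := by
  have hfin := pot_ne_top_of_potFun_ne_bot h
  obtain ⟨h1, h2⟩ := integrable_log_of_pot_ne_top hfin (by
    filter_upwards [hR] with w hw
    exact (norm_sub_le _ _).trans (by linarith))
  refine ⟨h1, ?_⟩
  rw [potFun_coe hfin, h2]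
  congr 1
  ring

lemma potFun_ne_bot_of_dist {c d : ℝ} {z : ℂ} (hd : 0 < d) (h : ∀ᵐ w ∂σ, d ≤ ‖z - w‖) :
    potFun R₀ σ c z ≠ ⊥ := by
  set D := ‖z‖ + R₀ + 1
  have hfin : pot D σ z ≠ ⊤ := by
    have : pot D σ z ≤ ∫⁻ _, ENNReal.ofReal (Real.log D - Real.log d) ∂σ := by
      refine lintegral_mono_ae ?_
      filter_upwards [h] with w hw
      have hne : z ≠ w := by rintro rfl; simp at hw; linarith
      rw [kern_of_ne hne]
      exact ENNReal.ofReal_le_ofReal (by linarith [Real.log_le_log hd hw])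
    exact ne_top_of_le_ne_top (by simp) this
  rw [potFun_coe hfin]
  exact EReal.coe_ne_bot _

/-- Off the support, the logarithmic potential is locally the real part of a holomorphic
function. -/
lemma exists_holomorphic_log_potential {w₀ : ℂ} {r : ℝ} (hr : 0 < r)
    (h : ∀ᵐ w ∂σ, r ≤ ‖w - w₀‖) (hw₀ : Integrable (fun w => Real.log ‖w₀ - w‖) σ) :
    ∃ H : ℂ → ℂ, DifferentiableOn ℂ H (Metric.ball w₀ r) ∧
      ∀ z ∈ Metric.ball w₀ r, (H z).re = ∫ w, Real.log ‖z - w‖ ∂σ := by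
  -- This is $\log\frac{z-w}{w_0-w}$. The quotient stays in the unit disc about $1$, so the
  -- principal branch is holomorphic in $z$ for $\sigma$-almost every $w$.
  set F : ℂ → ℂ → ℂ := fun z w => Complex.log (1 + (z - w₀) / (w₀ - w))
  have hFm : ∀ z, Measurable (F z) := fun z => by
    refine Complex.measurable_log.comp ?_
    fun_prop
  have hlogm : ∀ z : ℂ, Measurable fun w => Real.log ‖z - w‖ := fun z => by
    refine Real.measurable_log.comp ?_
    fun_prop
  have hu : ∀ z ∈ Metric.ball w₀ r, ∀ w : ℂ, r ≤ ‖w - w₀‖ →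
      ‖(z - w₀) / (w₀ - w)‖ ≤ ‖z - w₀‖ / r := fun z _ w hw => by
    rw [norm_div, norm_sub_rev w₀ w]
    gcongr
  have hint : ∀ z ∈ Metric.ball w₀ r, Integrable (F z) σ := fun z hz => by
    set s := ‖z - w₀‖ / r
    have hs0 : 0 ≤ s := by positivity
    have hs : s < 1 := by
      rw [div_lt_one hr]
      simpa [dist_eq_norm] using hz
    refine Integrable.of_bound (hFm z).aestronglyMeasurable (s ^ 2 * (1 - s)⁻¹ / 2 + s) ?_
    filter_upwards [h] with w hw
    have h1 := hu z hz w hw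
    refine (Complex.norm_log_one_add_le (h1.trans_lt hs)).trans ?_
    have : 0 < 1 - s := by linarith
    have h2 : (1 - ‖(z - w₀) / (w₀ - w)‖)⁻¹ ≤ (1 - s)⁻¹ := inv_anti₀ this (by linarith)
    have h3 : 0 ≤ (1 - ‖(z - w₀) / (w₀ - w)‖)⁻¹ := inv_nonneg.2 (by linarith)
    gcongr
  refine ⟨fun z => ((∫ w, Real.log ‖w₀ - w‖ ∂σ : ℝ) : ℂ) + ∫ w, F z w ∂σ, ?_, ?_⟩
  · intro z₀ hz₀
    refine DifferentiableAt.differentiableWithinAt ?_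
    refine (differentiableAt_const _).add ?_
    set ρ := (r - ‖z₀ - w₀‖) / 2
    have hz₀' : ‖z₀ - w₀‖ < r := by simpa [dist_eq_norm] using hz₀
    have hρ : 0 < ρ := by simp only [ρ]; linarith
    have hsub : ∀ z ∈ Metric.ball z₀ ρ, z ∈ Metric.ball w₀ r := fun z hz => by
      rw [Metric.mem_ball, dist_eq_norm] at hz ⊢
      have := norm_sub_le_norm_sub_add_norm_sub z z₀ w₀
      simp only [ρ] at hz
      linarith
    have key := hasDerivAt_integral_of_dominated_loc_of_deriv_le (μ := σ) (F := F) (x₀ := z₀)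
      (s := Metric.ball z₀ ρ) (bound := fun _ => ρ⁻¹) (F' := fun z w => (z - w)⁻¹)
      (Metric.ball_mem_nhds z₀ hρ)
      (Eventually.of_forall fun z => (hFm z).aestronglyMeasurable) (hint z₀ hz₀)
      (Measurable.aestronglyMeasurable (by fun_prop)) ?_ (integrable_const _) ?_
    · exact key.2.differentiableAt
    · filter_upwards [h] with w hw z hz
      rw [norm_inv]
      refine inv_anti₀ hρ ?_
      rw [Metric.mem_ball, dist_eq_norm] at hz
      have h1 := norm_sub_le_norm_sub_add_norm_sub w z w₀
      have h2 := norm_sub_le_norm_sub_add_norm_sub z z₀ w₀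
      rw [norm_sub_rev z w]
      simp only [ρ] at hz ⊢
      linarith
    · filter_upwards [h] with w hw z hz
      have hz' := hsub z hz
      have hwne : w₀ - w ≠ 0 := by
        rw [← norm_pos_iff, norm_sub_rev]; linarith
      have h1 : ‖(z - w₀) / (w₀ - w)‖ < 1 := by
        refine (hu z hz' w hw).trans_lt ?_
        rw [div_lt_one hr]
        simpa [dist_eq_norm] using hz'
      have hslit := Complex.mem_slitPlane_of_norm_lt_one h1
      have hd : HasDerivAt (fun z => 1 + (z - w₀) / (w₀ - w)) (1 / (w₀ - w)) z :=
        (((hasDerivAt_id z).sub_const w₀).div_const (w₀ - w)).const_add 1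
      have hzw : z - w ≠ 0 := by
        intro h0
        have : z = w := sub_eq_zero.1 h0
        subst this
        simp [dist_eq_norm] at hz'
        linarith
      have : 1 + (z - w₀) / (w₀ - w) = (z - w) / (w₀ - w) := by field_simp; ring
      have hinv : 1 / (w₀ - w) / (1 + (z - w₀) / (w₀ - w)) = (z - w)⁻¹ := by
        rw [this]
        field_simp
      rw [← hinv]
      exact hd.clog hslit
  · intro z hz
    have hre : (∫ w, F z w ∂σ).re = ∫ w, (F z w).re ∂σ := by
      have := integral_re (𝕜 := ℂ) (hint z hz)
      simpa using this.symm
    have hFre : (fun w => Real.log ‖z - w‖) =ᵐ[σ]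
        fun w => Real.log ‖w₀ - w‖ + (F z w).re := by
      filter_upwards [h] with w hw
      have hwne : w₀ - w ≠ 0 := by
        rw [← norm_pos_iff, norm_sub_rev]; linarith
      have hzw : z - w ≠ 0 := by
        intro h0
        have : z = w := sub_eq_zero.1 h0
        subst this
        simp [dist_eq_norm] at hz
        linarith
      have : 1 + (z - w₀) / (w₀ - w) = (z - w) / (w₀ - w) := by field_simp; ring
      simp only [F]
      rw [Complex.log_re, this, norm_div, Real.log_div (norm_ne_zero_iff.2 hzw)
        (norm_ne_zero_iff.2 hwne)]
      ring
    rw [Complex.add_re, Complex.ofReal_re, hre, integral_congr_ae hFre]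
    have hI : Integrable (fun w => (F z w).re) σ := (hint z hz).re
    rw [integral_add hw₀ hI]

/-- The continuity principle: a logarithmic potential whose restriction to the support is
continuous at a point of the support is lower semicontinuous there. -/
lemma eventually_lt_of_continuousAt_support {P : ℂ → ℝ} {S : Set ℂ} (hS : IsCompact S)
    (hσS : ∀ᵐ w ∂σ, w ∈ S) (hP : ∀ z, P z = ∫ w, Real.log ‖z - w‖ ∂σ)
    (hint : ∀ z, Integrable (fun w => Real.log ‖z - w‖) σ) (hne : ∀ z, ∀ᵐ w ∂σ, w ≠ z)
    {z₀ : ℂ} (hz₀ : z₀ ∈ S) (hcont : ContinuousWithinAt P S z₀) {y : ℝ} (hy : y < P z₀) :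
    ∀ᶠ z in 𝓝 z₀, y < P z := by
  choose π hπS hπ using fun z => hS.exists_infDist_eq_dist ⟨z₀, hz₀⟩ z
  have hπle : ∀ z, ∀ w ∈ S, ‖π z - z‖ ≤ ‖z - w‖ := fun z w hw => by
    rw [norm_sub_rev, ← dist_eq_norm, ← dist_eq_norm, ← hπ z]
    exact Metric.infDist_le_dist_of_mem hw
  have hπt : Tendsto π (𝓝 z₀) (𝓝 z₀) := by
    have h1 : Tendsto (fun z => 2 * ‖z - z₀‖) (𝓝 z₀) (𝓝 0) := by
      have : Continuous fun z : ℂ => 2 * ‖z - z₀‖ := by fun_prop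
      simpa using this.tendsto z₀
    refine tendsto_iff_norm_sub_tendsto_zero.2 (squeeze_zero (fun _ => norm_nonneg _) (fun z => ?_) h1)
    have := norm_sub_le_norm_sub_add_norm_sub (π z) z z₀
    linarith [hπle z z₀ hz₀]
  have hPπ : Tendsto (fun z => P (π z)) (𝓝 z₀) (𝓝 (P z₀)) :=
    hcont.tendsto.comp (tendsto_nhdsWithin_iff.2 ⟨hπt, Eventually.of_forall hπS⟩)
  -- With $\pi z$ a nearest point of $S$, $|\pi z-w|\le2|z-w|$ for $w\in S$. Hence $g\ge0$ a.e. and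
  -- Fatou applies: $\log2\le\liminf(\log2+P(z)-P(\pi z))$, while $P(\pi z)\to P(z_0)$ by continuity
  -- along $S$.
  set g : ℂ → ℂ → ℝ := fun z w => Real.log 2 + Real.log ‖z - w‖ - Real.log ‖π z - w‖
  have hgm : ∀ z, Measurable (g z) := fun z => by
    have hl : ∀ z : ℂ, Measurable fun w : ℂ => Real.log ‖z - w‖ := fun z =>
      Real.measurable_log.comp (by fun_prop)
    exact (measurable_const.add (hl z)).sub (hl (π z))
  have hgI : ∀ z, ∫⁻ w, ENNReal.ofReal (g z w) ∂σ = ENNReal.ofReal (Real.log 2 + P z - P (π z)) := by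
    intro z
    have hI : Integrable (g z) σ := ((integrable_const _).add (hint z)).sub (hint (π z))
    rw [← ofReal_integral_eq_lintegral_ofReal hI]
    · simp only [g]
      have h1 : Integrable (fun w => Real.log 2 + Real.log ‖z - w‖) σ :=
        (integrable_const _).add (hint z)
      rw [integral_sub h1 (hint (π z)), integral_add (integrable_const _) (hint z), hP z, hP (π z)]
      simp
    · filter_upwards [hσS, hne z, hne (π z)] with w hw h1 h2
      have hpos : 0 < ‖z - w‖ := norm_pos_iff.2 (sub_ne_zero.2 h1.symm)
      have hpos' : 0 < ‖π z - w‖ := norm_pos_iff.2 (sub_ne_zero.2 h2.symm)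
      have h3 : ‖π z - w‖ ≤ 2 * ‖z - w‖ := by
        have := norm_sub_le_norm_sub_add_norm_sub (π z) z w
        linarith [hπle z w hw]
      have := Real.log_le_log hpos' h3
      rw [Real.log_mul (by norm_num) hpos.ne'] at this
      simp only [Pi.zero_apply, g]
      linarith
  have hlim : ENNReal.ofReal (Real.log 2) ≤
      liminf (fun z => ENNReal.ofReal (Real.log 2 + P z - P (π z))) (𝓝 z₀) := by
    calc ENNReal.ofReal (Real.log 2) = ∫⁻ _, ENNReal.ofReal (Real.log 2) ∂σ := by simp
      _ = ∫⁻ w, liminf (fun z => ENNReal.ofReal (g z w)) (𝓝 z₀) ∂σ := by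
        refine lintegral_congr_ae ?_
        filter_upwards [hne z₀] with w hw
        have hw' : ‖z₀ - w‖ ≠ 0 := norm_ne_zero_iff.2 (sub_ne_zero.2 hw.symm)
        have t0 : Tendsto (fun z : ℂ => Real.log ‖z - w‖) (𝓝 z₀) (𝓝 (Real.log ‖z₀ - w‖)) :=
          ((continuousAt_id.sub continuousAt_const).norm.log hw').tendsto
        have t1 : Tendsto (fun z => g z w) (𝓝 z₀)
            (𝓝 (Real.log 2 + Real.log ‖z₀ - w‖ - Real.log ‖z₀ - w‖)) :=
          (tendsto_const_nhds.add t0).sub (t0.comp hπt)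
        rw [add_sub_cancel_right] at t1
        exact (ENNReal.tendsto_ofReal t1).liminf_eq.symm
      _ ≤ liminf (fun z => ∫⁻ w, ENNReal.ofReal (g z w) ∂σ) (𝓝 z₀) :=
        lintegral_liminf_le fun z => (hgm z).ennreal_ofReal
      _ = _ := by simp only [hgI]
  -- The bound by $\log2$ keeps $\log2-\eta$ nonnegative, so that strict inequalities survive
  -- `ENNReal.ofReal`.
  set η := min (Real.log 2) (P z₀ - y) / 2
  have hlog2 : 0 < Real.log 2 := Real.log_pos (by norm_num)
  have hη : 0 < η := by
    have : 0 < min (Real.log 2) (P z₀ - y) := lt_min hlog2 (by linarith)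
    simp only [η]; linarith
  have hη1 : η ≤ Real.log 2 / 2 := by
    simp only [η]; linarith [min_le_left (Real.log 2) (P z₀ - y)]
  have hη2 : η ≤ (P z₀ - y) / 2 := by
    simp only [η]; linarith [min_le_right (Real.log 2) (P z₀ - y)]
  have hlt : ENNReal.ofReal (Real.log 2 - η) <
      liminf (fun z => ENNReal.ofReal (Real.log 2 + P z - P (π z))) (𝓝 z₀) :=
    lt_of_lt_of_le ((ENNReal.ofReal_lt_ofReal_iff hlog2).2 (by linarith)) hlim
  filter_upwards [eventually_lt_of_lt_liminf hlt,
    hPπ.eventually (lt_mem_nhds (show P z₀ - η < P z₀ by linarith))] with z h1 h2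
  have h3 := (ENNReal.ofReal_lt_ofReal_iff_of_nonneg (by linarith)).1 h1
  linarith

end RealPotential

/-! ### Construction of the effective potential. -/

/-- A finite version of the obstacle function: it coincides with `Q` on `S`, is uniformly smaller
than `Q` away from `S`, harmonic off `S`, and grows like `2 log |z|`. -/
structure IsEffectivePotential (Q : ℂ → EReal) (S : Set ℂ) (V : ℂ → ℝ) : Prop where
  lsc : LowerSemicontinuous V
  eq_on : ∀ z ∈ S, Q z = V z
  growth : ∃ A c : ℝ, ∀ z : ℂ, A < ‖z‖ → 2 * Real.log (‖z‖ - A) + c ≤ V z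
  harmonic : ∀ (w : ℂ) (r : ℝ), 0 < r → Disjoint (Metric.ball w r) S →
    ∃ H : ℂ → ℂ, DifferentiableOn ℂ H (Metric.ball w r) ∧ ∀ z ∈ Metric.ball w r, (H z).re = V z
  gap : ∀ ε : ℝ, 0 < ε → ∃ δ : ℝ, 0 < δ ∧ ∀ z, ε ≤ Metric.infDist z S →
    ((V z + δ : ℝ) : EReal) ≤ Q z

lemma exists_gap_on_compact {Q : ℂ → EReal} {f : ℂ → EReal} (hQ : LowerSemicontinuous Q)
    (hf : UpperSemicontinuous f) {K : Set ℂ} (hK : IsCompact K) (h : ∀ z ∈ K, f z < Q z) :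
    ∃ δ : ℝ, 0 < δ ∧ ∀ z ∈ K, f z + δ ≤ Q z := by
  refine hK.induction_on (p := fun s => ∃ δ : ℝ, 0 < δ ∧ ∀ z ∈ s, f z + δ ≤ Q z)
    ⟨1, one_pos, by simp⟩ ?_ ?_ ?_
  · rintro s t hst ⟨δ, h1, h2⟩
    exact ⟨δ, h1, fun z hz => h2 z (hst hz)⟩
  · rintro s t ⟨δ, h1, h2⟩ ⟨δ', h1', h2'⟩
    refine ⟨min δ δ', lt_min h1 h1', fun z hz => ?_⟩
    rcases hz with hz | hz
    · exact (add_le_add_right (EReal.coe_le_coe_iff.2 (min_le_left _ _)) _).trans (h2 z hz)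
    · exact (add_le_add_right (EReal.coe_le_coe_iff.2 (min_le_right _ _)) _).trans (h2' z hz)
  · intro z hz
    obtain ⟨a, ha1, ha2⟩ := EReal.lt_iff_exists_real_btwn.1 (h z hz)
    obtain ⟨b, hb1, hb2⟩ := EReal.lt_iff_exists_real_btwn.1 ha2
    have hab : a < b := EReal.coe_lt_coe_iff.1 hb1
    refine ⟨_, mem_nhdsWithin_of_mem_nhds ((hf z a ha1).and (hQ z b hb2)), b - a, by linarith,
      fun w hw => ?_⟩
    refine le_trans ?_ hw.2.le
    calc f w + ((b - a : ℝ) : EReal) ≤ (a : EReal) + ((b - a : ℝ) : EReal) :=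
          add_le_add_left hw.1.le _
      _ = b := by rw [← EReal.coe_add]; congr 1; ring

/-- The function is the Euler–Lagrange translate of twice the logarithmic potential. Finiteness on
$S$ comes from equality with $Q$, and off $S$ from the positive distance to the support. -/
theorem exists_isEffectivePotential {Q : ℂ → EReal} (hQ : IsExternalPotential Q)
    {σ : Measure ℂ} (hσ : IsEquilibriumMeasure Q σ) (hC2 : IsC2Near Q σ.support)
    (hcoin : ∀ z, z ∉ σ.support → (⨆ f ∈ obstacleClass Q, f z) < Q z) :
    IsCompact σ.support ∧ σ.support.Nonempty ∧ ∃ V, IsEffectivePotential Q σ.support V := by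
  have := hσ.1.1
  obtain ⟨K, hK, hKσ⟩ := hσ.1.2
  obtain ⟨R₁, hR₁⟩ := hK.isBounded.exists_norm_le
  set R₀ := max R₁ 0
  have h0 : 0 ≤ R₀ := le_max_right _ _
  have hR : ∀ᵐ w ∂σ, ‖w‖ ≤ R₀ := by
    rw [ae_iff]
    refine measure_mono_null (fun w hw => ?_) hKσ
    intro hwK
    exact hw ((hR₁ w hwK).trans (le_max_left _ _))
  have hS : IsCompact σ.support := (isCompact_closedBall (0 : ℂ) R₀).of_isClosed_subset
    Measure.isClosed_support fun z hz => by simpa using norm_le_of_mem_support hR hz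
  have hSne : σ.support.Nonempty := Measure.nonempty_support (IsProbabilityMeasure.ne_zero σ)
  have hσS : ∀ᵐ w ∂σ, w ∈ σ.support := Measure.support_mem_ae
  refine ⟨hS, hSne, ?_⟩
  obtain ⟨c, hc1, hc2⟩ := exists_potFun_le hQ hσ hC2 hcoin h0 hR
  have hclt : ∀ z, z ∉ σ.support → potFun R₀ σ c z < Q z := fun z hz =>
    lt_of_le_of_lt (le_iSup₂_of_le (f := fun (f : ℂ → EReal) (_ : f ∈ obstacleClass Q) => f z)
        (potFun R₀ σ c) (potFun_mem_obstacleClass h0 hR hc1) le_rfl) (hcoin z hz)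
  have hballS : ∀ (w : ℂ) (r : ℝ), Disjoint (Metric.ball w r) σ.support →
      ∀ᵐ v ∂σ, r ≤ ‖v - w‖ := fun w r hd => by
    filter_upwards [hσS] with v hv
    by_contra hlt
    exact Set.disjoint_left.1 hd (by simpa [dist_eq_norm] using hlt) hv
  have hoff : ∀ z, z ∉ σ.support → ∃ r, 0 < r ∧ Disjoint (Metric.ball z r) σ.support := by
    intro z hz
    obtain ⟨r, hr, hsub⟩ := Metric.isOpen_iff.1 Measure.isOpen_compl_support z hz
    exact ⟨r, hr, Set.disjoint_left.2 fun v hv => hsub hv⟩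
  have hbot : ∀ z, potFun R₀ σ c z ≠ ⊥ := by
    intro z
    by_cases hz : z ∈ σ.support
    · rw [hc2 z hz]; exact hQ.ne_bot z
    · obtain ⟨r, hr, hd⟩ := hoff z hz
      refine potFun_ne_bot_of_dist hr ?_
      filter_upwards [hballS z r hd] with v hv
      rwa [norm_sub_rev]
  set P : ℂ → ℝ := fun z => ∫ w, Real.log ‖z - w‖ ∂σ
  have hint : ∀ z, Integrable (fun w => Real.log ‖z - w‖) σ := fun z =>
    (potFun_eq_integral hR (hbot z)).1
  have hV : ∀ z, potFun R₀ σ c z = ((c + 2 * P z : ℝ) : EReal) := fun z =>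
    (potFun_eq_integral hR (hbot z)).2
  have hne : ∀ z, ∀ᵐ w ∂σ, w ≠ z := fun z =>
    ae_ne_of_pot_ne_top (pot_ne_top_of_potFun_ne_bot (hbot z))
  have hharm : ∀ (w : ℂ) (r : ℝ), 0 < r → Disjoint (Metric.ball w r) σ.support →
      ∃ H : ℂ → ℂ, DifferentiableOn ℂ H (Metric.ball w r) ∧
        ∀ z ∈ Metric.ball w r, (H z).re = c + 2 * P z := by
    intro w r hr hd
    obtain ⟨H, h1, h2⟩ := exists_holomorphic_log_potential hr (hballS w r hd) (hint w)
    refine ⟨fun z => (c : ℂ) + 2 * H z, (differentiableOn_const _).add (h1.const_mul 2), ?_⟩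
    intro z hz
    simp [h2 z hz, P]
  have heq : ∀ z ∈ σ.support, Q z = ((c + 2 * P z : ℝ) : EReal) := fun z hz => by
    rw [← hV z, hc2 z hz]
  refine ⟨fun z => c + 2 * P z, ?_, heq, ?_, hharm, ?_⟩
  · intro z y hy
    by_cases hz : z ∈ σ.support
    · have hPc : ContinuousWithinAt P σ.support z := by
        obtain ⟨U, hU, hSU, -, hC⟩ := hC2
        have h1 : ContinuousWithinAt (fun w => ((Q w).toReal - c) / 2) σ.support z :=
          (((hC.continuousOn.continuousWithinAt (hSU hz)).mono hSU).sub
            continuousWithinAt_const).div_const 2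
        have h2 : ∀ w ∈ σ.support, P w = ((Q w).toReal - c) / 2 := fun w hw => by
          rw [heq w hw, EReal.toReal_coe]; ring
        exact h1.congr h2 (h2 z hz)
      filter_upwards [eventually_lt_of_continuousAt_support hS hσS (fun _ => rfl) hint hne hz hPc
        (y := (y - c) / 2) (by linarith)] with w hw
      linarith
    · obtain ⟨r, hr, hd⟩ := hoff z hz
      obtain ⟨H, h1, h2⟩ := hharm z r hr hd
      have hzr : z ∈ Metric.ball z r := Metric.mem_ball_self hr
      have hcz : ContinuousAt (fun v => (H v).re) z :=
        Complex.continuous_re.continuousAt.comp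
          ((h1.differentiableAt (Metric.ball_mem_nhds z hr)).continuousAt)
      have := hcz.eventually (lt_mem_nhds (show y < (H z).re by rw [h2 z hzr]; exact hy))
      filter_upwards [this, Metric.ball_mem_nhds z hr] with v hv hvr
      rwa [h2 v hvr] at hv
  · refine ⟨R₀, c, fun z hz => ?_⟩
    have : Real.log (‖z‖ - R₀) ≤ P z := by
      calc Real.log (‖z‖ - R₀) = ∫ _, Real.log (‖z‖ - R₀) ∂σ := by simp
        _ ≤ _ := by
          refine integral_mono_ae (integrable_const _) (hint z) ?_
          filter_upwards [hR] with w hw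
          refine Real.log_le_log (by linarith) ?_
          linarith [norm_sub_norm_le z w]
    change _ ≤ c + 2 * P z
    linarith
  · intro ε hε
    -- Growth gives a gap of $1$ outside a large disc; inside it, the strict inequality is made
    -- uniform by compactness.
    obtain ⟨R₂, -, hR₂⟩ := (Filter.hasBasis_cobounded_norm (E := ℂ)).eventually_iff.1
      (hQ.eventually_log_le (R₀ + 1) (c + 1))
    have hKc : IsCompact (Metric.closedBall (0 : ℂ) R₂ ∩ {z | ε ≤ Metric.infDist z σ.support}) :=
      (isCompact_closedBall _ _).inter_right
        (isClosed_le continuous_const (Metric.continuous_infDist_pt _))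
    have hlt : ∀ z, ε ≤ Metric.infDist z σ.support → potFun R₀ σ c z < Q z := fun z hz => by
      refine hclt z fun hzS => ?_
      rw [Metric.infDist_zero_of_mem hzS] at hz
      linarith
    obtain ⟨δ, hδ, hgap⟩ := exists_gap_on_compact hQ.lsc (upperSemicontinuous_potFun h0 hR c) hKc
      (fun z hz => hlt z hz.2)
    refine ⟨min δ 1, lt_min hδ one_pos, fun z hz => ?_⟩
    rw [EReal.coe_add, ← hV z]
    by_cases hzR : ‖z‖ ≤ R₂
    · exact (add_le_add_right (EReal.coe_le_coe_iff.2 (min_le_left _ _)) _).trans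
        (hgap z ⟨by simpa using hzR, hz⟩)
    · refine le_trans ?_ (hR₂ (not_le.1 hzR).le)
      calc potFun R₀ σ c z + ((min δ 1 : ℝ) : EReal)
          ≤ ((c + 2 * Real.log (‖z‖ + R₀ + 1) : ℝ) : EReal) + ((1 : ℝ) : EReal) :=
            add_le_add (potFun_le R₀ σ c z) (EReal.coe_le_coe_iff.2 (min_le_right _ _))
        _ = _ := by rw [← EReal.coe_add]; congr 1; rw [add_assoc ‖z‖]; ring

/-! ### Mean value estimates for holomorphic functions -/

lemma integral_circleMap_symm {g : ℂ → ℂ} (hg : Differentiable ℂ g) (w : ℂ) (ρ : ℝ) :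
    ∫ θ in -Real.pi..Real.pi, g (circleMap w ρ θ) = (2 * Real.pi : ℝ) • g w := by
  have h1 := (hg.diffContOnCl (s := Metric.ball w |ρ|)).circleAverage
  have hper : Function.Periodic (fun θ => g (circleMap w ρ θ)) (2 * Real.pi) := fun θ => by
    simp only [periodic_circleMap w ρ θ]
  have h2 := hper.intervalIntegral_add_eq (-Real.pi) 0
  rw [show -Real.pi + 2 * Real.pi = Real.pi by ring, zero_add] at h2
  rw [h2, ← h1, Real.circleAverage, smul_inv_smul₀ (by positivity)]

/-- The mean value property followed by Hölder's inequality. The convexity requirement $p\ge1$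
becomes $\beta\ge\tfrac12$ when $p=2\beta$. The interval $(-\pi,\pi)$ matches polar coordinates. -/
lemma rpow_enorm_le_lintegral_circle {g : ℂ → ℂ} (hg : Differentiable ℂ g) (w : ℂ) (ρ : ℝ)
    {p : ℝ} (hp : 1 ≤ p) :
    ENNReal.ofReal (2 * Real.pi) * ‖g w‖ₑ ^ p ≤
      ∫⁻ θ in Set.Ioo (-Real.pi) Real.pi, ‖g (circleMap w ρ θ)‖ₑ ^ p := by
  have hpi : (0 : ℝ) < 2 * Real.pi := by positivity
  set μ := (volume : Measure ℝ).restrict (Set.Ioo (-Real.pi) Real.pi)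
  set T := ENNReal.ofReal (2 * Real.pi)
  have hT0 : T ≠ 0 := by simp [T, Real.pi_pos]
  have hTt : T ≠ ⊤ := ENNReal.ofReal_ne_top
  have hμ : μ Set.univ = T := by
    simp only [μ, Measure.restrict_apply_univ, Real.volume_Ioo, T]
    congr 1; ring
  set f : ℝ → ℂ := fun θ => g (circleMap w ρ θ)
  have hf : Continuous f := hg.continuous.comp (continuous_circleMap w ρ)
  have h1 : T * ‖g w‖ₑ ≤ ∫⁻ θ, ‖f θ‖ₑ ∂μ := by
    have h := integral_circleMap_symm hg w ρ
    rw [intervalIntegral.integral_of_le (by linarith [Real.pi_pos]), integral_Ioc_eq_integral_Ioo] at h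
    calc T * ‖g w‖ₑ = ‖(2 * Real.pi : ℝ) • g w‖ₑ := by
          rw [enorm_smul, Real.enorm_eq_ofReal hpi.le]
      _ = ‖∫ θ, f θ ∂μ‖ₑ := by rw [← h]
      _ ≤ _ := enorm_integral_le_lintegral_enorm _
  have h2 := eLpNorm'_le_eLpNorm'_mul_rpow_measure_univ (μ := μ) (p := 1) (q := p) one_pos hp
    hf.aestronglyMeasurable
  simp only [eLpNorm', ENNReal.rpow_one, div_one, hμ] at h2
  have hp0 : 0 < p := by linarith
  have h3 : (T * ‖g w‖ₑ) ^ p ≤ (∫⁻ θ, ‖f θ‖ₑ ^ p ∂μ) * T ^ (p - 1) := by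
    calc (T * ‖g w‖ₑ) ^ p ≤ ((∫⁻ θ, ‖f θ‖ₑ ^ p ∂μ) ^ (1 / p) * T ^ (1 - 1 / p)) ^ p :=
          ENNReal.rpow_le_rpow (h1.trans h2) hp0.le
      _ = _ := by
        rw [ENNReal.mul_rpow_of_nonneg _ _ hp0.le, ← ENNReal.rpow_mul, ← ENNReal.rpow_mul,
          one_div_mul_cancel hp0.ne', ENNReal.rpow_one, sub_mul, one_div_mul_cancel hp0.ne',
          one_mul]
  rw [ENNReal.mul_rpow_of_nonneg _ _ hp0.le] at h3
  have h4 : T ^ p = T * T ^ (p - 1) := by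
    nth_rewrite 2 [← ENNReal.rpow_one T]
    rw [← ENNReal.rpow_add _ _ hT0 hTt]
    congr 1; ring
  have h5 : T ^ (p - 1) ≠ 0 := by simp [hT0, hTt]
  have h6 : T ^ (p - 1) ≠ ⊤ := by simp [hT0, hTt]
  rw [h4, mul_right_comm] at h3
  exact (ENNReal.mul_le_mul_iff_left h5 h6).1 h3

/-- The open annulus with centre `w` and radii `r / 2` and `r`. -/
def annulus (w : ℂ) (r : ℝ) : Set ℂ := {z | r / 2 < ‖z - w‖ ∧ ‖z - w‖ < r}

lemma isOpen_annulus (w : ℂ) (r : ℝ) : IsOpen (annulus w r) :=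
  (isOpen_lt (g := fun z : ℂ => ‖z - w‖) continuous_const (by fun_prop)).inter
    (isOpen_lt (f := fun z : ℂ => ‖z - w‖) (by fun_prop) continuous_const)

lemma setLIntegral_areaMeasure {s : Set ℂ} (f : ℂ → ℝ≥0∞) :
    ∫⁻ z in s, f z ∂areaMeasure = ENNReal.ofReal Real.pi⁻¹ * ∫⁻ z in s, f z := by
  rw [areaMeasure, Measure.restrict_smul, lintegral_smul_measure]
  rfl

lemma areaMeasure_ball (w : ℂ) (r : ℝ) :
    areaMeasure (Metric.ball w r) = ENNReal.ofReal r ^ 2 := by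
  have hpi : (NNReal.pi : ℝ≥0∞) = ENNReal.ofReal Real.pi := (ENNReal.ofReal_coe_nnreal).symm
  have h : areaMeasure (Metric.ball w r) =
      ENNReal.ofReal Real.pi⁻¹ * volume (Metric.ball w r) := rfl
  rw [h, Complex.volume_ball, hpi, mul_comm, mul_assoc, ← ENNReal.ofReal_mul Real.pi_pos.le,
    mul_inv_cancel₀ Real.pi_pos.ne']
  simp

instance : SigmaFinite areaMeasure := by unfold areaMeasure; infer_instance

/-- Integrate the circle estimate in $\rho\in(r/2,r)$; the constant is the normalized area of the
annulus. The inner disc is omitted because a root factor may vanish there. -/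
lemma rpow_enorm_le_setLIntegral_annulus {g : ℂ → ℂ} (hg : Differentiable ℂ g) (w : ℂ) {r : ℝ}
    (hr : 0 < r) {p : ℝ} (hp : 1 ≤ p) :
    ENNReal.ofReal (3 / 4 * r ^ 2) * ‖g w‖ₑ ^ p ≤ ∫⁻ z in annulus w r, ‖g z‖ₑ ^ p ∂areaMeasure := by
  set F : ℂ → ℝ≥0∞ := (annulus w r).indicator fun z => ‖g z‖ₑ ^ p
  have hF : Measurable F := by
    refine Measurable.indicator ?_ (isOpen_annulus w r).measurableSet
    exact hg.continuous.measurable.enorm.pow_const p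
  rw [setLIntegral_areaMeasure, ← lintegral_indicator (isOpen_annulus w r).measurableSet]
  change _ ≤ _ * ∫⁻ z, F z
  rw [← lintegral_add_right_eq_self F w, ← Complex.lintegral_comp_polarCoord_symm]
  have hps : ∀ q : ℝ × ℝ, Complex.polarCoord.symm q + w = circleMap w q.1 q.2 := fun q => by
    rw [Complex.polarCoord_symm_apply, circleMap, Complex.exp_mul_I, add_comm]
    push_cast
    ring
  simp only [hps, polarCoord_target]
  rw [Measure.volume_eq_prod, ← Measure.prod_restrict, lintegral_prod]
  · have key : ENNReal.ofReal (3 / 8 * r ^ 2) * (ENNReal.ofReal (2 * Real.pi) * ‖g w‖ₑ ^ p) ≤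
        ∫⁻ ρ in Set.Ioi (0 : ℝ), ∫⁻ θ in Set.Ioo (-Real.pi) Real.pi,
          ENNReal.ofReal ρ • F (circleMap w ρ θ) := by
      have hρ : ∫⁻ ρ in Set.Ioo (r / 2) r, ENNReal.ofReal ρ = ENNReal.ofReal (3 / 8 * r ^ 2) := by
        rw [Measure.restrict_congr_set Ioo_ae_eq_Ioc, ← ofReal_integral_eq_lintegral_ofReal,
          ← intervalIntegral.integral_of_le (by linarith), integral_id]
        · congr 1; ring
        · exact (continuous_id.integrableOn_Icc).mono_set Set.Ioc_subset_Icc_self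
        · filter_upwards [ae_restrict_mem measurableSet_Ioc] with ρ hρ
          simp only [Pi.zero_apply]
          linarith [hρ.1]
      rw [← hρ, ← lintegral_mul_const _ (by fun_prop)]
      calc _ ≤ ∫⁻ ρ in Set.Ioo (r / 2) r, ∫⁻ θ in Set.Ioo (-Real.pi) Real.pi,
            ENNReal.ofReal ρ • F (circleMap w ρ θ) := by
            refine setLIntegral_mono' measurableSet_Ioo fun ρ hρ => ?_
            have hmem : ∀ θ, circleMap w ρ θ ∈ annulus w r := fun θ => by
              have hρ0 : 0 < ρ := by linarith [hρ.1]
              simp only [annulus, Set.mem_ofPred_eq, circleMap_sub_center, norm_circleMap_zero,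
                abs_of_pos hρ0]
              exact hρ
            have hFe : ∀ θ, F (circleMap w ρ θ) = ‖g (circleMap w ρ θ)‖ₑ ^ p := fun θ =>
              Set.indicator_of_mem (hmem θ) _
            simp only [hFe, smul_eq_mul]
            rw [lintegral_const_mul' _ _ ENNReal.ofReal_ne_top]
            gcongr
            exact rpow_enorm_le_lintegral_circle hg w ρ hp
        _ ≤ _ := lintegral_mono_set fun ρ hρ => by
            simp only [Set.mem_Ioi]; linarith [hρ.1]
    refine le_trans (le_of_eq ?_) (mul_le_mul_right key _)
    rw [← mul_assoc, ← mul_assoc, ← ENNReal.ofReal_mul (by positivity),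
      ← ENNReal.ofReal_mul (by positivity)]
    congr 2
    have := Real.pi_pos.ne'
    field_simp
    norm_num
  · refine Measurable.aemeasurable ?_
    have hc : Continuous fun q : ℝ × ℝ => circleMap w q.1 q.2 := by
      unfold circleMap
      fun_prop
    exact (ENNReal.measurable_ofReal.comp measurable_fst).smul (hF.comp hc.measurable)

/-! ### Second order approximation of the potential near the droplet -/

/-- Taylor's formula with $\varepsilon$ and $K$ uniform over a neighbourhood of the droplet, by
compactness of a closed thickening. -/
lemma IsC2Near.exists_affine_approx {Q : ℂ → EReal} {S : Set ℂ} (h : IsC2Near Q S)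
    (hS : IsCompact S) (hne : S.Nonempty) :
    ∃ ε K : ℝ, 0 < ε ∧ 0 ≤ K ∧ ∀ w, Metric.infDist w S < ε → (∀ z, ‖z - w‖ ≤ ε → Q z ≠ ⊤) ∧
      ∃ b : ℂ, ∀ z, ‖z - w‖ ≤ ε →
        |(Q z).toReal - ((Q w).toReal + (b * (z - w)).re)| ≤ K * ‖z - w‖ ^ 2 := by
  obtain ⟨U, hU, hSU, hfin, hC⟩ := h
  obtain ⟨δ, hδ, hδU⟩ := hS.exists_cthickening_subset_open hU hSU
  set f : ℂ → ℝ := fun z => (Q z).toReal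
  have hC1 : ContDiffOn ℝ 1 (fderiv ℝ f) U := hC.fderiv_of_isOpen hU (by norm_num)
  have hC2 : ContinuousOn (fderiv ℝ (fderiv ℝ f)) U :=
    (hC1.fderiv_of_isOpen (m := 0) hU (by norm_num)).continuousOn
  obtain ⟨K, hK⟩ := (hS.cthickening (r := δ)).exists_bound_of_continuousOn
    (f := fderiv ℝ (fderiv ℝ f)) (hC2.mono hδU)
  refine ⟨δ / 2, max K 0, by positivity, le_max_right _ _, fun w hw => ?_⟩
  have hball : ∀ z, ‖z - w‖ ≤ δ / 2 → z ∈ Metric.cthickening δ S := fun z hz => by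
    obtain ⟨s, hs, hws⟩ := (Metric.infDist_lt_iff hne).1 hw
    refine Metric.mem_cthickening_of_dist_le z s δ S hs ?_
    have := dist_triangle z w s
    rw [dist_eq_norm z w] at this
    linarith
  have hballU : ∀ z, ‖z - w‖ ≤ δ / 2 → z ∈ U := fun z hz => hδU (hball z hz)
  refine ⟨fun z hz => hfin z (hballU z hz), ?_⟩
  set φ := fderiv ℝ f w
  -- This $b$ satisfies $\operatorname{Re}(bu)=\varphi(u)$, so the affine part is the real part of a
  -- holomorphic function.
  refine ⟨⟨φ 1, -φ Complex.I⟩, fun z hz => ?_⟩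
  have hφ : ∀ u : ℂ, ((⟨φ 1, -φ Complex.I⟩ : ℂ) * u).re = φ u := fun u => by
    have : u = u.re • (1 : ℂ) + u.im • Complex.I := by
      simp [Complex.re_add_im]
    conv_rhs => rw [this, map_add, map_smul, map_smul]
    simp only [Complex.mul_re, smul_eq_mul]
    ring
  rw [hφ, ← sub_sub]
  set ρ := ‖z - w‖
  have hdiff : ∀ x ∈ U, DifferentiableAt ℝ f x := fun x hx =>
    (hC.contDiffAt (hU.mem_nhds hx)).differentiableAt (by norm_num)
  have hdiff' : ∀ x ∈ U, DifferentiableAt ℝ (fderiv ℝ f) x := fun x hx =>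
    (hC1.contDiffAt (hU.mem_nhds hx)).differentiableAt (by norm_num)
  have hmem : ∀ x ∈ Metric.closedBall w ρ, ‖x - w‖ ≤ δ / 2 := fun x hx => by
    rw [Metric.mem_closedBall, dist_eq_norm] at hx
    exact hx.trans hz
  have hw0 : w ∈ Metric.closedBall w ρ := Metric.mem_closedBall_self (norm_nonneg _)
  have hz0 : z ∈ Metric.closedBall w ρ := by
    rw [Metric.mem_closedBall, dist_eq_norm]
  have hLip : ∀ x ∈ Metric.closedBall w ρ, ‖fderiv ℝ f x - φ‖ ≤ max K 0 * ρ := fun x hx => by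
    refine ((convex_closedBall w ρ).norm_image_sub_le_of_norm_fderiv_le (C := max K 0)
      (fun y hy => hdiff' y (hballU y (hmem y hy)))
      (fun y hy => (hK y (hball y (hmem y hy))).trans (le_max_left _ _)) hw0 hx).trans ?_
    rw [Metric.mem_closedBall, dist_eq_norm] at hx
    gcongr
  have := (convex_closedBall w ρ).norm_image_sub_le_of_norm_fderiv_le' (C := max K 0 * ρ)
    (φ := φ) (fun y hy => hdiff y (hballU y (hmem y hy))) hLip hw0 hz0
  rw [Real.norm_eq_abs] at this
  refine this.trans (le_of_eq ?_)
  ring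

/-! ### Weighted polynomials -/

/-- The weighted density `|u|^p e^{-κ Q}`. -/
def wt (Q : ℂ → EReal) (κ p : ℝ) (u : ℂ → ℂ) (z : ℂ) : ℝ≥0∞ :=
  ‖u z‖ₑ ^ p * EReal.exp (-((κ : EReal) * Q z))

lemma wt_coe {Q : ℂ → EReal} {κ p : ℝ} {u : ℂ → ℂ} {z : ℂ} (hp : 0 ≤ p) {x : ℝ} (hx : Q z = x) :
    wt Q κ p u z = ENNReal.ofReal (‖u z‖ ^ p * Real.exp (-(κ * x))) := by
  rw [wt, hx, ← EReal.coe_mul, ← EReal.coe_neg, EReal.exp_coe,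
    ENNReal.ofReal_mul (by positivity), ← ENNReal.ofReal_rpow_of_nonneg (norm_nonneg _) hp,
    ofReal_norm]

lemma measurable_wt {Q : ℂ → EReal} (hQ : Measurable Q) (κ p : ℝ) {u : ℂ → ℂ} (hu : Measurable u) :
    Measurable (wt Q κ p u) :=
  (hu.enorm.pow_const p).mul (hQ.const_mul (κ : EReal)).neg.ereal_exp

/-- Sub-mean value property of weighted holomorphic functions in the region where the potential is
approximately harmonic. -/
lemma wt_le_setLIntegral_annulus {Q : ℂ → EReal} (hbot : ∀ z, Q z ≠ ⊥) {w b : ℂ} {ε K r κ p E : ℝ}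
    (hfin : ∀ z, ‖z - w‖ ≤ ε → Q z ≠ ⊤)
    (hb : ∀ z, ‖z - w‖ ≤ ε →
      |(Q z).toReal - ((Q w).toReal + (b * (z - w)).re)| ≤ K * ‖z - w‖ ^ 2)
    (hK : 0 ≤ K) (hr : 0 < r) (hrε : r ≤ ε) (hκ : 0 ≤ κ) (hp : 1 ≤ p) (hE : κ * (K * r ^ 2) ≤ E)
    {u : ℂ → ℂ} (hu : Differentiable ℂ u) :
    ENNReal.ofReal (3 / 4 * r ^ 2) * wt Q κ p u w ≤
      ENNReal.ofReal (Real.exp E) * ∫⁻ z in annulus w r, wt Q κ p u z ∂areaMeasure := by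
  have hp0 : 0 < p := by linarith
  set L : ℂ → ℂ := fun z => ((Q w).toReal : ℂ) + b * (z - w)
  -- Then $|g|^p=|u|^pe^{-\kappa\operatorname{Re}L}$, which equals the weighted density at $w$ and
  -- exceeds it elsewhere in the disc by at most $e^E$.
  set g : ℂ → ℂ := fun z => u z * Complex.exp (-((κ / p : ℝ) : ℂ) * L z)
  have hg : Differentiable ℂ g := by
    have : Differentiable ℂ L := by fun_prop
    fun_prop
  have hQe : ∀ z, ‖z - w‖ ≤ ε → Q z = ((Q z).toReal : EReal) := fun z hz =>
    (EReal.coe_toReal (hfin z hz) (hbot z)).symm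
  have hgn : ∀ z, ‖g z‖ₑ ^ p = ENNReal.ofReal (‖u z‖ ^ p * Real.exp (-(κ * (L z).re))) := fun z => by
    rw [← ofReal_norm, ENNReal.ofReal_rpow_of_nonneg (norm_nonneg _) hp0.le]
    congr 1
    simp only [g]
    rw [norm_mul, Complex.norm_exp, Real.mul_rpow (norm_nonneg _) (Real.exp_pos _).le,
      ← Real.exp_mul]
    congr 2
    rw [← Complex.ofReal_neg, Complex.re_ofReal_mul]
    field_simp
  have hw : wt Q κ p u w = ‖g w‖ₑ ^ p := by
    rw [hgn, wt_coe hp0.le (hQe w (by simp; linarith))]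
    simp [L]
  rw [hw]
  refine (rpow_enorm_le_setLIntegral_annulus hg w hr hp).trans ?_
  rw [← lintegral_const_mul' _ _ ENNReal.ofReal_ne_top]
  refine setLIntegral_mono' (isOpen_annulus w r).measurableSet fun z hz => ?_
  have hzr : ‖z - w‖ ≤ r := hz.2.le
  have hzε : ‖z - w‖ ≤ ε := hzr.trans hrε
  rw [hgn, wt_coe hp0.le (hQe z hzε), ← ENNReal.ofReal_mul (Real.exp_pos _).le]
  refine ENNReal.ofReal_le_ofReal ?_
  have h1 := (abs_le.1 (hb z hzε)).2
  have hLre : (L z).re = (Q w).toReal + (b * (z - w)).re := by simp [L]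
  rw [← hLre] at h1
  have h2 : K * ‖z - w‖ ^ 2 ≤ K * r ^ 2 := by gcongr
  have h3 : κ * ((Q z).toReal - (L z).re) ≤ E :=
    (mul_le_mul_of_nonneg_left (h1.trans h2) hκ).trans hE
  calc ‖u z‖ ^ p * Real.exp (-(κ * (L z).re))
      ≤ ‖u z‖ ^ p * (Real.exp E * Real.exp (-(κ * (Q z).toReal))) := by
        rw [← Real.exp_add]
        gcongr
        linarith
    _ = _ := by ring

/-- The monic polynomial with zeros `a k`, `k ∈ s`. -/
def rootPoly {ι : Type*} (s : Finset ι) (a : ι → ℂ) (z : ℂ) : ℂ := ∏ k ∈ s, (z - a k)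

lemma differentiable_rootPoly {ι : Type*} (s : Finset ι) (a : ι → ℂ) :
    Differentiable ℂ (rootPoly s a) := by
  unfold rootPoly
  fun_prop

lemma rootPoly_eq_mul_erase {ι : Type*} [DecidableEq ι] {s : Finset ι} (a : ι → ℂ) {k : ι}
    (hk : k ∈ s) (z : ℂ) : rootPoly s a z = (z - a k) * rootPoly (s.erase k) a z :=
  (Finset.mul_prod_erase s (fun k => z - a k) hk).symm

lemma exists_rootPoly_ne_zero {ι : Type*} (s : Finset ι) (a : ι → ℂ) :
    ∃ z, rootPoly s a z ≠ 0 := by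
  obtain ⟨z, hz⟩ := Infinite.exists_notMem_finset (s.image a)
  refine ⟨z, Finset.prod_ne_zero_iff.2 fun k hk => sub_ne_zero.2 ?_⟩
  rintro rfl
  exact hz (Finset.mem_image_of_mem a hk)

/-- The weighted polynomial `|q| e^{-n V / 2}`. -/
def wpoly {ι : Type*} (V : ℂ → ℝ) (n : ℕ) (s : Finset ι) (a : ι → ℂ) (z : ℂ) : ℝ :=
  ‖rootPoly s a z‖ * Real.exp (-(n * V z / 2))

/-! ### Weighted polynomials and the maximum principle. -/

section MaxPrinciple

variable {ι : Type*} {Q : ℂ → EReal} {S : Set ℂ} {V : ℂ → ℝ} {n : ℕ}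

lemma wpoly_nonneg (V : ℂ → ℝ) (n : ℕ) (s : Finset ι) (a : ι → ℂ) (z : ℂ) :
    0 ≤ wpoly V n s a z := by
  unfold wpoly
  positivity

lemma upperSemicontinuous_wpoly (hV : LowerSemicontinuous V) (n : ℕ) (s : Finset ι) (a : ι → ℂ) :
    UpperSemicontinuous (wpoly V n s a) := by
  intro z y hy
  set v := Real.exp (-(n * V z / 2))
  have h1 : Continuous fun η : ℝ => (‖rootPoly s a z‖ + η) * Real.exp (-(n * (V z - η) / 2)) := by
    fun_prop
  have h2 : ∀ᶠ η in 𝓝 (0 : ℝ),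
      (‖rootPoly s a z‖ + η) * Real.exp (-(n * (V z - η) / 2)) < y := by
    refine h1.continuousAt.eventually (gt_mem_nhds ?_)
    simpa [wpoly] using hy
  obtain ⟨η, hη1, hη2⟩ := ((h2.filter_mono nhdsWithin_le_nhds).and
    (self_mem_nhdsWithin (a := (0 : ℝ)) (s := Set.Ioi 0))).exists
  have hη0 : 0 < η := hη2
  have hq : ∀ᶠ w in 𝓝 z, ‖rootPoly s a w‖ < ‖rootPoly s a z‖ + η :=
    (differentiable_rootPoly s a).continuous.norm.continuousAt.eventually
      (gt_mem_nhds (by linarith))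
  filter_upwards [hq, hV z (V z - η) (by linarith)] with w hw1 hw2
  refine lt_of_le_of_lt ?_ hη1
  unfold wpoly
  gcongr

/-- Degree $n-1$ loses to $e^{-nV/2}=O(|z|^{-n})$; the one missing degree yields decay. -/
lemma tendsto_wpoly_cobounded (hV : IsEffectivePotential Q S V) {s : Finset ι}
    (hs : s.card + 1 = n) (a : ι → ℂ) :
    Tendsto (wpoly V n s a) (Bornology.cobounded ℂ) (𝓝 0) := by
  obtain ⟨A, c, hA⟩ := hV.growth
  obtain ⟨M, hM⟩ : ∃ M : ℝ, ∀ k ∈ s, ‖a k‖ ≤ M := by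
    obtain ⟨M, hM⟩ := (s.finite_toSet.image fun k => ‖a k‖).bddAbove
    exact ⟨M, fun k hk => hM ⟨k, hk, rfl⟩⟩
  set C := 2 ^ s.card * (2 ^ n * Real.exp (-(n * c / 2)))
  have hlim : Tendsto (fun z : ℂ => C * ‖z‖⁻¹) (Bornology.cobounded ℂ) (𝓝 0) := by
    have := (tendsto_inv_atTop_zero.comp (tendsto_norm_cobounded_atTop (E := ℂ))).const_mul C
    simpa using this
  refine squeeze_zero' (Eventually.of_forall fun z => wpoly_nonneg V n s a z) ?_ hlim
  filter_upwards [(tendsto_norm_cobounded_atTop (E := ℂ)).eventually_gt_atTop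
    (max (max M (2 * |A|)) 1)] with z hz
  have hz1 : 1 < ‖z‖ := lt_of_le_of_lt (le_max_right _ _) hz
  have hzM : M < ‖z‖ := lt_of_le_of_lt ((le_max_left _ _).trans (le_max_left _ _)) hz
  have hzA : 2 * |A| < ‖z‖ := lt_of_le_of_lt ((le_max_right _ _).trans (le_max_left _ _)) hz
  have hAle := le_abs_self A
  have hAz : A < ‖z‖ := by linarith [abs_nonneg A]
  have hq : ‖rootPoly s a z‖ ≤ (2 * ‖z‖) ^ s.card := by
    rw [rootPoly, norm_prod, ← Finset.prod_const]
    refine Finset.prod_le_prod (fun _ _ => norm_nonneg _) fun k hk => ?_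
    exact (norm_sub_le _ _).trans (by linarith [hM k hk])
  have hexp : Real.exp (-(n * V z / 2)) ≤ 2 ^ n * Real.exp (-(n * c / 2)) * (‖z‖⁻¹) ^ n := by
    have h1 := hA z hAz
    have hlog : Real.log (‖z‖ / 2) ≤ Real.log (‖z‖ - A) :=
      Real.log_le_log (by linarith) (by linarith)
    calc Real.exp (-(n * V z / 2)) ≤ Real.exp (-(n * c / 2) + n * -Real.log (‖z‖ / 2)) := by
          refine Real.exp_le_exp.2 ?_
          have : (n : ℝ) * (2 * Real.log (‖z‖ / 2) + c) ≤ n * V z := by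
            gcongr
            linarith
          linarith
      _ = _ := by
        rw [Real.exp_add, Real.exp_nat_mul, ← Real.log_inv, Real.exp_log (by positivity), inv_div,
          div_pow, inv_pow]
        ring
  calc wpoly V n s a z ≤ (2 * ‖z‖) ^ s.card * (2 ^ n * Real.exp (-(n * c / 2)) * (‖z‖⁻¹) ^ n) := by
        unfold wpoly
        gcongr
    _ = C * ‖z‖⁻¹ := by
      have : ‖z‖ ≠ 0 := by linarith
      have hC : C = 2 ^ s.card * (2 ^ n * Real.exp (-(n * c / 2))) := rfl
      rw [hC, mul_pow]
      nth_rewrite 3 [← hs]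
      rw [pow_succ ‖z‖⁻¹, inv_pow]
      field_simp

/-- The maximum principle: a weighted polynomial of degree less than `n` attains its maximum on the
droplet. -/
lemma exists_wpoly_le (hV : IsEffectivePotential Q S V) (hS : IsClosed S) (hSne : S.Nonempty)
    {s : Finset ι} (hs : s.card + 1 = n) (a : ι → ℂ) :
    ∃ z₀ ∈ S, ∀ z, wpoly V n s a z ≤ wpoly V n s a z₀ := by
  set f := wpoly V n s a
  have husc : UpperSemicontinuous f := upperSemicontinuous_wpoly hV.lsc n s a
  obtain ⟨z₁, hz₁⟩ := exists_rootPoly_ne_zero s a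
  have hpos : 0 < f z₁ := mul_pos (norm_pos_iff.2 hz₁) (Real.exp_pos _)
  obtain ⟨R, -, hR⟩ := (Filter.hasBasis_cobounded_norm (E := ℂ)).eventually_iff.1
    ((tendsto_wpoly_cobounded hV hs a).eventually (gt_mem_nhds hpos))
  have hz₁R : ‖z₁‖ < R := by
    by_contra h
    exact lt_irrefl _ (hR (not_lt.1 h))
  obtain ⟨p, -, hp⟩ := (husc.upperSemicontinuousOn (Metric.closedBall 0 R)).exists_isMaxOn
    ⟨z₁, by simpa using hz₁R.le⟩ (isCompact_closedBall _ _)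
  have hmax : ∀ z, f z ≤ f p := fun z => by
    have hz₁p : f z₁ ≤ f p := hp (by simpa using hz₁R.le)
    by_cases hz : ‖z‖ ≤ R
    · exact hp (by simpa using hz)
    · exact (hR (not_le.1 hz).le).le.trans hz₁p
  -- The set of maximum points is closed. If it missed $S$ it would also be open, since off $S$ the
  -- function is locally the modulus of a holomorphic one; being nonempty it would be the whole
  -- plane.
  set A := {z | f p ≤ f z}
  have hAc : IsClosed A := husc.isClosed_preimage (f p)
  by_contra hcon
  push Not at hcon
  have hAS : ∀ z ∈ A, z ∉ S := fun z hz hzS => by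
    obtain ⟨w, hw⟩ := hcon z hzS
    exact absurd ((hmax w).trans hz) (not_le.2 hw)
  have hAo : IsOpen A := by
    refine isOpen_iff_mem_nhds.2 fun z hz => ?_
    obtain ⟨r, hr, hsub⟩ := Metric.isOpen_iff.1 hS.isOpen_compl z (hAS z hz)
    obtain ⟨H, hH1, hH2⟩ := hV.harmonic z r hr (Set.disjoint_left.2 fun v hv => hsub hv)
    set g : ℂ → ℂ := fun v => rootPoly s a v * Complex.exp (-((n / 2 : ℝ) : ℂ) * H v)
    have hgn : ∀ v ∈ Metric.ball z r, ‖g v‖ = f v := fun v hv => by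
      simp only [g, f, wpoly]
      rw [norm_mul, Complex.norm_exp, ← Complex.ofReal_neg, Complex.re_ofReal_mul, hH2 v hv]
      congr 2
      ring
    have hz0 : z ∈ Metric.ball z r := Metric.mem_ball_self hr
    have hgd : ∀ᶠ v in 𝓝 z, DifferentiableAt ℂ g v := by
      filter_upwards [Metric.ball_mem_nhds z hr] with v hv
      have h1 : DifferentiableAt ℂ H v := hH1.differentiableAt (Metric.isOpen_ball.mem_nhds hv)
      exact (differentiable_rootPoly s a v).mul (h1.const_mul _).cexp
    have hloc : IsLocalMax (norm ∘ g) z := by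
      filter_upwards [Metric.ball_mem_nhds z hr] with v hv
      simp only [Function.comp_apply]
      rw [hgn v hv, hgn z hz0]
      exact (hmax v).trans hz
    filter_upwards [Complex.norm_eventually_eq_of_isLocalMax hgd hloc,
      Metric.ball_mem_nhds z hr] with v hv hvr
    rw [hgn v hvr, hgn z hz0] at hv
    exact hz.trans hv.ge
  rcases isClopen_iff.1 ⟨hAc, hAo⟩ with h | h
  · exact (h ▸ (show p ∈ A from le_refl (f p)) : p ∈ (∅ : Set ℂ))
  · obtain ⟨z, hz⟩ := hSne
    exact hAS z (h ▸ Set.mem_univ z) hz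

end MaxPrinciple

/-! ### Small mass near the zeros of a weighted polynomial. -/

section Separation

lemma wpoly_rpow {ι : Type*} (V : ℂ → ℝ) (n : ℕ) (β : ℝ) (s : Finset ι) (a : ι → ℂ) (z : ℂ) :
    wpoly V n s a z ^ (2 * β) = ‖rootPoly s a z‖ ^ (2 * β) * Real.exp (-(n * β * V z)) := by
  rw [wpoly, Real.mul_rpow (norm_nonneg _) (Real.exp_pos _).le, ← Real.exp_mul]
  congr 2
  ring

variable {ι : Type*} [DecidableEq ι] {Q : ℂ → EReal} {S : Set ℂ} {V : ℂ → ℝ} {ε K r κ p E : ℝ}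
  {s : Finset ι} {a : ι → ℂ} {k : ι} {w : ℂ} {d : ℝ}

lemma annulus_subset_ball (w : ℂ) (r : ℝ) : annulus w r ⊆ Metric.ball w r := fun z hz => by
  simpa [dist_eq_norm] using hz.2

/-- If a weighted polynomial has a zero at distance at most `d` from a point `w` near the droplet,
then its value at `w` is controlled by a local average. -/
lemma wt_le_of_near_root (hbot : ∀ z, Q z ≠ ⊥) {b : ℂ} (hfin : ∀ z, ‖z - w‖ ≤ ε → Q z ≠ ⊤)
    (hb : ∀ z, ‖z - w‖ ≤ ε →
      |(Q z).toReal - ((Q w).toReal + (b * (z - w)).re)| ≤ K * ‖z - w‖ ^ 2)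
    (hK : 0 ≤ K) (hr : 0 < r) (hrε : r ≤ ε) (hκ : 0 ≤ κ) (hp : 1 ≤ p) (hE : κ * (K * r ^ 2) ≤ E)
    (hk : k ∈ s) (hd : ‖w - a k‖ ≤ d) (hdr : d ≤ r / 4) :
    ENNReal.ofReal (3 / 4 * r ^ 2) * wt Q κ p (rootPoly s a) w ≤
      ENNReal.ofReal ((4 * d / r) ^ p * Real.exp E) *
        ∫⁻ z in Metric.ball w r, wt Q κ p (rootPoly s a) z ∂areaMeasure := by
  have hp0 : 0 ≤ p := by linarith
  have hd0 : 0 ≤ d := (norm_nonneg _).trans hd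
  set q₁ := rootPoly (s.erase k) a
  have hfac : ∀ z, wt Q κ p (rootPoly s a) z = ‖z - a k‖ₑ ^ p * wt Q κ p q₁ z := fun z => by
    rw [wt, wt, rootPoly_eq_mul_erase a hk, enorm_mul, ENNReal.mul_rpow_of_nonneg _ _ hp0, mul_assoc]
  have h1 := wt_le_setLIntegral_annulus hbot hfin hb hK hr hrε hκ hp hE
    (differentiable_rootPoly (s.erase k) a)
  -- On the annulus $|z-a_k|\ge r/2-d\ge r/4$, so restoring the removed root costs at most
  -- $(4/r)^p$.
  have h2 : ∫⁻ z in annulus w r, wt Q κ p q₁ z ∂areaMeasure ≤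
      ENNReal.ofReal (4 / r) ^ p *
        ∫⁻ z in Metric.ball w r, wt Q κ p (rootPoly s a) z ∂areaMeasure := by
    calc _ ≤ ∫⁻ z in annulus w r, ENNReal.ofReal (4 / r) ^ p * wt Q κ p (rootPoly s a) z
          ∂areaMeasure := by
          refine setLIntegral_mono' (isOpen_annulus w r).measurableSet fun z hz => ?_
          rw [hfac, ← mul_assoc, ← ENNReal.mul_rpow_of_nonneg _ _ hp0]
          refine le_mul_of_one_le_left zero_le (ENNReal.one_le_rpow ?_ (by linarith))
          rw [← ofReal_norm, ← ENNReal.ofReal_mul (by positivity), ENNReal.one_le_ofReal]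
          have h3 := norm_sub_le_norm_sub_add_norm_sub z (a k) w
          rw [norm_sub_rev (a k) w] at h3
          have h4 : r / 4 ≤ ‖z - a k‖ := by linarith [hz.1]
          calc 1 = 4 / r * (r / 4) := by field_simp
            _ ≤ _ := by gcongr
      _ ≤ _ := by
        rw [lintegral_const_mul' _ _ (by simp [hp0])]
        gcongr
        exact annulus_subset_ball w r
  calc _ = ‖w - a k‖ₑ ^ p * (ENNReal.ofReal (3 / 4 * r ^ 2) * wt Q κ p q₁ w) := by rw [hfac]; ring
    _ ≤ ENNReal.ofReal d ^ p * (ENNReal.ofReal (Real.exp E) * (ENNReal.ofReal (4 / r) ^ p *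
        ∫⁻ z in Metric.ball w r, wt Q κ p (rootPoly s a) z ∂areaMeasure)) := by
        refine mul_le_mul' (ENNReal.rpow_le_rpow ?_ hp0) (h1.trans (mul_le_mul_right h2 _))
        rw [← ofReal_norm]
        exact ENNReal.ofReal_le_ofReal hd
    _ = _ := by
        rw [show 4 * d / r = d * (4 / r) by ring, ENNReal.ofReal_mul (by positivity),
          ← ENNReal.ofReal_rpow_of_nonneg (by positivity) hp0, ENNReal.ofReal_mul hd0,
          ENNReal.mul_rpow_of_nonneg _ _ hp0]
        ring

/-- Away from the droplet, a weighted polynomial with a zero close to `w` is small at `w` compared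
to its maximum. -/
lemma wpoly_le_of_near_root (hV : IsEffectivePotential Q S V) {n : ℕ} (hr : 0 < r)
    (hdisj : Disjoint (Metric.ball w r) S) (hk : k ∈ s) (hd : ‖w - a k‖ ≤ d) (hdr : d ≤ r / 4)
    {M : ℝ} (hM : ∀ z, wpoly V n s a z ≤ M) : wpoly V n s a w ≤ 4 * d / r * M := by
  have hd0 : 0 ≤ d := (norm_nonneg _).trans hd
  obtain ⟨H, hH1, hH2⟩ := hV.harmonic w r hr hdisj
  set g : ℂ → ℂ := fun v => rootPoly (s.erase k) a v * Complex.exp (-((n / 2 : ℝ) : ℂ) * H v)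
  have hgn : ∀ v ∈ Metric.ball w r, ‖v - a k‖ * ‖g v‖ = wpoly V n s a v := fun v hv => by
    simp only [g, wpoly]
    rw [norm_mul, Complex.norm_exp, ← Complex.ofReal_neg, Complex.re_ofReal_mul, hH2 v hv,
      rootPoly_eq_mul_erase a hk, norm_mul, ← mul_assoc]
    congr 2
    ring
  have hgd : DifferentiableOn ℂ g (Metric.ball w r) :=
    (differentiable_rootPoly _ a).differentiableOn.mul (hH1.const_mul _).cexp
  have hsub : Metric.closedBall w (r / 2) ⊆ Metric.ball w r :=
    Metric.closedBall_subset_ball (by linarith)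
  have hr2 : r / 2 ≠ 0 := by positivity
  have hdc : DiffContOnCl ℂ g (Metric.ball w (r / 2)) := by
    refine DifferentiableOn.diffContOnCl ?_
    rw [closure_ball w hr2]
    exact hgd.mono hsub
  -- Schwarz-type argument: divide out the root and apply the maximum modulus principle on the
  -- circle of radius $r/2$, where the divided factor is at least $r/4$.
  have hgw : ‖g w‖ ≤ 4 / r * M := by
    refine Complex.norm_le_of_forall_mem_frontier_norm_le Metric.isBounded_ball hdc
      (fun z hz => ?_) (subset_closure (Metric.mem_ball_self (by positivity)))
    rw [frontier_ball w hr2, Metric.mem_sphere, dist_eq_norm] at hz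
    have hzb : z ∈ Metric.ball w r := by
      rw [Metric.mem_ball, dist_eq_norm, hz]; linarith
    have h3 := norm_sub_le_norm_sub_add_norm_sub z (a k) w
    rw [norm_sub_rev (a k) w] at h3
    have h4 : r / 4 ≤ ‖z - a k‖ := by linarith
    have h5 : r / 4 * ‖g z‖ ≤ M := by
      refine le_trans ?_ ((hgn z hzb).le.trans (hM z))
      gcongr
    calc ‖g z‖ = 4 / r * (r / 4 * ‖g z‖) := by field_simp
      _ ≤ _ := by gcongr
  rw [← hgn w (Metric.mem_ball_self hr)]
  calc ‖w - a k‖ * ‖g w‖ ≤ d * (4 / r * M) := by gcongr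
    _ = _ := by ring

/-- Three factors combine: $e^{-n\beta\delta}$ from replacing $Q$ by $V$, $(4d/r)^{2\beta}$ from the
nearby root, and $e^E$ from the local mean value estimate at the maximum point, which lies on $S$
where $V=Q$. -/
lemma wt_le_of_far_root (hbot : ∀ z, Q z ≠ ⊥) (hV : IsEffectivePotential Q S V) (hS : IsClosed S)
    (hSne : S.Nonempty) (hε : 0 < ε)
    (happ : ∀ w, Metric.infDist w S < ε → (∀ z, ‖z - w‖ ≤ ε → Q z ≠ ⊤) ∧
      ∃ b : ℂ, ∀ z, ‖z - w‖ ≤ ε →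
        |(Q z).toReal - ((Q w).toReal + (b * (z - w)).re)| ≤ K * ‖z - w‖ ^ 2)
    (hK : 0 ≤ K) {δ : ℝ} (hδ : ∀ z, ε ≤ Metric.infDist z S → ((V z + δ : ℝ) : EReal) ≤ Q z)
    {n : ℕ} {β : ℝ} (hβ : 1 / 2 ≤ β) (hs : s.card + 1 = n) (hr : 0 < r) (hrε : r ≤ ε)
    (hE : n * β * (K * r ^ 2) ≤ E) (hw : ε ≤ Metric.infDist w S)
    (hk : k ∈ s) (hd : ‖w - a k‖ ≤ d) (hdr : d ≤ r / 4) :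
    ENNReal.ofReal (3 / 4 * r ^ 2) * wt Q (n * β) (2 * β) (rootPoly s a) w ≤
      ENNReal.ofReal ((4 * d / r) ^ (2 * β) * Real.exp E * Real.exp (-(n * β * δ))) *
        ∫⁻ z, wt Q (n * β) (2 * β) (rootPoly s a) z ∂areaMeasure := by
  have hd0 : 0 ≤ d := (norm_nonneg _).trans hd
  have hβ0 : 0 ≤ 2 * β := by linarith
  have hβ0' : 0 ≤ β := by linarith
  rcases eq_or_ne (Q w) ⊤ with hQw | hQw
  · have hn : (0 : ℝ) < n * β := by
      have : (0 : ℝ) < n := by rw [← hs]; positivity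
      have : 0 < β := by linarith
      positivity
    have : wt Q (n * β) (2 * β) (rootPoly s a) w = 0 := by
      rw [wt, hQw, EReal.coe_mul_top_of_pos hn]
      simp
    rw [this, mul_zero]
    exact zero_le
  have hdisj : Disjoint (Metric.ball w r) S := by
    refine Set.disjoint_left.2 fun z hz hzS => ?_
    have := Metric.infDist_le_dist_of_mem (x := w) hzS
    rw [Metric.mem_ball, dist_comm] at hz
    linarith
  obtain ⟨z₀, hz₀, hmax⟩ := exists_wpoly_le hV hS hSne hs a
  have h1 := wpoly_le_of_near_root hV hr hdisj hk hd hdr hmax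
  have hz₀S : Metric.infDist z₀ S < ε := by rwa [Metric.infDist_zero_of_mem hz₀]
  obtain ⟨hfin, b, hb⟩ := happ z₀ hz₀S
  have h2 := wt_le_setLIntegral_annulus (p := 2 * β) (κ := n * β) hbot hfin hb hK hr hrε
    (by positivity) (by linarith) hE (differentiable_rootPoly s a)
  set q := rootPoly s a
  have h3 : wt Q (n * β) (2 * β) q z₀ = ENNReal.ofReal (wpoly V n s a z₀ ^ (2 * β)) := by
    rw [wt_coe hβ0 (hV.eq_on z₀ hz₀), wpoly_rpow]
  have hQw' : Q w = ((Q w).toReal : EReal) := (EReal.coe_toReal hQw (hbot w)).symm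
  have hgap : V w + δ ≤ (Q w).toReal := by
    have := hδ w hw
    rw [hQw'] at this
    exact EReal.coe_le_coe_iff.1 this
  have h4 : wt Q (n * β) (2 * β) q w ≤ ENNReal.ofReal
      ((4 * d / r) ^ (2 * β) * Real.exp (-(n * β * δ)) * wpoly V n s a z₀ ^ (2 * β)) := by
    rw [wt_coe hβ0 hQw']
    refine ENNReal.ofReal_le_ofReal ?_
    calc ‖q w‖ ^ (2 * β) * Real.exp (-(n * β * (Q w).toReal))
        ≤ ‖q w‖ ^ (2 * β) * Real.exp (-(n * β * V w) + -(n * β * δ)) := by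
          gcongr
          have : (n : ℝ) * β * (V w + δ) ≤ n * β * (Q w).toReal := by gcongr
          linarith
      _ = wpoly V n s a w ^ (2 * β) * Real.exp (-(n * β * δ)) := by
          rw [wpoly_rpow, Real.exp_add]
          ring
      _ ≤ (4 * d / r * wpoly V n s a z₀) ^ (2 * β) * Real.exp (-(n * β * δ)) := by
          gcongr
          exact wpoly_nonneg V n s a w
      _ = _ := by
          rw [Real.mul_rpow (by positivity) (wpoly_nonneg V n s a z₀)]
          ring
  calc _ ≤ ENNReal.ofReal (3 / 4 * r ^ 2) * ENNReal.ofReal ((4 * d / r) ^ (2 * β) *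
          Real.exp (-(n * β * δ)) * wpoly V n s a z₀ ^ (2 * β)) := by gcongr
    _ = ENNReal.ofReal ((4 * d / r) ^ (2 * β) * Real.exp (-(n * β * δ))) *
        (ENNReal.ofReal (3 / 4 * r ^ 2) * wt Q (n * β) (2 * β) q z₀) := by
        rw [h3, ENNReal.ofReal_mul (p := (4 * d / r) ^ (2 * β) * Real.exp (-(n * β * δ)))
          (by positivity)]
        ring
    _ ≤ ENNReal.ofReal ((4 * d / r) ^ (2 * β) * Real.exp (-(n * β * δ))) *
        (ENNReal.ofReal (Real.exp E) * ∫⁻ z, wt Q (n * β) (2 * β) q z ∂areaMeasure) := by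
        exact mul_le_mul_right (h2.trans (mul_le_mul_right (setLIntegral_le_lintegral _ _) _)) _
    _ = _ := by
        rw [← mul_assoc, ← ENNReal.ofReal_mul (by positivity)]
        congr 2
        ring

lemma lintegral_setLIntegral_ball {f : ℂ → ℝ≥0∞} (hf : Measurable f) (r : ℝ) :
    ∫⁻ w, ∫⁻ z in Metric.ball w r, f z ∂areaMeasure ∂areaMeasure =
      ENNReal.ofReal r ^ 2 * ∫⁻ z, f z ∂areaMeasure := by
  have h1 : ∀ w, ∫⁻ z in Metric.ball w r, f z ∂areaMeasure =
      ∫⁻ z, {q : ℂ × ℂ | dist q.1 q.2 < r}.indicator (fun q => f q.2) (w, z) ∂areaMeasure := by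
    intro w
    rw [← lintegral_indicator Metric.isOpen_ball.measurableSet]
    refine lintegral_congr fun z => ?_
    simp only [Set.indicator, Metric.mem_ball, dist_comm z w]
    rfl
  have hm : MeasurableSet {q : ℂ × ℂ | dist q.1 q.2 < r} :=
    (isOpen_lt continuous_dist continuous_const).measurableSet
  have hF : Measurable ({q : ℂ × ℂ | dist q.1 q.2 < r}.indicator fun q => f q.2) :=
    (hf.comp measurable_snd).indicator hm
  simp only [h1]
  rw [lintegral_lintegral_swap (f := fun w z =>
    {q : ℂ × ℂ | dist q.1 q.2 < r}.indicator (fun q => f q.2) (w, z)) hF.aemeasurable, ← lintegral_const_mul _ hf]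
  refine lintegral_congr fun z => ?_
  have h2 : ∀ w, {q : ℂ × ℂ | dist q.1 q.2 < r}.indicator (fun q => f q.2) (w, z) =
      (Metric.ball z r).indicator (fun _ => f z) w := fun w => by
    simp only [Set.indicator, Metric.mem_ball]
    rfl
  simp only [h2]
  rw [lintegral_indicator Metric.isOpen_ball.measurableSet, setLIntegral_const, areaMeasure_ball,
    mul_comm]

lemma le_of_ofReal_mul_le {c c' : ℝ} (hc : 0 < c) {x y : ℝ≥0∞}
    (h : ENNReal.ofReal c * x ≤ ENNReal.ofReal (c * c') * y) : x ≤ ENNReal.ofReal c' * y := by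
  rw [ENNReal.ofReal_mul hc.le, mul_assoc] at h
  exact (ENNReal.mul_le_mul_iff_right (by simpa using hc) ENNReal.ofReal_ne_top).1 h

lemma natCast_mul_exp_le {n : ℕ} {β δ : ℝ} (hβ : 1 / 2 ≤ β) (hδ : 0 < δ) :
    (n : ℝ) * Real.exp (-(n * β * δ)) ≤ 2 / δ := by
  have h1 : (n : ℝ) * δ / 2 ≤ Real.exp (n * β * δ) := by
    have h2 := Real.add_one_le_exp ((n : ℝ) * β * δ)
    have h3 : (n : ℝ) * δ * (1 / 2) ≤ n * δ * β := by gcongr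
    linarith
  rw [Real.exp_neg, ← div_eq_mul_inv, div_le_div_iff₀ (Real.exp_pos _) hδ]
  linarith

/-- One-particle separation estimate: the weighted density of a particle charges a neighbourhood of
the other particles only by a small proportion of its total mass. -/
theorem exists_separation_estimate (hbot : ∀ z, Q z ≠ ⊥) (hQm : Measurable Q)
    (hV : IsEffectivePotential Q S V) (hS : IsCompact S) (hSne : S.Nonempty)
    (hC2 : IsC2Near Q S) :
    ∃ A B : ℝ, 0 < A ∧ 0 < B ∧ ∀ (ι : Type) [DecidableEq ι] (n : ℕ) (β lam : ℝ),
      1 / 2 ≤ β → 0 < lam → ∀ (s : Finset ι) (a : ι → ℂ), s.card + 1 = n →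
        ∫⁻ w in {w | ∃ k ∈ s, √n * ‖w - a k‖ < A * lam ^ (-(1 / (2 * β)))},
          wt Q (n * β) (2 * β) (rootPoly s a) w ∂areaMeasure ≤
        ENNReal.ofReal (B / lam) *
          ∫⁻ w, wt Q (n * β) (2 * β) (rootPoly s a) w ∂areaMeasure := by
  obtain ⟨ε, K, hε, hK, happ⟩ := hC2.exists_affine_approx hS hSne
  obtain ⟨δ, hδ, hgap⟩ := hV.gap ε hε
  -- The exponential in $A$ cancels the loss $e^E$ after raising to the power $2\beta$. The second
  -- constant dominates $\tfrac43+\tfrac1{6\delta}$, the sum of the near and far contributions.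
  refine ⟨ε / 4 * Real.exp (-(K * ε ^ 2 / 2)), 2 + 1 / δ, by positivity, by positivity, ?_⟩
  intro ι _ n β lam hβ hlam s a hs
  set A := ε / 4 * Real.exp (-(K * ε ^ 2 / 2))
  set W := wt Q (n * β) (2 * β) (rootPoly s a)
  set I := ∫⁻ w, W w ∂areaMeasure
  set t := A * lam ^ (-(1 / (2 * β)))
  set bad := {w : ℂ | ∃ k ∈ s, √n * ‖w - a k‖ < t}
  -- For $\lambda\le1$ the claim is trivial, as $B\ge1$. For $\lambda>1$ one gets
  -- $t\le\varepsilon/4$, hence $d\le r/4$.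
  rcases le_or_gt lam 1 with hlam1 | hlam1
  · refine (setLIntegral_le_lintegral _ _).trans (le_mul_of_one_le_left zero_le ?_)
    rw [ENNReal.one_le_ofReal, one_le_div hlam]
    have : 0 < 1 / δ := by positivity
    linarith
  have hWm : Measurable W := measurable_wt hQm _ _ (differentiable_rootPoly s a).continuous.measurable
  have hn0 : (0 : ℝ) < n := by rw [← hs]; positivity
  have hn1 : (1 : ℝ) ≤ n := by rw [← hs]; simp
  have hsq : 0 < √(n : ℝ) := Real.sqrt_pos.2 hn0
  have hsq1 : 1 ≤ √(n : ℝ) := Real.one_le_sqrt.2 hn1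
  have hβ0 : 0 < β := by linarith
  -- At this scale the exponent error $n\beta Kr^2=\beta K\varepsilon^2$ is independent of $n$.
  set r := ε / √(n : ℝ)
  set d := t / √(n : ℝ)
  have hr : 0 < r := by positivity
  have hrε : r ≤ ε := div_le_self hε.le hsq1
  have ht0 : 0 < t := by positivity
  have htA : t ≤ ε / 4 := by
    have h1 : lam ^ (-(1 / (2 * β))) ≤ 1 :=
      Real.rpow_le_one_of_one_le_of_nonpos hlam1.le (by
        have : 0 < 1 / (2 * β) := by positivity
        linarith)
    have h2 : Real.exp (-(K * ε ^ 2 / 2)) ≤ 1 := Real.exp_le_one_iff.2 (by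
      have : 0 ≤ K * ε ^ 2 / 2 := by positivity
      linarith)
    calc t = ε / 4 * Real.exp (-(K * ε ^ 2 / 2)) * lam ^ (-(1 / (2 * β))) := rfl
      _ ≤ ε / 4 * 1 * 1 := by gcongr
      _ = _ := by ring
  have hdr : d ≤ r / 4 := by
    calc d ≤ (ε / 4) / √(n : ℝ) := div_le_div_of_nonneg_right htA hsq.le
      _ = r / 4 := by ring
  have hr2 : r ^ 2 = ε ^ 2 / n := by rw [div_pow, Real.sq_sqrt hn0.le]
  set E := β * K * ε ^ 2
  have hE : n * β * (K * r ^ 2) ≤ E := by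
    rw [hr2]
    refine le_of_eq ?_
    simp only [E]
    field_simp
  have hfactor : (4 * d / r) ^ (2 * β) * Real.exp E = 1 / lam := by
    have h1 : 4 * d / r = Real.exp (-(K * ε ^ 2 / 2)) * lam ^ (-(1 / (2 * β))) := by
      simp only [d, r, t, A]
      field_simp
    rw [h1, Real.mul_rpow (by positivity) (by positivity), ← Real.exp_mul, ← Real.rpow_mul hlam.le]
    rw [show -(1 / (2 * β)) * (2 * β) = -1 by field_simp, Real.rpow_neg_one, mul_right_comm,
      ← Real.exp_add]
    rw [show -(K * ε ^ 2 / 2) * (2 * β) + E = 0 by simp only [E]; ring]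
    simp
  have hbad : ∀ w ∈ bad, ∃ k ∈ s, ‖w - a k‖ ≤ d := by
    rintro w ⟨k, hk, hkw⟩
    refine ⟨k, hk, ?_⟩
    rw [le_div_iff₀ hsq, mul_comm]
    exact hkw.le
  set N := {w : ℂ | Metric.infDist w S < ε}
  have hN : MeasurableSet N :=
    (isOpen_lt (Metric.continuous_infDist_pt S) continuous_const).measurableSet
  have hbadm : MeasurableSet bad := by
    have : bad = ⋃ k ∈ s, {w : ℂ | √n * ‖w - a k‖ < t} := by
      ext w; simp [bad]
    rw [this]
    refine Finset.measurableSet_biUnion _ fun k _ => measurableSet_lt (by fun_prop) (by fun_prop)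
  -- Integrating the pointwise bound in $w$ turns local masses into $r^2$ times the total one; the
  -- powers of $r$ cancel and leave $\tfrac43$.
  have hnear : ∫⁻ w in bad ∩ N, W w ∂areaMeasure ≤ ENNReal.ofReal (4 / 3 / lam) * I := by
    refine le_of_ofReal_mul_le (c := 3 / 4 * r ^ 2) (by positivity) ?_
    rw [← lintegral_const_mul' _ _ ENNReal.ofReal_ne_top]
    calc _ ≤ ∫⁻ w in bad ∩ N, ENNReal.ofReal (1 / lam) *
          ∫⁻ z in Metric.ball w r, W z ∂areaMeasure ∂areaMeasure := by
          refine setLIntegral_mono' (hbadm.inter hN) fun w hw => ?_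
          obtain ⟨k, hk, hkd⟩ := hbad w hw.1
          obtain ⟨hfin, b, hb⟩ := happ w hw.2
          rw [← hfactor]
          exact wt_le_of_near_root hbot hfin hb hK hr hrε (by positivity) (by linarith) hE hk hkd hdr
      _ ≤ ∫⁻ w, ENNReal.ofReal (1 / lam) *
          ∫⁻ z in Metric.ball w r, W z ∂areaMeasure ∂areaMeasure := setLIntegral_le_lintegral _ _
      _ = _ := by
          rw [lintegral_const_mul' _ _ ENNReal.ofReal_ne_top, lintegral_setLIntegral_ball hWm,
            ← mul_assoc, ← ENNReal.ofReal_pow hr.le, ← ENNReal.ofReal_mul (by positivity)]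
          congr 2
          field_simp
  -- At most $n$ discs of radius $d\le\varepsilon/(4\sqrt n)$: the area is bounded uniformly in $n$.
  have harea : areaMeasure bad ≤ ENNReal.ofReal (ε ^ 2 / 16) := by
    have hsub : bad ⊆ ⋃ k ∈ s, Metric.ball (a k) d := by
      rintro w ⟨k, hk, hkw⟩
      refine Set.mem_biUnion hk ?_
      rw [Metric.mem_ball, dist_eq_norm, lt_div_iff₀ hsq, mul_comm]
      exact hkw
    calc areaMeasure bad ≤ ∑ k ∈ s, areaMeasure (Metric.ball (a k) d) :=
          (measure_mono hsub).trans (measure_biUnion_finset_le _ _)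
      _ = ENNReal.ofReal (s.card * d ^ 2) := by
          simp only [areaMeasure_ball, Finset.sum_const, nsmul_eq_mul]
          rw [ENNReal.ofReal_mul (by positivity), ENNReal.ofReal_natCast,
            ENNReal.ofReal_pow (by positivity)]
      _ ≤ _ := by
          refine ENNReal.ofReal_le_ofReal ?_
          have h1 : d ^ 2 ≤ ε ^ 2 / (16 * n) := by
            calc d ^ 2 ≤ (r / 4) ^ 2 := by gcongr
              _ = ε ^ 2 / (16 * n) := by rw [div_pow, hr2]; field_simp; norm_num
          have h2 : (s.card : ℝ) ≤ n := by rw [← hs]; push_cast; linarith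
          calc s.card * d ^ 2 ≤ n * (ε ^ 2 / (16 * n)) := by gcongr
            _ = _ := by field_simp
  -- Here the bound is pointwise by the total mass, so $1/r^2$ leaves a factor $n$; it is absorbed
  -- by $ne^{-n\beta\delta}\le2/\delta$, valid for $\beta\ge\tfrac12$.
  have hfar : ∫⁻ w in bad \ N, W w ∂areaMeasure ≤ ENNReal.ofReal (1 / (6 * δ) / lam) * I := by
    refine le_of_ofReal_mul_le (c := 3 / 4 * r ^ 2) (by positivity) ?_
    rw [← lintegral_const_mul' _ _ ENNReal.ofReal_ne_top]
    calc _ ≤ ∫⁻ w in bad \ N, ENNReal.ofReal (1 / lam * Real.exp (-(n * β * δ))) * I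
          ∂areaMeasure := by
          refine setLIntegral_mono' (hbadm.diff hN) fun w hw => ?_
          obtain ⟨k, hk, hkd⟩ := hbad w hw.1
          rw [← hfactor]
          exact wt_le_of_far_root hbot hV hS.isClosed hSne hε happ hK hgap hβ hs hr hrε hE
            (not_lt.1 hw.2) hk hkd hdr
      _ = ENNReal.ofReal (1 / lam * Real.exp (-(n * β * δ))) * I * areaMeasure (bad \ N) := by
          rw [setLIntegral_const]
      _ ≤ ENNReal.ofReal (1 / lam * Real.exp (-(n * β * δ))) * I * ENNReal.ofReal (ε ^ 2 / 16) := by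
          gcongr
          exact (measure_mono Set.sdiff_subset).trans harea
      _ = ENNReal.ofReal (1 / lam * Real.exp (-(n * β * δ)) * (ε ^ 2 / 16)) * I := by
          rw [mul_right_comm, ← ENNReal.ofReal_mul (by positivity)]
      _ ≤ _ := by
          refine mul_le_mul_left (ENNReal.ofReal_le_ofReal ?_) _
          have h1 := natCast_mul_exp_le (n := n) hβ hδ
          rw [hr2]
          calc 1 / lam * Real.exp (-(n * β * δ)) * (ε ^ 2 / 16)
              = ε ^ 2 / (16 * lam * n) * (n * Real.exp (-(n * β * δ))) := by field_simp
            _ ≤ ε ^ 2 / (16 * lam * n) * (2 / δ) := by gcongr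
            _ = _ := by field_simp; norm_num
  calc ∫⁻ w in bad, W w ∂areaMeasure
      = ∫⁻ w in bad ∩ N, W w ∂areaMeasure + ∫⁻ w in bad \ N, W w ∂areaMeasure :=
        (lintegral_inter_add_sdiff _ _ hN).symm
    _ ≤ ENNReal.ofReal (4 / 3 / lam) * I + ENNReal.ofReal (1 / (6 * δ) / lam) * I :=
        add_le_add hnear hfar
    _ = ENNReal.ofReal (4 / 3 / lam + 1 / (6 * δ) / lam) * I := by
        rw [← add_mul, ENNReal.ofReal_add (by positivity) (by positivity)]
    _ ≤ _ := by
        gcongr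
        rw [← add_div]
        gcongr
        · norm_num
        · linarith

end Separation

/-! ### The Boltzmann-Gibbs measure -/

lemma exp_neg_mul_add {β : ℝ} (hβ : 0 < β) {x y : EReal} (hx : x ≠ ⊥) (hy : y ≠ ⊥) :
    EReal.exp (-((β : EReal) * (x + y))) =
      EReal.exp (-((β : EReal) * x)) * EReal.exp (-((β : EReal) * y)) := by
  induction x with
  | bot => exact absurd rfl hx
  | top => simp [EReal.top_add_of_ne_bot hy, EReal.coe_mul_top_of_pos hβ]
  | coe x =>
    induction y with
    | bot => exact absurd rfl hy
    | top => simp [EReal.coe_mul_top_of_pos hβ]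
    | coe y =>
      rw [← EReal.exp_add]
      congr 1
      norm_cast
      ring

lemma sum_ne_bot {ι : Type*} {s : Finset ι} {f : ι → EReal} (hf : ∀ i, f i ≠ ⊥) :
    ∑ i ∈ s, f i ≠ ⊥ := by
  classical
  induction s using Finset.induction_on with
  | empty => simp
  | insert i s hi ih =>
    rw [Finset.sum_insert hi, Ne, EReal.add_eq_bot_iff]
    exact not_or.2 ⟨hf i, ih⟩

lemma exp_neg_mul_sum {ι : Type*} {β : ℝ} (hβ : 0 < β) {s : Finset ι} {f : ι → EReal}
    (hf : ∀ i, f i ≠ ⊥) :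
    EReal.exp (-((β : EReal) * ∑ i ∈ s, f i)) = ∏ i ∈ s, EReal.exp (-((β : EReal) * f i)) := by
  classical
  induction s using Finset.induction_on with
  | empty => simp
  | insert i s hi ih =>
    rw [Finset.sum_insert hi, Finset.prod_insert hi, exp_neg_mul_add hβ (hf i) (sum_ne_bot hf), ih]

lemma exp_neg_mul_logKernel (β : ℝ) (z w : ℂ) :
    EReal.exp (-((β : EReal) * logKernel z w)) = ‖z - w‖ₑ ^ β := by
  rw [logKernel, mul_neg, neg_neg, ← ENNReal.log_rpow, ENNReal.exp_log, edist_eq_enorm_sub]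

lemma logKernel_ne_bot (z w : ℂ) : logKernel z w ≠ ⊥ := by
  rw [logKernel, Ne, EReal.neg_eq_bot_iff, ENNReal.log_eq_top_iff]
  exact edist_ne_top z w

lemma enorm_rootPoly {ι : Type*} (s : Finset ι) (a : ι → ℂ) (z : ℂ) :
    ‖rootPoly s a z‖ₑ = ∏ k ∈ s, ‖z - a k‖ₑ := by
  simp only [rootPoly, enorm_eq_nnnorm, nnnorm_prod, ENNReal.ofNNReal_finsetProd]

lemma boltzmannFactor_eq_prod {Q : ℂ → EReal} (hbot : ∀ z, Q z ≠ ⊥) {n : ℕ} (hn : 0 < n) {β : ℝ}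
    (hβ : 0 < β) (ζ : Fin n → ℂ) :
    boltzmannFactor Q n β ζ = (∏ i, ∏ k ∈ Finset.univ.erase i, ‖ζ i - ζ k‖ₑ ^ β) *
      ∏ i, EReal.exp (-(((n * β : ℝ) : EReal) * Q (ζ i))) := by
  have hn' : (0 : ℝ) < n * β := by positivity
  have h1 : ∀ i, ∑ k ∈ Finset.univ.erase i, logKernel (ζ i) (ζ k) ≠ ⊥ :=
    fun i => sum_ne_bot fun k => logKernel_ne_bot _ _
  have h2 : (n : EReal) * ∑ j, Q (ζ j) ≠ ⊥ := by
    rw [EReal.mul_ne_bot]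
    refine ⟨.inl (EReal.natCast_ne_bot n), .inr (sum_ne_bot fun i => hbot _),
      .inl (EReal.natCast_ne_top n), .inl (by positivity)⟩
  rw [boltzmannFactor, hamiltonian, exp_neg_mul_add hβ (sum_ne_bot h1) h2, exp_neg_mul_sum hβ h1]
  congr 1
  · refine Finset.prod_congr rfl fun i _ => ?_
    rw [exp_neg_mul_sum hβ fun k => logKernel_ne_bot _ _]
    simp only [exp_neg_mul_logKernel]
  · rw [← exp_neg_mul_sum hn' fun i => hbot _, ← mul_assoc, mul_comm (n : ℝ), EReal.coe_mul]
    rfl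

lemma measurable_boltzmannFactor {Q : ℂ → EReal} (hbot : ∀ z, Q z ≠ ⊥) (hQm : Measurable Q) {n : ℕ}
    (hn : 0 < n) {β : ℝ} (hβ : 0 < β) : Measurable (boltzmannFactor Q n β) := by
  rw [funext (boltzmannFactor_eq_prod hbot hn hβ)]
  refine .mul ?_ ?_
  · refine Finset.measurable_prod _ fun i _ => Finset.measurable_prod _ fun k _ => ?_
    fun_prop
  · exact Finset.measurable_prod _ fun i _ =>
      ((hQm.comp (measurable_pi_apply i)).const_mul _).neg.ereal_exp

/-- The Boltzmann factor as a function of one particle is a multiple of a weighted polynomial. -/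
lemma exists_boltzmannFactor_update {Q : ℂ → EReal} (hbot : ∀ z, Q z ≠ ⊥) {n : ℕ} (hn : 0 < n)
    {β : ℝ} (hβ : 0 < β) (ζ : Fin n → ℂ) (j : Fin n) :
    ∃ C : ℝ≥0∞, ∀ z, boltzmannFactor Q n β (Function.update ζ j z) =
      C * wt Q (n * β) (2 * β) (rootPoly (Finset.univ.erase j) ζ) z := by
  refine ⟨(∏ i ∈ Finset.univ.erase j, ∏ k ∈ (Finset.univ.erase i).erase j, ‖ζ i - ζ k‖ₑ ^ β) *
    ∏ i ∈ Finset.univ.erase j, EReal.exp (-(((n * β : ℝ) : EReal) * Q (ζ i))), fun z => ?_⟩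
  have hu : ∀ i ∈ Finset.univ.erase j, Function.update ζ j z i = ζ i := fun i hi =>
    Function.update_of_ne (Finset.ne_of_mem_erase hi) _ _
  rw [boltzmannFactor_eq_prod hbot hn hβ,
    ← Finset.mul_prod_erase _ _ (Finset.mem_univ j), ← Finset.mul_prod_erase _ _ (Finset.mem_univ j)]
  have h1 : ∏ k ∈ Finset.univ.erase j, ‖Function.update ζ j z j - Function.update ζ j z k‖ₑ ^ β =
      ‖rootPoly (Finset.univ.erase j) ζ z‖ₑ ^ β := by
    rw [enorm_rootPoly, ← ENNReal.prod_rpow_of_nonneg hβ.le]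
    refine Finset.prod_congr rfl fun k hk => ?_
    rw [hu k hk, Function.update_self]
  -- Each pair containing $j$ occurs twice in the ordered product, once here and once in the row of
  -- $j$, whence the exponent $2\beta$.
  have h2 : ∏ i ∈ Finset.univ.erase j, ∏ k ∈ Finset.univ.erase i,
      ‖Function.update ζ j z i - Function.update ζ j z k‖ₑ ^ β =
      ‖rootPoly (Finset.univ.erase j) ζ z‖ₑ ^ β *
        ∏ i ∈ Finset.univ.erase j, ∏ k ∈ (Finset.univ.erase i).erase j, ‖ζ i - ζ k‖ₑ ^ β := by
    rw [enorm_rootPoly, ← ENNReal.prod_rpow_of_nonneg hβ.le, ← Finset.prod_mul_distrib]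
    refine Finset.prod_congr rfl fun i hi => ?_
    have hji : j ∈ Finset.univ.erase i :=
      Finset.mem_erase.2 ⟨(Finset.ne_of_mem_erase hi).symm, Finset.mem_univ _⟩
    rw [← Finset.mul_prod_erase _ _ hji, hu i hi, Function.update_self, enorm_sub_rev]
    congr 1
    refine Finset.prod_congr rfl fun k hk => ?_
    rw [Function.update_of_ne (Finset.ne_of_mem_erase hk)]
  have h3 : ∏ i ∈ Finset.univ.erase j,
        EReal.exp (-(((n * β : ℝ) : EReal) * Q (Function.update ζ j z i))) =
      ∏ i ∈ Finset.univ.erase j, EReal.exp (-(((n * β : ℝ) : EReal) * Q (ζ i))) :=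
    Finset.prod_congr rfl fun i hi => by rw [hu i hi]
  rw [h1, h2, h3, Function.update_self, wt, two_mul β, ENNReal.rpow_add_of_nonneg _ _ hβ.le hβ.le]
  ring

/-! ### Crowded configurations. -/

/-- The configurations for which the particle `j` is closer than `t / √n` to another particle. -/
def crowded (n : ℕ) (t : ℝ) (j : Fin n) : Set (Fin n → ℂ) :=
  {ζ | ∃ k ∈ Finset.univ.erase j, √(n : ℝ) * ‖ζ j - ζ k‖ < t}

lemma measurableSet_crowded (n : ℕ) (t : ℝ) (j : Fin n) : MeasurableSet (crowded n t j) := by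
  have : crowded n t j = ⋃ k ∈ Finset.univ.erase j, {ζ | √(n : ℝ) * ‖ζ j - ζ k‖ < t} := by
    ext; simp [crowded]
  rw [this]
  exact Finset.measurableSet_biUnion _ fun k _ => measurableSet_lt (by fun_prop) (by fun_prop)

lemma le_spacing_of_notMem_crowded {n : ℕ} {t : ℝ} {ζ : Fin n → ℂ} (hn : 0 < n)
    (h : ∀ j, ζ ∉ crowded n t j) : ENNReal.ofReal t ≤ spacing n ζ := by
  have hsq : ENNReal.ofReal √(n : ℝ) ≠ 0 := by
    have : 0 < √(n : ℝ) := by positivity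
    simpa using this
  rw [spacing, mul_comm, ← ENNReal.div_le_iff_le_mul (.inl hsq) (.inl ENNReal.ofReal_ne_top)]
  refine le_iInf fun j => le_iInf fun k => le_iInf fun hjk => ?_
  rw [ENNReal.div_le_iff_le_mul (.inl hsq) (.inl ENNReal.ofReal_ne_top), mul_comm, edist_eq_enorm_sub,
    ← ofReal_norm, ← ENNReal.ofReal_mul (by positivity)]
  refine ENNReal.ofReal_le_ofReal (not_lt.1 fun hlt => h j ⟨k, ?_, hlt⟩)
  simpa using hjk.symm

/-- Tonelli in the coordinate $j$: with the other particles fixed, the one-particle estimate holds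
up to a common factor, and integrating it over them preserves the inequality. -/
lemma boltzmannGibbs_crowded_le {Q : ℂ → EReal} (hbot : ∀ z, Q z ≠ ⊥) (hQm : Measurable Q) {n : ℕ}
    {β t c : ℝ} (hβ : 0 < β) (j : Fin n)
    (hsep : ∀ a : Fin n → ℂ, ∫⁻ w in {w | ∃ k ∈ Finset.univ.erase j, √n * ‖w - a k‖ < t},
        wt Q (n * β) (2 * β) (rootPoly (Finset.univ.erase j) a) w ∂areaMeasure ≤
      ENNReal.ofReal c *
        ∫⁻ w, wt Q (n * β) (2 * β) (rootPoly (Finset.univ.erase j) a) w ∂areaMeasure) :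
    boltzmannGibbs Q n β (crowded n t j) ≤
      ENNReal.ofReal c * boltzmannGibbs Q n β Set.univ := by
  have hn : 0 < n := j.pos
  have hm := measurable_boltzmannFactor hbot hQm hn hβ
  have hc := measurableSet_crowded n t j
  have hkey : ∫⁻ ζ, (crowded n t j).indicator (boltzmannFactor Q n β) ζ
        ∂(Measure.pi fun _ : Fin n => areaMeasure) ≤
      ∫⁻ ζ, ENNReal.ofReal c * boltzmannFactor Q n β ζ
        ∂(Measure.pi fun _ : Fin n => areaMeasure) := by
    refine lintegral_le_of_lmarginal_le {j} (hm.indicator hc) (hm.const_mul _) ?_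
    rw [lmarginal_singleton, lmarginal_singleton]
    intro ζ
    obtain ⟨C, hC⟩ := exists_boltzmannFactor_update hbot hn hβ ζ j
    set u := rootPoly (Finset.univ.erase j) ζ
    have hW : Measurable (wt Q (n * β) (2 * β) u) :=
      measurable_wt hQm _ _ (differentiable_rootPoly _ _).continuous.measurable
    have hbad : MeasurableSet {w | ∃ k ∈ Finset.univ.erase j, √(n : ℝ) * ‖w - ζ k‖ < t} := by
      have : {w | ∃ k ∈ Finset.univ.erase j, √(n : ℝ) * ‖w - ζ k‖ < t} =
          ⋃ k ∈ Finset.univ.erase j, {w | √(n : ℝ) * ‖w - ζ k‖ < t} := by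
        ext; simp
      rw [this]
      exact Finset.measurableSet_biUnion _ fun k _ => measurableSet_lt (by fun_prop) (by fun_prop)
    have hind : ∀ z, (crowded n t j).indicator (boltzmannFactor Q n β) (Function.update ζ j z) =
        C * ({w | ∃ k ∈ Finset.univ.erase j, √(n : ℝ) * ‖w - ζ k‖ < t}).indicator
          (wt Q (n * β) (2 * β) u) z := fun z => by
      have hiff : Function.update ζ j z ∈ crowded n t j ↔
          z ∈ {w | ∃ k ∈ Finset.univ.erase j, √(n : ℝ) * ‖w - ζ k‖ < t} := by
        refine exists_congr fun k => and_congr_right fun hk => ?_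
        rw [Function.update_self, Function.update_of_ne (Finset.ne_of_mem_erase hk)]
      by_cases hz : Function.update ζ j z ∈ crowded n t j
      · rw [Set.indicator_of_mem hz, Set.indicator_of_mem (hiff.1 hz), hC]
      · rw [Set.indicator_of_notMem hz, Set.indicator_of_notMem (mt hiff.2 hz), mul_zero]
    simp only [hind, hC]
    rw [lintegral_const_mul _ (hW.indicator hbad), lintegral_indicator hbad,
      lintegral_const_mul _ (hW.const_mul C), lintegral_const_mul _ hW, mul_left_comm]
    exact mul_le_mul_right (hsep ζ) C
  rw [lintegral_indicator hc, lintegral_const_mul _ hm] at hkey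
  rw [boltzmannGibbs, Measure.smul_apply, Measure.smul_apply, withDensity_apply _ hc,
    withDensity_apply _ MeasurableSet.univ, Measure.restrict_univ, smul_eq_mul, smul_eq_mul,
    mul_left_comm]
  exact mul_le_mul_right hkey _

/-- Quantitative separation in the Coulomb gas. -/
theorem exists_boltzmannGibbs_crowded_le {Q : ℂ → EReal} {σ : Measure ℂ}
    (hQ : IsExternalPotential Q) (hσ : IsEquilibriumMeasure Q σ) (hC2 : IsC2Near Q σ.support)
    (hcoin : ∀ z, z ∉ σ.support → (⨆ f ∈ obstacleClass Q, f z) < Q z) :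
    ∃ A B : ℝ, 0 < A ∧ 0 < B ∧ ∀ (n : ℕ) (β lam : ℝ), 1 / 2 ≤ β → 0 < lam →
      boltzmannGibbs Q n β (⋃ j, crowded n (A * lam ^ (-(1 / (2 * β)))) j) ≤
        ENNReal.ofReal (B * (n / lam)) * boltzmannGibbs Q n β Set.univ := by
  obtain ⟨hS, hSne, V, hV⟩ := exists_isEffectivePotential hQ hσ hC2 hcoin
  have hQm : Measurable Q := hQ.lsc.measurable
  obtain ⟨A, B, hA, hB, h⟩ := exists_separation_estimate hQ.ne_bot hQm hV hS hSne hC2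
  refine ⟨A, B, hA, hB, fun n β lam hβ hlam => ?_⟩
  refine (measure_iUnion_fintype_le _ _).trans ?_
  calc _ ≤ ∑ j : Fin n, ENNReal.ofReal (B / lam) * boltzmannGibbs Q n β Set.univ := by
        refine Finset.sum_le_sum fun j _ => ?_
        refine boltzmannGibbs_crowded_le hQ.ne_bot hQm (by linarith) j fun a => ?_
        refine h (Fin n) n β lam hβ hlam _ a ?_
        rw [Finset.card_erase_of_mem (Finset.mem_univ j), Finset.card_univ, Fintype.card_fin]
        exact Nat.sub_add_cancel j.pos
    _ = _ := by
        rw [Finset.sum_const, Finset.card_univ, Fintype.card_fin, nsmul_eq_mul, ← mul_assoc,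
          ← ENNReal.ofReal_natCast, ← ENNReal.ofReal_mul (by positivity)]
        congr 2
        ring

end

end CoulombGas

/-! ### The two separation statements. -/

theorem theorem1 (Q : ℂ → EReal) (hQ : CoulombGas.IsExternalPotential Q)
    (σ : Measure ℂ) (hσ : CoulombGas.IsEquilibriumMeasure Q σ)
    (hC2 : CoulombGas.IsC2Near Q σ.support)
    (hreg : CoulombGas.IsRegularDroplet Q σ.support) :
    (∃ m : ℝ, 0 < m ∧ ∀ c : ℝ, 0 < c → ∀ β : ℕ+ → ℝ,
      (∀ n : ℕ+, c * Real.log (n : ℕ) ≤ β n) →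
      ∀ [∀ n : ℕ+, IsProbabilityMeasure (CoulombGas.boltzmannGibbs Q n (β n))],
      ∀ᵐ ζ : (n : ℕ+) → (Fin n → ℂ)
        ∂(Measure.infinitePi fun n : ℕ+ => CoulombGas.boltzmannGibbs Q n (β n)),
        ENNReal.ofReal (m * Real.exp (-(3 / (2 * c)))) ≤
          liminf (fun n : ℕ+ => CoulombGas.spacing n (ζ n)) atTop) ∧
    (∃ a b : ℝ, 0 < a ∧ 0 < b ∧ ∀ β : ℝ, 1 / 2 ≤ β → ∀ n : ℕ+,
      IsProbabilityMeasure (CoulombGas.boltzmannGibbs Q n β) → ∀ lam : ℝ, 0 < lam →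
      1 - b * ((n : ℕ) / lam) ≤
        (CoulombGas.boltzmannGibbs Q n β).real
          {ζ | ENNReal.ofReal (a * lam ^ (-(1 / (2 * β)))) ≤ CoulombGas.spacing n ζ}) := by
  obtain ⟨A, B, hA, hB, h⟩ :=
    CoulombGas.exists_boltzmannGibbs_crowded_le hQ hσ hC2 hreg.coincidence
  refine ⟨⟨A, hA, fun c hc β hβ hP => ?_⟩, A, B, hA, hB, fun β hβ n hP lam hlam => ?_⟩
  -- The choice $\lambda=n^3$ makes the failure probability $O(n^{-2})$, which is summable, and is
  -- the source of the $3$ in $e^{-3/(2c)}$.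
  · set r : ℕ+ → ℝ := fun n => A * ((n : ℕ) ^ 3 : ℝ) ^ (-(1 / (2 * β n)))
    -- The estimate needs $\beta_n\ge\tfrac12$, true only eventually, as $c\log n\to\infty$; the
    -- events for smaller $n$ are made empty.
    obtain ⟨N, hN⟩ : ∃ N : ℕ+, ∀ n, N ≤ n → 1 / 2 ≤ β n := by
      have hlim : Tendsto (fun n : ℕ => c * Real.log n) atTop atTop :=
        (Real.tendsto_log_atTop.comp tendsto_natCast_atTop_atTop).const_mul_atTop hc
      obtain ⟨N, hN⟩ := (hlim.eventually_ge_atTop (1 / 2)).exists_forall_of_atTop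
      refine ⟨N.succPNat, fun n hn => (hN n ?_).trans (hβ n)⟩
      have : N.succPNat ≤ n := hn
      have h2 : N + 1 ≤ (n : ℕ) := by exact_mod_cast (PNat.coe_le_coe _ _).2 this
      omega
    set bad : (n : ℕ+) → Set (Fin n → ℂ) := fun n => ⋃ j, CoulombGas.crowded n (r n) j
    have hbadm : ∀ n, MeasurableSet (bad n) := fun n =>
      MeasurableSet.iUnion fun j => CoulombGas.measurableSet_crowded _ _ j
    set E : ℕ+ → Set ((n : ℕ+) → (Fin n → ℂ)) := fun n => {ζ | N ≤ n ∧ ζ n ∈ bad n}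
    have hE : ∀ n, (Measure.infinitePi fun n : ℕ+ => CoulombGas.boltzmannGibbs Q n (β n)) (E n) ≤
        ENNReal.ofReal (B * (1 / ((n : ℕ) : ℝ) ^ 2)) := fun n => by
      by_cases hn : N ≤ n
      · have hn0 : (0 : ℝ) < (n : ℕ) := by exact_mod_cast n.pos
        have h1 := h n (β n) (((n : ℕ) : ℝ) ^ 3) (hN n hn) (by positivity)
        rw [measure_univ, mul_one] at h1
        have h2 : E n = Function.eval n ⁻¹' bad n := by ext ζ; simp [E, hn]
        rw [h2, (measurePreserving_eval_infinitePi _ n).measure_preimage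
          (hbadm n).nullMeasurableSet]
        refine h1.trans_eq ?_
        congr 2
        field_simp
      · have h2 : E n = ∅ := by ext ζ; simp [E, hn]
        rw [h2, measure_empty]
        exact zero_le
    have hsum : ∑' n, (Measure.infinitePi fun n : ℕ+ => CoulombGas.boltzmannGibbs Q n (β n)) (E n) ≠
        ∞ := by
      have hs : Summable fun n : ℕ+ => B * (1 / ((n : ℕ) : ℝ) ^ 2) :=
        ((Real.summable_one_div_nat_pow.2 one_lt_two).mul_left B).comp_injective
          PNat.coe_injective
      exact ne_top_of_le_ne_top hs.tsum_ofReal_ne_top (ENNReal.tsum_le_tsum hE)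
    -- Borel–Cantelli: almost surely only finitely many bad events occur.
    filter_upwards [ae_finite_setOfPred_mem hsum] with ζ hζ
    refine le_liminf_of_le (by isBoundedDefault) ?_
    obtain ⟨M, hM⟩ := hζ.bddAbove
    -- Requiring $n>1$ gives $\log n>0$, so $\beta_n>0$ and $\log n/\beta_n\le1/c$.
    filter_upwards [eventually_gt_atTop M, eventually_ge_atTop N, eventually_gt_atTop 1]
      with n hnM hnN hn1
    have hgood : ζ n ∉ bad n := fun hmem => not_le.2 hnM (hM ⟨hnN, hmem⟩)
    refine le_trans ?_ (CoulombGas.le_spacing_of_notMem_crowded (t := r n) n.pos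
      fun j hj => hgood (Set.mem_iUnion.2 ⟨j, hj⟩))
    refine ENNReal.ofReal_le_ofReal (mul_le_mul_of_nonneg_left ?_ hA.le)
    have hn1' : (1 : ℝ) < (n : ℕ) := by exact_mod_cast (PNat.coe_lt_coe _ _).2 hn1
    have hlog : 0 < Real.log (n : ℕ) := Real.log_pos hn1'
    have hβn : 0 < β n := (mul_pos hc hlog).trans_le (hβ n)
    rw [Real.rpow_def_of_pos (by positivity), Real.log_pow]
    refine Real.exp_le_exp.2 ?_
    have : Real.log (n : ℕ) / β n ≤ 1 / c := by
      rw [div_le_div_iff₀ hβn hc, one_mul, mul_comm]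
      exact hβ n
    calc -(3 / (2 * c)) = -(3 / 2) * (1 / c) := by field_simp
      _ ≤ -(3 / 2) * (Real.log (n : ℕ) / β n) := by linarith
      _ = _ := by push_cast; field_simp
  · have h1 := h n β lam hβ hlam
    rw [measure_univ, mul_one] at h1
    set bad := ⋃ j : Fin n, CoulombGas.crowded n (A * lam ^ (-(1 / (2 * β)))) j
    have hbadm : MeasurableSet bad :=
      MeasurableSet.iUnion fun j => CoulombGas.measurableSet_crowded _ _ j
    have h2 : (CoulombGas.boltzmannGibbs Q n β).real bad ≤ B * ((n : ℕ) / lam) :=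
      ENNReal.toReal_le_of_le_ofReal (by positivity) h1
    calc 1 - B * ((n : ℕ) / lam) ≤ 1 - (CoulombGas.boltzmannGibbs Q n β).real bad := by linarith
      _ = (CoulombGas.boltzmannGibbs Q n β).real badᶜ := (probReal_compl_eq_one_sub hbadm).symm
      _ ≤ _ := measureReal_mono fun ζ hζ =>
        CoulombGas.le_spacing_of_notMem_crowded n.pos fun j hj => hζ (Set.mem_iUnion.2 ⟨j, hj⟩)
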